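/- Let $k$ be an algebraically closed field (for instance $k=\mathbb{C}$), let $Z$ be a variety over $k$ (an integral separated scheme of finite type), and let $\mathcal{F}$ be a globally generated vector bundle of rank $r$ on $Z$ whose space of global sections $F=H^0(Z,\mathcal{F})$ has finite dimension $d$. Let $\mathcal{M}$ be the kernel of the evaluation map $F\otimes\mathcal{O}_Z\to\mathcal{F}$. For a closed point $x\in Z$, regard the fibre $\mathcal{M}_x$ as a subspace of $F$ (the image of $\mathcal M_x\to F$). Let $W$ be a $k$-vector space of finite dimension $w\ge d$, let $0<\ell<w$, and let $G(\ell,W)$ be the Grassmannian of $\ell$-dimensional subspaces of $W$, with tautological subbundle $\mathcal{U}\subset W\otimes\mathcal{O}$ of rank $\ell$. (This is the $k$-scheme that represents the functor of rank $\ell$ subbundles of $W\otimes\mathcal{O}$, where a subbundle is a locally free subsheaf with locally free quotient; it exists, and its $k$-points are the $\ell$-dimensional subspaces of $W$. The Grassmannian bundle $G(\ell,\mathcal{E})\to Z$ of a vector bundle $\mathcal{E}$ on $Z$ is defined in the same way.) Let $\sigma\colon W\to F$ be a linear map, and let $s$ be the section of $\mathcal{F}\boxtimes\mathcal{U}^*=\mathcal{H}om(\mathrm{pr}_2^*\mathcal{U},\mathrm{pr}_1^*\mathcal{F})$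 on $Z\times G(\ell,W)$ that is given by the composite $$\mathrm{pr}_2^*\mathcal{U}\hookrightarrow W\otimes\mathcal{O}\xrightarrow{\ \sigma\ }F\otimes\mathcal{O}\to \mathrm{pr}_1^*\mathcal{F}.$$ Let $Z(s)\subset Z\times G(\ell,W)$ be its zero scheme, the largest closed subscheme on which $s$ vanishes. Then: 1. A closed point $(x,U)$ of $Z\times G(\ell,W)$ lies in $Z(s)$ if and only if $\sigma(U)\subset\mathcal{M}_x$. 2. Suppose that $\sigma$ is surjective, and let $K=\ker\sigma$. Then the projection $Z(s)\to Z$ is smooth; in particular, if $Z$ is smooth over $k$, then so is $Z(s)$. The projection $Z(s)\to Z$ is a Zariski locally trivial bundle with fibre $G(\ell,k^{w-r})$. More precisely, $K\otimes\mathcal{O}_Z\oplus\mathcal{M}$ is a vector bundle of rank $w-r$ on $Z$, and there is an isomorphism of $Z$-schemes $$Z(s)\simeq G(\ell,\,K\otimes\mathcal{O}_Z\oplus\mathcal{M}).$$ -/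

import Mathlib

open CategoryTheory AlgebraicGeometry

universe u

noncomputable section

namespace GrassmannZero

/-- The sheaf of modules `E` is free of rank `r` on some open neighbourhood of the point `x`. -/
def IsFreeNear {X : Scheme.{u}} (E : X.Modules) (x : X) (r : ℕ) : Prop :=
  ∃ U : X.Opens, x ∈ U ∧
    Nonempty (E.restrict U.ι ≅
      (SheafOfModules.free (R := (U : Scheme.{u}).ringCatSheaf) (ULift.{u} (Fin r)) :
        (U : Scheme.{u}).Modules))

/-- `E` is a vector bundle of rank `r`, i.e. a locally free sheaf of constant rank `r`. -/
def IsVectorBundle {X : Scheme.{u}} (E : X.Modules) (r : ℕ) : Prop :=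
  ∀ x : X, IsFreeNear E x r

/-- `j : S ⟶ E` is the inclusion of a rank `l` subbundle: a monomorphism from a vector bundle
of rank `l` whose cokernel is locally free of finite rank. -/
structure IsSubbundle {X : Scheme.{u}} {S E : X.Modules} (j : S ⟶ E) (l : ℕ) : Prop where
  mono : Mono j
  isVectorBundle : IsVectorBundle S l
  cokernel_free : ∀ x : X, ∃ m : ℕ, IsFreeNear (Limits.cokernel j) x m

/-- The canonical isomorphism `g^* p^* E ≅ f^* E` when `f = p ∘ g`. -/
def pullbackIso {T X Y : Scheme.{u}} {g : T ⟶ X} {p : X ⟶ Y} {f : T ⟶ Y} (h : g ≫ p = f)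
    (E : Y.Modules) :
    (Scheme.Modules.pullback g).obj ((Scheme.Modules.pullback p).obj E) ≅
      (Scheme.Modules.pullback f).obj E :=
  (Scheme.Modules.pullbackComp g p).app E ≪≫ (Scheme.Modules.pullbackCongr h).app E

/-- The Grassmannian bundle `G(l, E) → Z` of rank `l` subbundles of `E`, with its tautological
subbundle: every rank `l` subbundle of a pullback `f^* E` along `f : T → Z` is, as a subsheaf
of `f^* E`, the pullback of the tautological one by a unique `Z`-morphism `T → G(l, E)`. -/
structure GrassmannianBundle {Z : Scheme.{u}} (E : Z.Modules) (l : ℕ) where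
  scheme : Scheme.{u}
  proj : scheme ⟶ Z
  taut : scheme.Modules
  incl : taut ⟶ (Scheme.Modules.pullback proj).obj E
  isSubbundle : IsSubbundle incl l
  existsUnique_lift : ∀ (T : Scheme.{u}) (f : T ⟶ Z) (S : T.Modules)
    (j : S ⟶ (Scheme.Modules.pullback f).obj E), IsSubbundle j l →
      ∃! g : T ⟶ scheme, ∃ hg : g ≫ proj = f,
        ∃ e : (Scheme.Modules.pullback g).obj taut ≅ S,
          e.hom ≫ j = (Scheme.Modules.pullback g).map incl ≫ (pullbackIso hg E).hom

section Field

variable {k : Type u} [Field k]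

/-- The functor `V ↦ V ⊗ O_X` for a `k`-scheme `p : X → Spec k`. -/
def trivialBundle {X : Scheme.{u}} (p : X ⟶ Spec (.of k)) :
    ModuleCat.{u} (CommRingCat.of k) ⥤ X.Modules :=
  tilde.functor (.of k) ⋙ Scheme.Modules.pullback p

/-- The functor sending a sheaf of modules on a `k`-scheme `p : X → Spec k` to its `k`-vector
space of global sections. -/
def globalSections {X : Scheme.{u}} (p : X ⟶ Spec (.of k)) :
    X.Modules ⥤ ModuleCat.{u} (CommRingCat.of k) :=
  Scheme.Modules.pushforward p ⋙ moduleSpecΓFunctor (R := .of k)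

/-- The adjunction between `V ↦ V ⊗ O_X` and global sections. -/
def trivialAdjunction {X : Scheme.{u}} (p : X ⟶ Spec (.of k)) :
    trivialBundle p ⊣ globalSections p :=
  (tilde.adjunction (R := .of k)).comp (Scheme.Modules.pullbackPushforwardAdjunction p)

/-- The evaluation map `H⁰(X, F) ⊗ O_X → F`. -/
def evaluation {X : Scheme.{u}} (p : X ⟶ Spec (.of k)) (F : X.Modules) :
    (trivialBundle p).obj ((globalSections p).obj F) ⟶ F :=
  (trivialAdjunction p).counit.app F

/-- `F` is generated by its global sections. -/
def IsGloballyGenerated {X : Scheme.{u}} (p : X ⟶ Spec (.of k)) (F : X.Modules) : Prop :=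
  Epi (evaluation p F)

/-- The kernel bundle `M` of `H⁰(X, F) ⊗ O_X → F`. -/
def kernelBundle {X : Scheme.{u}} (p : X ⟶ Spec (.of k)) (F : X.Modules) : X.Modules :=
  Limits.kernel (evaluation p F)

/-- The inclusion `M → H⁰(X, F) ⊗ O_X`. -/
def kernelInclusion {X : Scheme.{u}} (p : X ⟶ Spec (.of k)) (F : X.Modules) :
    kernelBundle p F ⟶ (trivialBundle p).obj ((globalSections p).obj F) :=
  Limits.kernel.ι (evaluation p F)

/-- For `j : S → V ⊗ O_X` and a `k`-point `x` of `X`, the image of the fibre `S_x → V`. -/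
def fiberSubspace {X : Scheme.{u}} (p : X ⟶ Spec (.of k)) {V : ModuleCat.{u} (CommRingCat.of k)}
    {S : X.Modules} (j : S ⟶ (trivialBundle p).obj V)
    (x : Spec (.of k) ⟶ X) (hx : x ≫ p = 𝟙 _) : Submodule k V :=
  LinearMap.range (ModuleCat.Hom.hom
    ((moduleSpecΓFunctor (R := .of k)).map ((Scheme.Modules.pullback x).map j ≫
        (pullbackIso hx ((tilde.functor (.of k)).obj V)).hom ≫
        (Scheme.Modules.pullbackId _).hom.app ((tilde.functor (.of k)).obj V)) ≫
      (tilde.toTildeΓNatIso (R := .of k)).inv.app V))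

/-- The Grassmannian `G(l, W)` of `l`-dimensional subspaces of the `k`-vector space `W`. -/
abbrev Grassmannian (k : Type u) [Field k] (W : Type u) [AddCommGroup W] [Module k W] (l : ℕ) :=
  GrassmannianBundle ((tilde.functor (.of k)).obj (ModuleCat.of (CommRingCat.of k) W)) l

end Field

/-- The zero scheme of a section of `Hom(A, B)`, i.e. of a morphism `φ : A ⟶ B`: the ideal sheaf
of the largest closed subscheme on which `φ` restricts to zero. -/
def zeroIdeal {X : Scheme.{u}} {A B : X.Modules} (φ : A ⟶ B) : X.IdealSheafData :=
  sInf {I | (Scheme.Modules.pullback I.subschemeι).map φ = 0}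

section Section

variable {k : Type u} [Field k] {Z : Scheme.{u}} (p : Z ⟶ Spec (.of k)) (F : Z.Modules)
  {W : Type u} [AddCommGroup W] [Module k W] {l : ℕ} (Gr : Grassmannian k W l)
  (σ : W →ₗ[k] (globalSections p).obj F)

/-- The product `Z × G(l, W)` over `k`. -/
abbrev prodGr : Scheme.{u} := Limits.pullback p Gr.proj

/-- The section of `F ⊠ U^*` on `Z × G(l, W)` given by `σ : W → H⁰(Z, F)`, as a section of the
bundle `Hom(U, F)`, i.e. as a morphism from the pullback of `U` to the pullback of `F`:
the composite `U → W ⊗ O → H⁰(Z, F) ⊗ O → F`. -/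
def boxSection :
    (Scheme.Modules.pullback (Limits.pullback.snd p Gr.proj)).obj Gr.taut ⟶
      (Scheme.Modules.pullback (Limits.pullback.fst p Gr.proj)).obj F :=
  (Scheme.Modules.pullback (Limits.pullback.snd p Gr.proj)).map Gr.incl ≫
    (pullbackIso Limits.pullback.condition.symm _).hom ≫
    (trivialBundle (Limits.pullback.fst p Gr.proj ≫ p)).map (ModuleCat.ofHom σ) ≫
    (pullbackIso rfl ((tilde.functor (.of k)).obj ((globalSections p).obj F))).inv ≫
    (Scheme.Modules.pullback (Limits.pullback.fst p Gr.proj)).map (evaluation p F)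

/-- The zero locus `Z(s) ⊆ Z × G(l, W)`, as a closed subscheme. -/
def zeroLocus : Scheme.{u} := (zeroIdeal (boxSection p F Gr σ)).subscheme

/-- The inclusion `Z(s) → Z × G(l, W)`. -/
def zeroLocusι : zeroLocus p F Gr σ ⟶ prodGr p Gr := (zeroIdeal (boxSection p F Gr σ)).subschemeι

/-- The projection `Z(s) → Z`. -/
def zeroLocusProj : zeroLocus p F Gr σ ⟶ Z := zeroLocusι p F Gr σ ≫ Limits.pullback.fst p Gr.proj

end Section

end GrassmannZero

end

/-! A morphism `T → Z × G(ℓ, W)` over `f : T → Z` is a rank `ℓ` subbundle `S` of `W ⊗ O_T`, and the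
pullback of `s` to `T` is the composite `S → W ⊗ O_T → f^* F`. Hence `Z(s)` represents the
subbundles `S` that land in the kernel of `W ⊗ O_T → f^* F`.

Suppose that `σ` is surjective. Then `W ⊗ O_Z → F` is an epimorphism of vector bundles, and a linear
section of `σ` identifies its kernel with `N = K ⊗ O_Z ⊕ M` (`exists_isLimit_sectionMap`). An
epimorphism of vector bundles splits locally, so `N` is a vector bundle of rank `w - r`, its
formation commutes with base change, and `f^* N` is locally a direct summand of `W ⊗ O_T`
(`kernel_near`). A subsheaf of `f^* N` is therefore a subbundle of `f^* N` exactly when it is one of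
`W ⊗ O_T`. So `Z(s)` has the universal property of `G(ℓ, N)` (`GrassmannianBundle.ofKernel`).
Universal properties are unique and stable under base change, so a local trivialization of `N`
trivializes `Z(s)`. Smoothness is local on the base, and thus reduces to a trivial bundle.

Part 1 is the same observation at a single `k`-point and needs no surjectivity. As `Spec k` is
reduced, a point lies in a closed subscheme iff the morphism factors through it. Since `M` is
locally a direct summand, `M_x` is the kernel of `H⁰(Z, F) → F_x`, and over a field bundles are
vector spaces.

Two further facts carry the argument. First, the zero scheme, defined as an infimum of ideal
sheaves, represents the vanishing of `s` (`zeroIdeal_spec`): where both bundles are free, it is cut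
out by the matrix entries. Secondly, Grassmannians exist: over the terminal scheme the functor of
subbundles is a Zariski sheaf covered by finitely many open subfunctors represented by affine spaces
(`exists_universal`), and every trivial bundle is a base change from there. Both rest on computing
with bases of sheaves of modules, so that morphisms become matrices of global functions. -/

noncomputable section
namespace GrassmannZero

/-! ### The structure sheaf, its endomorphisms and its pullbacks. -/

/-- The structure sheaf as a sheaf of modules. -/
abbrev structureModule (X : Scheme.{u}) : X.Modules := SheafOfModules.unit X.ringCatSheaf

variable {X Y : Scheme.{u}}

/-- The global function by which an endomorphism of the structure sheaf acts. -/
def toGlobal (f : structureModule X ⟶ structureModule X) : Γ(X, ⊤) :=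
  (Scheme.Modules.Hom.app f ⊤).hom (1 : Γ(X, ⊤))

/-- A section `x` of `O` over `U` is `x • 1`, and `1` is the restriction of the global `1`, so
linearity and naturality leave only the image of the global `1` free. -/
theorem hom_structureModule_ext {M : X.Modules} {f g : structureModule X ⟶ M}
    (h : (Scheme.Modules.Hom.app f ⊤).hom (1 : Γ(X, ⊤)) =
      (Scheme.Modules.Hom.app g ⊤).hom (1 : Γ(X, ⊤))) : f = g := by
  apply Scheme.Modules.hom_ext
  intro U
  ext x
  have key : ∀ f : structureModule X ⟶ M, (Scheme.Modules.Hom.app f U).hom x =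
      (show Γ(X, U) from x) • (M.presheaf.map U.leTop.op).hom
        ((Scheme.Modules.Hom.app f ⊤).hom (1 : Γ(X, ⊤))) := by
    intro f
    have h1 := f.mapPresheaf.naturality U.leTop.op
    have h2 : (M.presheaf.map U.leTop.op).hom ((Scheme.Modules.Hom.app f ⊤).hom (1 : Γ(X, ⊤))) =
        (Scheme.Modules.Hom.app f U).hom (((structureModule X).presheaf.map U.leTop.op).hom
          (1 : Γ(X, ⊤))) := congr($(h1.symm).hom (1 : Γ(X, ⊤)))
    rw [h2]
    have h3 : ((structureModule X).presheaf.map U.leTop.op).hom (1 : Γ(X, ⊤)) = (1 : Γ(X, U)) :=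
      map_one (X.presheaf.map U.leTop.op).hom
    rw [h3]
    refine Eq.trans ?_ (f.app_smul (U := U) (show Γ(X, U) from x) (1 : Γ(X, U)))
    have : ((show Γ(X, U) from x) • (1 : Γ(X, U)) : Γ(X, U)) = x := mul_one _
    exact congrArg _ this.symm
  rw [key f, key g, h]

theorem toGlobal_injective : Function.Injective (toGlobal (X := X)) :=
  fun _ _ h => hom_structureModule_ext h

/-- Multiplication by a global function. -/
def scalar (a : Γ(X, ⊤)) : structureModule X ⟶ structureModule X :=
  (SheafOfModules.unitHomEquiv (R := X.ringCatSheaf) (structureModule X)).symm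
    ⟨fun U => (X.presheaf.map (Opposite.unop U).leTop.op).hom a, by
      intro U V i
      change (X.presheaf.map i).hom ((X.presheaf.map (Opposite.unop U).leTop.op).hom a) = _
      rw [← RingHom.comp_apply, ← CommRingCat.hom_comp, ← Functor.map_comp]
      rfl⟩

@[simp]
theorem toGlobal_scalar (a : Γ(X, ⊤)) : toGlobal (scalar a) = a := by
  have := (SheafOfModules.unitHomEquiv_apply_coe (R := X.ringCatSheaf) (structureModule X)
    (scalar a) (Opposite.op ⊤)).symm
  refine Eq.trans this ?_
  refine Eq.trans (congrArg (fun s => s.val (Opposite.op ⊤))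
    ((SheafOfModules.unitHomEquiv (R := X.ringCatSheaf) (structureModule X)).apply_symm_apply _)) ?_
  change (X.presheaf.map (𝟙 _)).hom a = a
  simp

@[simp]
theorem toGlobal_id : toGlobal (𝟙 (structureModule X)) = 1 := rfl

@[simp]
theorem toGlobal_zero : toGlobal (0 : structureModule X ⟶ structureModule X) = 0 := rfl

@[simp]
theorem toGlobal_add (f g : structureModule X ⟶ structureModule X) :
    toGlobal (f + g) = toGlobal f + toGlobal g := rfl

theorem toGlobal_comp (f g : structureModule X ⟶ structureModule X) :
    toGlobal (f ≫ g) = toGlobal f * toGlobal g := by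
  have h := g.app_smul (U := ⊤) (show Γ(X, ⊤) from toGlobal f) (1 : Γ(X, ⊤))
  refine Eq.trans ?_ h
  have : ((show Γ(X, ⊤) from toGlobal f) • (1 : Γ(X, ⊤)) : Γ(X, ⊤)) = toGlobal f := mul_one _
  exact congrArg _ this.symm

theorem toGlobal_sum {ι : Type*} (s : Finset ι)
    (f : ι → (structureModule X ⟶ structureModule X)) :
    toGlobal (∑ i ∈ s, f i) = ∑ i ∈ s, toGlobal (f i) :=
  map_sum (AddMonoidHom.mk' toGlobal toGlobal_add) f s

/-- Every open set lies in the preimage of `⊤`. Finality is the condition under which `g^* O_Y →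
O_X` is an isomorphism. -/
instance (g : X ⟶ Y) : (TopologicalSpace.Opens.map g.base).Final := by
  apply (config := {allowSynthFailures := true}) Functor.final_of_exists_of_isFiltered
  · intro V
    exact ⟨⊤, ⟨homOfLE le_top⟩⟩
  · intro d c s s'
    exact ⟨c, 𝟙 _, Subsingleton.elim _ _⟩

/-- The morphism `O_Y → g_* O_X` given by `g`. -/
def unitToPushforward (g : X ⟶ Y) :
    structureModule Y ⟶ (Scheme.Modules.pushforward g).obj (structureModule X) :=
  SheafOfModules.unitToPushforwardObjUnit g.toRingCatSheafHom

/-- The canonical morphism `g^* O_Y → O_X`. -/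
def pullbackUnitHom (g : X ⟶ Y) :
    (Scheme.Modules.pullback g).obj (structureModule Y) ⟶ structureModule X :=
  ((Scheme.Modules.pullbackPushforwardAdjunction g).homEquiv _ _).symm (unitToPushforward g)

instance (g : X ⟶ Y) : IsIso (pullbackUnitHom g) := by
  have h1 : (SheafOfModules.pushforward.{u} g.toRingCatSheafHom).IsRightAdjoint :=
    inferInstanceAs (Scheme.Modules.pushforward g).IsRightAdjoint
  have h2 : (TopologicalSpace.Opens.map g.base).Final := inferInstance
  exact @SheafOfModules.instIsIsoPullbackObjUnitToUnitOfFinal _ _ _ _ _ _ _ _ _ _ g.toRingCatSheafHom h1 h2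

/-- The canonical isomorphism `g^* O_Y ≅ O_X`. -/
def pullbackUnitIso (g : X ⟶ Y) :
    (Scheme.Modules.pullback g).obj (structureModule Y) ≅ structureModule X :=
  asIso (pullbackUnitHom g)

/-- After transposing along the adjunction both sides are morphisms out of `O_Y`, and each sends `1`
to the image of `toGlobal φ` under `g`. -/
theorem pullback_map_pullbackUnitHom (g : X ⟶ Y) (φ : structureModule Y ⟶ structureModule Y) :
    (Scheme.Modules.pullback g).map φ ≫ pullbackUnitHom g =
      pullbackUnitHom g ≫ scalar (g.appTop.hom (toGlobal φ)) := by
  apply ((Scheme.Modules.pullbackPushforwardAdjunction g).homEquiv _ _).injective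
  rw [Adjunction.homEquiv_naturality_left, Adjunction.homEquiv_naturality_right, pullbackUnitHom,
    Equiv.apply_symm_apply]
  apply hom_structureModule_ext
  have h1 := toGlobal_scalar (g.appTop.hom (toGlobal φ))
  refine Eq.trans (b := g.appTop.hom (toGlobal φ)) rfl ?_
  refine h1.symm.trans ?_
  change _ = (Scheme.Modules.Hom.app (scalar (g.appTop.hom (toGlobal φ))) ⊤).hom
    ((g.app ⊤).hom (1 : Γ(Y, ⊤)))
  rw [map_one]
  rfl

theorem toGlobal_pullback (g : X ⟶ Y) (φ : structureModule Y ⟶ structureModule Y) :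
    toGlobal ((pullbackUnitIso g).inv ≫ (Scheme.Modules.pullback g).map φ ≫
      (pullbackUnitIso g).hom) = g.appTop.hom (toGlobal φ) := by
  have : (pullbackUnitIso g).inv ≫ (Scheme.Modules.pullback g).map φ ≫ (pullbackUnitIso g).hom =
      scalar (g.appTop.hom (toGlobal φ)) := by
    rw [Iso.inv_comp_eq]
    exact pullback_map_pullbackUnitHom g φ
  rw [this, toGlobal_scalar]

end GrassmannZero
end

/-! ### Frames, and morphisms as matrices of global functions. -/

noncomputable section
namespace GrassmannZero
variable {X Y : Scheme.{u}}

/-- A finite basis of a sheaf of modules, with its dual basis. -/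
structure Frame (M : X.Modules) (ι : Type*) [Fintype ι] where
  e : ι → (structureModule X ⟶ M)
  p : ι → (M ⟶ structureModule X)
  e_p_self : ∀ i, e i ≫ p i = 𝟙 _
  e_p_ne : ∀ i j, i ≠ j → e i ≫ p j = 0
  total : ∑ i, p i ≫ e i = 𝟙 M

namespace Frame

variable {ι κ μ : Type*} [Fintype ι] [Fintype κ] [Fintype μ] {M N P : X.Modules}

theorem e_p_self_assoc (a : Frame M ι) (i : ι) {Q : X.Modules} (h : structureModule X ⟶ Q) :
    a.e i ≫ a.p i ≫ h = h := by
  rw [← Category.assoc, a.e_p_self, Category.id_comp]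

theorem e_p_ne_assoc (a : Frame M ι) (i j : ι) (hij : i ≠ j) {Q : X.Modules}
    (h : structureModule X ⟶ Q) : a.e i ≫ a.p j ≫ h = 0 := by
  rw [← Category.assoc, a.e_p_ne i j hij, Limits.zero_comp]

/-- Transport of a basis along an isomorphism. -/
def congr (a : Frame M ι) (f : M ≅ N) : Frame N ι where
  e i := a.e i ≫ f.hom
  p i := f.inv ≫ a.p i
  e_p_self i := by simp [a.e_p_self]
  e_p_ne i j h := by simp [a.e_p_ne i j h]
  total := by
    have : ∑ i, (f.inv ≫ a.p i) ≫ a.e i ≫ f.hom = f.inv ≫ (∑ i, a.p i ≫ a.e i) ≫ f.hom := by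
      simp [Preadditive.sum_comp, Preadditive.comp_sum]
    rw [this, a.total]; simp

/-- Change of the index type of a basis. -/
def reindex (a : Frame M ι) (f : κ ≃ ι) : Frame M κ where
  e i := a.e (f i)
  p i := a.p (f i)
  e_p_self _ := a.e_p_self _
  e_p_ne _ _ h := a.e_p_ne _ _ (fun h' => h (f.injective h'))
  total := (f.sum_comp (fun i => a.p i ≫ a.e i)).trans a.total

/-- The pullback of a basis. -/
def pullback {M : Y.Modules} (a : Frame M ι) (g : X ⟶ Y) :
    Frame ((Scheme.Modules.pullback g).obj M) ι where
  e i := (pullbackUnitIso g).inv ≫ (Scheme.Modules.pullback g).map (a.e i)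
  p i := (Scheme.Modules.pullback g).map (a.p i) ≫ (pullbackUnitIso g).hom
  e_p_self i := by simp [← Functor.map_comp_assoc, a.e_p_self]
  e_p_ne i j h := by simp [← Functor.map_comp_assoc, a.e_p_ne i j h]
  total := by
    simp [← Functor.map_comp, ← Functor.map_sum, a.total]

theorem hom_ext (a : Frame M ι) {f g : M ⟶ N} (h : ∀ i, a.e i ≫ f = a.e i ≫ g) : f = g := by
  rw [← Category.id_comp f, ← Category.id_comp g, ← a.total]
  simp [Preadditive.sum_comp, h]

theorem hom_ext' (a : Frame M ι) {f g : N ⟶ M} (h : ∀ i, f ≫ a.p i = g ≫ a.p i) : f = g := by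
  rw [← Category.comp_id f, ← Category.comp_id g, ← a.total]
  simp [Preadditive.comp_sum, reassoc_of% h]

/-- The matrix of a morphism, acting on row vectors. -/
def mat (a : Frame M ι) (b : Frame N κ) (φ : M ⟶ N) : Matrix ι κ Γ(X, ⊤) :=
  Matrix.of fun i j => toGlobal (a.e i ≫ φ ≫ b.p j)

theorem mat_apply (a : Frame M ι) (b : Frame N κ) (φ : M ⟶ N) (i : ι) (j : κ) :
    a.mat b φ i j = toGlobal (a.e i ≫ φ ≫ b.p j) := rfl

theorem mat_injective (a : Frame M ι) (b : Frame N κ) : Function.Injective (a.mat b) := by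
  intro f g h
  refine a.hom_ext fun i => b.hom_ext' fun j => ?_
  have : toGlobal (a.e i ≫ f ≫ b.p j) = toGlobal (a.e i ≫ g ≫ b.p j) :=
    congrFun (congrFun h i) j
  simpa using toGlobal_injective this

@[simp]
theorem mat_zero (a : Frame M ι) (b : Frame N κ) : a.mat b 0 = 0 := by
  ext i j; simp [mat]

theorem mat_eq_zero_iff (a : Frame M ι) (b : Frame N κ) {φ : M ⟶ N} : a.mat b φ = 0 ↔ φ = 0 :=
  ⟨fun h => a.mat_injective b (by rw [h, mat_zero]), fun h => by rw [h, mat_zero]⟩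

/-- Matrices act on row vectors, so composition in diagrammatic order is multiplication in the same
order. The proof inserts `∑ k, b.p k ≫ b.e k = 𝟙 N` between the two morphisms. -/
theorem mat_comp (a : Frame M ι) (b : Frame N κ) (c : Frame P μ) (φ : M ⟶ N) (ψ : N ⟶ P) :
    a.mat c (φ ≫ ψ) = a.mat b φ * b.mat c ψ := by
  ext i j
  rw [Matrix.mul_apply]
  simp only [mat_apply, ← toGlobal_comp, ← toGlobal_sum]
  congr 1
  have : φ ≫ ψ = φ ≫ (∑ k, b.p k ≫ b.e k) ≫ ψ := by rw [b.total]; simp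
  rw [this]
  simp [Preadditive.sum_comp, Preadditive.comp_sum]

@[simp]
theorem mat_id [DecidableEq ι] (a : Frame M ι) : a.mat a (𝟙 M) = 1 := by
  ext i j
  by_cases h : i = j
  · subst h; simp [mat, a.e_p_self]
  · simp [mat, a.e_p_ne _ _ h, h]

/-- The morphism with a given matrix. -/
def ofMat (a : Frame M ι) (b : Frame N κ) (A : Matrix ι κ Γ(X, ⊤)) : M ⟶ N :=
  ∑ i, ∑ j, a.p i ≫ scalar (A i j) ≫ b.e j

@[simp]
theorem mat_ofMat (a : Frame M ι) (b : Frame N κ) (A : Matrix ι κ Γ(X, ⊤)) :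
    a.mat b (a.ofMat b A) = A := by
  classical
  ext i j
  rw [mat_apply, ofMat]
  have : a.e i ≫ (∑ i, ∑ j, a.p i ≫ scalar (A i j) ≫ b.e j) ≫ b.p j = scalar (A i j) := by
    simp only [Preadditive.sum_comp, Preadditive.comp_sum, Category.assoc]
    rw [Finset.sum_eq_single i, Finset.sum_eq_single j]
    · simp [b.e_p_self, a.e_p_self_assoc]
    · intro j' _ h
      simp [b.e_p_ne _ _ h]
    · simp
    · intro i' _ h
      simp [a.e_p_ne_assoc _ _ h.symm]
    · simp
  rw [this, toGlobal_scalar]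

@[simp]
theorem ofMat_mat (a : Frame M ι) (b : Frame N κ) (φ : M ⟶ N) : a.ofMat b (a.mat b φ) = φ :=
  a.mat_injective b (by simp)

/-- Base change acts on matrices entrywise by a ring homomorphism. Vanishing and invertibility of a
pulled back morphism thereby become conditions on pulled back functions. -/
theorem mat_pullback {M N : Y.Modules} (a : Frame M ι) (b : Frame N κ) (g : X ⟶ Y) (φ : M ⟶ N) :
    (a.pullback g).mat (b.pullback g) ((Scheme.Modules.pullback g).map φ) =
      (a.mat b φ).map g.appTop.hom := by
  ext i j
  rw [Matrix.map_apply, mat_apply, mat_apply, ← toGlobal_pullback]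
  simp [pullback]

theorem isIso_iff_isUnit_mat [DecidableEq ι] (a : Frame M ι) (b : Frame N ι) (φ : M ⟶ N) :
    IsIso φ ↔ IsUnit (a.mat b φ) := by
  constructor
  · intro h
    refine IsUnit.of_mul_eq_one (b.mat a (inv φ)) ?_
    rw [← mat_comp]; simp
  · rintro ⟨u, hu⟩
    refine ⟨b.ofMat a u⁻¹.val, a.mat_injective a ?_, b.mat_injective b ?_⟩
    · rw [mat_comp _ b, mat_ofMat, ← hu]; simp
    · rw [mat_comp _ a, mat_ofMat, ← hu]; simp

theorem isIso_iff_isUnit_det [DecidableEq ι] (a : Frame M ι) (b : Frame N ι) (φ : M ⟶ N) :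
    IsIso φ ↔ IsUnit (a.mat b φ).det := by
  rw [isIso_iff_isUnit_mat a b, Matrix.isUnit_iff_isUnit_det]

/-- Two sheaves of modules with bases of the same size are isomorphic. -/
def iso [DecidableEq ι] (a : Frame M ι) (b : Frame N ι) : M ≅ N where
  hom := a.ofMat b 1
  inv := b.ofMat a 1
  hom_inv_id := a.mat_injective a (by rw [mat_comp _ b]; simp)
  inv_hom_id := b.mat_injective b (by rw [mat_comp _ a]; simp)

/-- The restriction of the target of a morphism to some coordinates yields a basis of the
kernel: if `φ` is split by `s`, and the coordinates with index in the range of `f` map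
isomorphically under `φ`, then the other coordinates restrict to a basis of the kernel. -/
def ofKernel (a : Frame M ι) {φ : M ⟶ N} {s : N ⟶ M} (hs : s ≫ φ = 𝟙 N) (q : ι → Prop)
    [DecidablePred q] (h₁ : ∀ i, q i → s ≫ a.p i = 0) (h₂ : ∀ i, ¬ q i → a.e i ≫ φ ≫ s = a.e i)
    {K : X.Modules} (k : K ⟶ M) (w : k ≫ φ = 0)
    (hk : Limits.IsLimit (Limits.KernelFork.ofι k w)) :
    Frame K {i // q i} where
  -- The idempotent `𝟙 M - φ ≫ s` projects `M` onto the kernel along the image of `s`. It kills the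
  -- basis vectors with `¬ q i`, and the images of the others form the basis.
  e i := hk.lift (Limits.KernelFork.ofι (a.e i ≫ (𝟙 M - φ ≫ s)) (by simp [hs]))
  p i := k ≫ a.p i
  e_p_self i := by
    have := hk.fac (Limits.KernelFork.ofι (a.e i ≫ (𝟙 M - φ ≫ s)) (by simp [hs]))
      Limits.WalkingParallelPair.zero
    dsimp at this
    rw [reassoc_of% this]
    simp [h₁ _ i.2, a.e_p_self]
  e_p_ne i j h := by
    have := hk.fac (Limits.KernelFork.ofι (a.e i ≫ (𝟙 M - φ ≫ s)) (by simp [hs]))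
      Limits.WalkingParallelPair.zero
    dsimp at this
    rw [reassoc_of% this]
    simp [h₁ _ j.2, a.e_p_ne _ _ (fun h' => h (Subtype.ext h'))]
  total := by
    refine Limits.Fork.IsLimit.hom_ext hk ?_
    have (i : {i // q i}) := hk.fac
      (Limits.KernelFork.ofι (a.e i ≫ (𝟙 M - φ ≫ s)) (by simp [hs]))
      Limits.WalkingParallelPair.zero
    dsimp at this
    dsimp
    simp only [Preadditive.sum_comp, Category.assoc, this, Category.id_comp]
    have h3 : ∑ i : {i // q i}, a.p i ≫ a.e i ≫ (𝟙 M - φ ≫ s) = 𝟙 M - φ ≫ s := by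
      calc _ = ∑ i, a.p i ≫ a.e i ≫ (𝟙 M - φ ≫ s) := by
            rw [← Finset.sum_subtype (Finset.univ.filter q) (by simp)
              (fun i => a.p i ≫ a.e i ≫ (𝟙 M - φ ≫ s))]
            refine Finset.sum_filter_of_ne fun i _ h => ?_
            by_contra hq
            exact h (by simp [h₂ i hq])
        _ = (∑ i, a.p i ≫ a.e i) ≫ (𝟙 M - φ ≫ s) := by
            simp only [Preadditive.sum_comp, Category.assoc]
        _ = _ := by rw [a.total, Category.id_comp]
    rw [← Preadditive.comp_sum, h3]
    simp [reassoc_of% w]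

end Frame
end GrassmannZero
end

/-! ### Local frames, and properties of morphisms that are local on the base. -/

noncomputable section
namespace GrassmannZero
variable {X Y : Scheme.{u}}

/-- The free sheaf of modules, as the coproduct of copies of the structure sheaf. -/
abbrev freeModule (X : Scheme.{u}) (I : Type u) : X.Modules :=
  SheafOfModules.free (R := X.ringCatSheaf) I

/-- The standard basis sections of a free sheaf of modules. -/
def freeModuleι (X : Scheme.{u}) {I : Type u} (i : I) : structureModule X ⟶ freeModule X I :=
  SheafOfModules.ιFree i

/-- The free sheaf of modules is a coproduct in the category of sheaves of modules. -/
def isColimitFreeModule (X : Scheme.{u}) (I : Type u) :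
    Limits.IsColimit (Limits.Cofan.mk (freeModule X I) (freeModuleι X (I := I))) :=
  SheafOfModules.isColimitFreeCofan (R := X.ringCatSheaf) I

/-- The standard basis of a free sheaf of modules. -/
def Frame.ofFree (X : Scheme.{u}) (r : ℕ) : Frame (freeModule X (ULift.{u} (Fin r))) (Fin r) :=
  have key (i : Fin r) (j : ULift.{u} (Fin r)) :
      freeModuleι X j ≫ Limits.Cofan.IsColimit.desc (isColimitFreeModule X _)
        (fun j => if i = j.down then 𝟙 (structureModule X) else 0) =
      if i = j.down then 𝟙 (structureModule X) else 0 :=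
    Limits.Cofan.IsColimit.fac (isColimitFreeModule X _) _ j
  { e := fun i => freeModuleι X ⟨i⟩
    p := fun i => Limits.Cofan.IsColimit.desc (isColimitFreeModule X _)
      (fun j => if i = j.down then 𝟙 (structureModule X) else 0)
    e_p_self := fun i => by rw [key]; exact if_pos rfl
    e_p_ne := fun i j h => by rw [key]; exact if_neg h.symm
    total := by
      refine Limits.Cofan.IsColimit.hom_ext (isColimitFreeModule X _) _ _ fun j => ?_
      change freeModuleι X j ≫ _ = freeModuleι X j ≫ _
      rw [Preadditive.comp_sum, Finset.sum_eq_single j.down]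
      · rw [reassoc_of% (key j.down j)]
        simp
      · intro i _ h
        rw [reassoc_of% (key i j), if_neg h, Limits.zero_comp]
      · simp }

/-- `M` has a basis indexed by `Fin r` near `x`. -/
def HasFrameNear (M : X.Modules) (x : X) (r : ℕ) : Prop :=
  ∃ (U : Scheme.{u}) (i : U ⟶ X) (_ : IsOpenImmersion i), x ∈ Set.range i ∧
    Nonempty (Frame ((Scheme.Modules.pullback i).obj M) (Fin r))

/-- Restriction to an open subset is traded for pullback along an arbitrary open immersion, a class
closed under composition and base change. Any frame with `r` elements gives an isomorphism with the
free module. -/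
theorem isFreeNear_iff {M : X.Modules} {x : X} {r : ℕ} :
    IsFreeNear M x r ↔ HasFrameNear M x r := by
  constructor
  · rintro ⟨U, hx, ⟨f⟩⟩
    refine ⟨U, U.ι, inferInstance, by simpa using hx,
      ⟨((Frame.ofFree _ r).congr f.symm).congr
        ((Scheme.Modules.restrictFunctorIsoPullback U.ι).app M)⟩⟩
  · rintro ⟨U, i, hi, hx, ⟨a⟩⟩
    refine ⟨i.opensRange, hx, ⟨?_⟩⟩
    let b := (a.pullback i.isoOpensRange.inv).congr
      ((Scheme.Modules.pullbackComp i.isoOpensRange.inv i).app M ≪≫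
        (Scheme.Modules.pullbackCongr (g := i.opensRange.ι) (by simp)).app M ≪≫
        ((Scheme.Modules.restrictFunctorIsoPullback i.opensRange.ι).app M).symm)
    exact b.iso (Frame.ofFree _ r)

theorem HasFrameNear.pullback {M : Y.Modules} {g : X ⟶ Y} {x : X} {r : ℕ}
    (h : HasFrameNear M (g x) r) : HasFrameNear ((Scheme.Modules.pullback g).obj M) x r := by
  obtain ⟨U, i, hi, hx, ⟨a⟩⟩ := h
  refine ⟨Limits.pullback g i, Limits.pullback.fst g i, inferInstance, ?_, ⟨?_⟩⟩
  · rw [IsOpenImmersion.range_pullbackFst]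
    exact hx
  · exact (a.pullback (Limits.pullback.snd g i)).congr
      ((Scheme.Modules.pullbackComp _ _).app M ≪≫
        (Scheme.Modules.pullbackCongr Limits.pullback.condition.symm).app M ≪≫
        ((Scheme.Modules.pullbackComp _ _).app M).symm)

theorem IsVectorBundle.hasFrameNear {M : X.Modules} {r : ℕ} (h : IsVectorBundle M r) (x : X) :
    HasFrameNear M x r := isFreeNear_iff.mp (h x)

theorem isVectorBundle_iff {M : X.Modules} {r : ℕ} :
    IsVectorBundle M r ↔ ∀ x, HasFrameNear M x r := forall_congr' fun _ => isFreeNear_iff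

theorem IsVectorBundle.pullback {M : Y.Modules} {r : ℕ} (h : IsVectorBundle M r) (g : X ⟶ Y) :
    IsVectorBundle ((Scheme.Modules.pullback g).obj M) r :=
  isVectorBundle_iff.mpr fun x => (h.hasFrameNear (g x)).pullback

theorem HasFrameNear.congr {M N : X.Modules} {x : X} {r : ℕ} (h : HasFrameNear M x r)
    (f : M ≅ N) : HasFrameNear N x r := by
  obtain ⟨U, i, hi, hx, ⟨a⟩⟩ := h
  exact ⟨U, i, hi, hx, ⟨a.congr ((Scheme.Modules.pullback i).mapIso f)⟩⟩

theorem IsVectorBundle.congr {M N : X.Modules} {r : ℕ} (h : IsVectorBundle M r) (f : M ≅ N) :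
    IsVectorBundle N r :=
  isVectorBundle_iff.mpr fun x => (h.hasFrameNear x).congr f

theorem Frame.isVectorBundle {M : X.Modules} {r : ℕ} (a : Frame M (Fin r)) :
    IsVectorBundle M r :=
  isVectorBundle_iff.mpr fun _ => ⟨X, 𝟙 X, inferInstance, by simp, ⟨a.pullback _⟩⟩

/-- A basis on an open neighbourhood of a point of an open subscheme is a basis near that point. -/
theorem HasFrameNear.of_pullback {M : Y.Modules} {i : X ⟶ Y} [IsOpenImmersion i] {x : X} {r : ℕ}
    (h : HasFrameNear ((Scheme.Modules.pullback i).obj M) x r) : HasFrameNear M (i x) r := by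
  obtain ⟨U, j, hj, ⟨u, rfl⟩, ⟨a⟩⟩ := h
  exact ⟨U, j ≫ i, inferInstance, ⟨u, by simp⟩, ⟨a.congr ((Scheme.Modules.pullbackComp _ _).app M)⟩⟩

/-! Local properties of morphisms. -/

variable {M N : X.Modules}

theorem mono_iff_injective (φ : M ⟶ N) :
    Mono φ ↔ ∀ U : X.Opens, Function.Injective (Scheme.Modules.Hom.app φ U).hom := by
  constructor
  · intro h U
    have h1 : Mono ((Scheme.Modules.toPresheaf X).map φ) := inferInstance
    have h2 : Mono (((Scheme.Modules.toPresheaf X).map φ).app (Opposite.op U)) := inferInstance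
    exact (AddCommGrpCat.mono_iff_injective _).mp h2
  · intro h
    refine ⟨fun f g w => Scheme.Modules.hom_ext _ _ fun U => ?_⟩
    ext s
    apply h U
    have := congrArg (fun t => (Scheme.Modules.Hom.app t U).hom s) w
    simpa using this

theorem section_eq_zero {U : X.Opens} (s : Γ(M, U))
    (h : ∀ x ∈ U, ∃ (V : X.Opens) (i : V ⟶ U), x ∈ V ∧ (M.presheaf.map i.op).hom s = 0) :
    s = 0 := by
  choose V i hx h using h
  refine TopCat.Sheaf.eq_of_locally_eq' ⟨M.presheaf, M.isSheaf⟩ (fun x : U => V x x.2) U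
    (fun x => i x x.2) (fun x hxU => ?_) s 0 fun x => ?_
  · exact TopologicalSpace.Opens.mem_iSup.mpr ⟨⟨x, hxU⟩, hx x hxU⟩
  · exact (h x x.2).trans (map_zero (M.presheaf.map (i x x.2).op).hom).symm

/-- Pullback along an open immersion is naturally isomorphic to restriction, whose sections over `V`
are the sections over the image of `V`. -/
theorem pullback_map_eq_zero_iff (i : Y ⟶ X) [IsOpenImmersion i] (φ : M ⟶ N) :
    (Scheme.Modules.pullback i).map φ = 0 ↔
      ∀ V : Y.Opens, Scheme.Modules.Hom.app φ (i ''ᵁ V) = 0 := by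
  have nat := (Scheme.Modules.restrictFunctorIsoPullback i).hom.naturality φ
  have h1 : (Scheme.Modules.pullback i).map φ = 0 ↔
      (Scheme.Modules.restrictFunctor i).map φ = 0 := by
    constructor
    · intro h
      rw [h] at nat
      rw [← cancel_mono ((Scheme.Modules.restrictFunctorIsoPullback i).hom.app N), nat]
      simp
    · intro h
      rw [h] at nat
      rw [← cancel_epi ((Scheme.Modules.restrictFunctorIsoPullback i).hom.app M), ← nat]
      simp
  rw [h1]
  constructor
  · intro h V
    exact congrArg (fun t => Scheme.Modules.Hom.app t V) h
  · intro h
    exact Scheme.Modules.hom_ext _ _ fun V => h V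

theorem eq_zero_of_locally (φ : M ⟶ N)
    (h : ∀ x : X, ∃ (U : Scheme.{u}) (i : U ⟶ X) (_ : IsOpenImmersion i), x ∈ Set.range i ∧
      (Scheme.Modules.pullback i).map φ = 0) : φ = 0 := by
  refine Scheme.Modules.hom_ext _ _ fun W => ?_
  ext s
  refine section_eq_zero _ fun x hx => ?_
  obtain ⟨U, i, hi, ⟨y, rfl⟩, h⟩ := h x
  rw [pullback_map_eq_zero_iff] at h
  have hle : i ''ᵁ (i ⁻¹ᵁ W) ≤ W := i.image_preimage_le W
  refine ⟨i ''ᵁ (i ⁻¹ᵁ W), homOfLE hle, ⟨y, hx, rfl⟩, ?_⟩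
  have nat := φ.mapPresheaf.naturality (homOfLE hle).op
  have := congr($(nat).hom s)
  refine this.symm.trans ?_
  exact congrArg (fun t => AddCommGrpCat.Hom.hom t ((M.presheaf.map (homOfLE hle).op).hom s))
    (h (i ⁻¹ᵁ W))

instance mono_pullback_map (i : Y ⟶ X) [IsOpenImmersion i] (φ : M ⟶ N) [Mono φ] :
    Mono ((Scheme.Modules.pullback i).map φ) := by
  have h1 : Mono ((Scheme.Modules.restrictFunctor i).map φ) :=
    (mono_iff_injective _).mpr fun V => (mono_iff_injective φ).mp inferInstance (i ''ᵁ V)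
  have nat := (Scheme.Modules.restrictFunctorIsoPullback i).hom.naturality φ
  have h2 : (Scheme.Modules.pullback i).map φ =
      inv ((Scheme.Modules.restrictFunctorIsoPullback i).hom.app M) ≫
        (Scheme.Modules.restrictFunctor i).map φ ≫
          (Scheme.Modules.restrictFunctorIsoPullback i).hom.app N := by
    rw [nat]; simp
  rw [h2]
  infer_instance

end GrassmannZero
end

/-! ### Coherence of iterated pullbacks, and locally split monomorphisms. -/

noncomputable section
namespace GrassmannZero
variable {X Y : Scheme.{u}}

/-! Coherence of the isomorphisms `g^* p^* E ≅ f^* E`. -/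

section Coherence
variable {T T' : Scheme.{u}}

theorem pullbackIso_naturality {g : T ⟶ X} {p : X ⟶ Y} {f : T ⟶ Y} (h : g ≫ p = f)
    {E E' : Y.Modules} (φ : E ⟶ E') :
    (Scheme.Modules.pullback g).map ((Scheme.Modules.pullback p).map φ) ≫ (pullbackIso h E').hom =
      (pullbackIso h E).hom ≫ (Scheme.Modules.pullback f).map φ := by
  simp only [pullbackIso, Iso.trans_hom, Category.assoc, Iso.app_hom]
  have h1 := (Scheme.Modules.pullbackComp g p).hom.naturality φ
  have h2 := (Scheme.Modules.pullbackCongr h).hom.naturality φ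
  dsimp at h1
  rw [reassoc_of% h1, h2]

theorem pullbackIso_naturality_assoc {g : T ⟶ X} {p : X ⟶ Y} {f : T ⟶ Y} (h : g ≫ p = f)
    {E E' : Y.Modules} (φ : E ⟶ E') {Q : T.Modules}
    (z : (Scheme.Modules.pullback f).obj E' ⟶ Q) :
    (Scheme.Modules.pullback g).map ((Scheme.Modules.pullback p).map φ) ≫
      (pullbackIso h E').hom ≫ z =
      (pullbackIso h E).hom ≫ (Scheme.Modules.pullback f).map φ ≫ z := by
  rw [← Category.assoc, pullbackIso_naturality, Category.assoc]

theorem pullbackIso_inv_naturality {g : T ⟶ X} {p : X ⟶ Y} {f : T ⟶ Y} (h : g ≫ p = f)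
    {E E' : Y.Modules} (φ : E ⟶ E') :
    (pullbackIso h E).inv ≫
      (Scheme.Modules.pullback g).map ((Scheme.Modules.pullback p).map φ) =
      (Scheme.Modules.pullback f).map φ ≫ (pullbackIso h E').inv := by
  rw [Iso.inv_comp_eq, ← pullbackIso_naturality_assoc]
  simp

theorem pullbackIso_inv_naturality_assoc {g : T ⟶ X} {p : X ⟶ Y} {f : T ⟶ Y} (h : g ≫ p = f)
    {E E' : Y.Modules} (φ : E ⟶ E') {Q : T.Modules}
    (z : (Scheme.Modules.pullback g).obj ((Scheme.Modules.pullback p).obj E') ⟶ Q) :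
    (pullbackIso h E).inv ≫
      (Scheme.Modules.pullback g).map ((Scheme.Modules.pullback p).map φ) ≫ z =
      (Scheme.Modules.pullback f).map φ ≫ (pullbackIso h E').inv ≫ z := by
  rw [← Category.assoc, pullbackIso_inv_naturality, Category.assoc]

/-- This is the associativity constraint of the pullback pseudofunctor. All composites are named by
separate variables, so that it applies to morphisms that are only propositionally equal to
composites. -/
theorem pullbackIso_assoc {a : T' ⟶ T} {g : T ⟶ X} {p : X ⟶ Y} {f : T ⟶ Y} {c : T' ⟶ X}
    {d : T' ⟶ Y} (h₁ : g ≫ p = f) (h₂ : a ≫ f = d) (h₃ : a ≫ g = c) (h₄ : c ≫ p = d)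
    (E : Y.Modules) :
    (Scheme.Modules.pullback a).map (pullbackIso h₁ E).hom ≫ (pullbackIso h₂ E).hom =
      (pullbackIso h₃ ((Scheme.Modules.pullback p).obj E)).hom ≫ (pullbackIso h₄ E).hom := by
  subst h₁ h₃ h₂
  have key := congrArg (fun t => t.app E) (Scheme.Modules.pseudofunctor_associativity a g p)
  simp only [NatTrans.comp_app, Functor.whiskerRight_app, Functor.associator_hom_app,
    Functor.whiskerLeft_app, Category.id_comp] at key
  have h5 : (eqToHom (congrArg Scheme.Modules.pullback (Category.assoc a g p).symm) :
      Scheme.Modules.pullback (a ≫ g ≫ p) ⟶ Scheme.Modules.pullback ((a ≫ g) ≫ p)).app E ≫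
      (Scheme.Modules.pullbackCongr h₄).hom.app E = 𝟙 _ := by
    simp [Scheme.Modules.pullbackCongr]
  simp only [pullbackIso, Iso.trans_hom, Iso.app_hom, Scheme.Modules.pullbackCongr, eqToIso_refl,
    Iso.refl_hom, NatTrans.id_app, Category.comp_id]
  have h6 := (reassoc_of% key) ((Scheme.Modules.pullbackCongr h₄).hom.app E)
  rw [h5] at h6
  have h7 : ∀ {A B C D : T'.Modules} (s : A ≅ B) (t : B ≅ C) (v : A ⟶ D) (w : D ⟶ C),
      t.inv ≫ s.inv ≫ v ≫ w = 𝟙 _ → s.hom ≫ t.hom = v ≫ w := by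
    intro A B C D s t v w h
    rw [Iso.inv_comp_eq, Iso.inv_comp_eq] at h
    rw [h]; simp
  exact h7 ((Scheme.Modules.pullback a).mapIso ((Scheme.Modules.pullbackComp g p).app E))
    ((Scheme.Modules.pullbackComp a (g ≫ p)).app E) _ _ h6

end Coherence

/-! Further local properties of morphisms. -/

variable {M N P : X.Modules}

theorem mono_of_locally (φ : M ⟶ N)
    (h : ∀ x : X, ∃ (U : Scheme.{u}) (i : U ⟶ X) (_ : IsOpenImmersion i), x ∈ Set.range i ∧
      Mono ((Scheme.Modules.pullback i).map φ)) : Mono φ := by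
  refine Preadditive.mono_of_cancel_zero _ fun {K} g hg => eq_zero_of_locally g fun x => ?_
  obtain ⟨U, i, hi, hx, h⟩ := h x
  refine ⟨U, i, hi, hx, ?_⟩
  rw [← cancel_mono ((Scheme.Modules.pullback i).map φ), ← Functor.map_comp, hg]
  simp

theorem isIso_of_locally (φ : M ⟶ N)
    (h : ∀ x : X, ∃ (U : Scheme.{u}) (i : U ⟶ X) (_ : IsOpenImmersion i), x ∈ Set.range i ∧
      IsIso ((Scheme.Modules.pullback i).map φ)) : IsIso φ := by
  have h1 : Mono φ := mono_of_locally φ fun x => by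
    obtain ⟨U, i, hi, hx, h⟩ := h x
    exact ⟨U, i, hi, hx, inferInstance⟩
  have h2 : Epi φ := by
    refine Preadditive.epi_of_cancel_zero _ fun {K} g hg => eq_zero_of_locally g fun x => ?_
    obtain ⟨U, i, hi, hx, h⟩ := h x
    refine ⟨U, i, hi, hx, ?_⟩
    rw [← cancel_epi ((Scheme.Modules.pullback i).map φ), ← Functor.map_comp, hg]
    simp
  exact isIso_of_mono_of_epi φ

/-- A morphism that has a retraction locally. -/
def LocSplitMono (j : M ⟶ N) : Prop :=
  ∀ x : X, ∃ (U : Scheme.{u}) (i : U ⟶ X) (_ : IsOpenImmersion i), x ∈ Set.range i ∧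
    IsSplitMono ((Scheme.Modules.pullback i).map j)

namespace LocSplitMono

theorem mono {j : M ⟶ N} (h : LocSplitMono j) : Mono j :=
  mono_of_locally j fun x => by
    obtain ⟨U, i, hi, hx, h⟩ := h x
    exact ⟨U, i, hi, hx, inferInstance⟩

theorem of_isSplitMono (j : M ⟶ N) [IsSplitMono j] : LocSplitMono j :=
  fun _ => ⟨X, 𝟙 X, inferInstance, by simp, inferInstance⟩

theorem of_comp {j : M ⟶ N} {k : N ⟶ P} (h : LocSplitMono (j ≫ k)) : LocSplitMono j := fun x => by
  obtain ⟨U, i, hi, hx, h⟩ := h x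
  rw [Functor.map_comp] at h
  exact ⟨U, i, hi, hx, IsSplitMono.mk' ⟨(Scheme.Modules.pullback i).map k ≫
    retraction ((Scheme.Modules.pullback i).map j ≫ (Scheme.Modules.pullback i).map k), by
      rw [← Category.assoc, IsSplitMono.id]⟩⟩

end LocSplitMono

theorem isSplitMono_pullback_pullback {M N : Y.Modules} {T U : Scheme.{u}} {j : M ⟶ N}
    {a : T ⟶ U} {i : U ⟶ Y} {b : T ⟶ X} {g : X ⟶ Y} (h : a ≫ i = b ≫ g)
    [IsSplitMono ((Scheme.Modules.pullback i).map j)] :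
    IsSplitMono ((Scheme.Modules.pullback b).map ((Scheme.Modules.pullback g).map j)) := by
  have h1 := pullbackIso_naturality h j
  have h2 := pullbackIso_naturality (rfl : b ≫ g = _) j
  refine IsSplitMono.mk' ⟨(pullbackIso rfl N).hom ≫ (pullbackIso h N).inv ≫
    (Scheme.Modules.pullback a).map (retraction ((Scheme.Modules.pullback i).map j)) ≫
    (pullbackIso h M).hom ≫ (pullbackIso rfl M).inv, ?_⟩
  rw [reassoc_of% h2, ← pullbackIso_inv_naturality_assoc h j, ← Functor.map_comp_assoc,
    IsSplitMono.id]
  simp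

theorem LocSplitMono.pullback {M N : Y.Modules} {j : M ⟶ N} (h : LocSplitMono j) (g : X ⟶ Y) :
    LocSplitMono ((Scheme.Modules.pullback g).map j) := fun x => by
  obtain ⟨U, i, hi, hx, h⟩ := h (g x)
  refine ⟨Limits.pullback g i, Limits.pullback.fst g i, inferInstance, ?_, ?_⟩
  · rw [IsOpenImmersion.range_pullbackFst]
    exact hx
  · exact isSplitMono_pullback_pullback Limits.pullback.condition.symm

theorem exists_common_openImmersion {x : X} {U V : Scheme.{u}} (i : U ⟶ X) (j : V ⟶ X)
    [IsOpenImmersion i] [IsOpenImmersion j] (hi : x ∈ Set.range i) (hj : x ∈ Set.range j) :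
    ∃ (W : Scheme.{u}) (a : W ⟶ U) (b : W ⟶ V) (_ : IsOpenImmersion a) (_ : IsOpenImmersion b),
      a ≫ i = b ≫ j ∧ x ∈ Set.range (a ≫ i) := by
  refine ⟨Limits.pullback i j, Limits.pullback.fst i j, Limits.pullback.snd i j, inferInstance,
    inferInstance, Limits.pullback.condition, ?_⟩
  obtain ⟨u, rfl⟩ := hi
  have : u ∈ Set.range (Limits.pullback.fst i j) := by
    rw [IsOpenImmersion.range_pullbackFst]
    exact hj
  obtain ⟨w, rfl⟩ := this
  exact ⟨w, by simp⟩

theorem LocSplitMono.comp {j : M ⟶ N} {k : N ⟶ P} (hj : LocSplitMono j) (hk : LocSplitMono k) :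
    LocSplitMono (j ≫ k) := fun x => by
  obtain ⟨U, i, hi, hx, h⟩ := hj x
  obtain ⟨U', i', hi', hx', h'⟩ := hk x
  obtain ⟨W, a, b, ha, hb, e, hw⟩ := exists_common_openImmersion i i' hx hx'
  refine ⟨W, a ≫ i, inferInstance, hw, ?_⟩
  have h1 : IsSplitMono ((Scheme.Modules.pullback (a ≫ i)).map j) := by
    have n1 := pullbackIso_naturality (rfl : a ≫ i = _) j
    refine IsSplitMono.mk' ⟨(pullbackIso rfl N).inv ≫ (Scheme.Modules.pullback a).map
      (retraction ((Scheme.Modules.pullback i).map j)) ≫ (pullbackIso rfl M).hom, ?_⟩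
    rw [← pullbackIso_inv_naturality_assoc, ← Functor.map_comp_assoc, IsSplitMono.id]
    simp
  have h2 : IsSplitMono ((Scheme.Modules.pullback (a ≫ i)).map k) := by
    refine IsSplitMono.mk' ⟨(pullbackIso e.symm P).inv ≫ (Scheme.Modules.pullback b).map
      (retraction ((Scheme.Modules.pullback i').map k)) ≫ (pullbackIso e.symm N).hom, ?_⟩
    rw [← pullbackIso_inv_naturality_assoc, ← Functor.map_comp_assoc, IsSplitMono.id]
    simp
  rw [Functor.map_comp]
  infer_instance

/-- If `ψ` is an epimorphism with kernel `k`, and `f^* k` is a monomorphism, then it is a kernel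
of `f^* ψ`. -/
def isLimitPullbackKernelFork {M N K : Y.Modules} {ψ : M ⟶ N} [Epi ψ] {k : K ⟶ M} {w : k ≫ ψ = 0}
    (hk : Limits.IsLimit (Limits.KernelFork.ofι k w)) (f : X ⟶ Y)
    [Mono ((Scheme.Modules.pullback f).map k)] :
    Limits.IsLimit (Limits.KernelFork.ofι (f := (Scheme.Modules.pullback f).map ψ)
      ((Scheme.Modules.pullback f).map k)
      (by rw [← Functor.map_comp, w, Functor.map_zero])) :=
  -- `ψ` is the cokernel of `k`. Pullback is a left adjoint and keeps it so, and a monomorphism is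
  -- the kernel of its cokernel.
  have h1 : Limits.IsColimit (Limits.CokernelCofork.ofπ ψ w) := Abelian.epiIsCokernelOfKernel _ hk
  Abelian.monoIsKernelOfCokernel _
    (Limits.isColimitCoforkMapOfIsColimit' (Scheme.Modules.pullback f) w h1)

end GrassmannZero
end

/-! ### Invertible minors and local splittings of epimorphisms. -/

noncomputable section
namespace GrassmannZero
variable {X Y : Scheme.{u}}

/-- The hypothesis says that `A` has rank `r`, so `r` of its rows form a basis of the row space. -/
theorem exists_submatrix_det_ne_zero {K : Type*} [Field K] {n r : ℕ}
    (A : Matrix (Fin n) (Fin r) K) (hA : ∀ c : Fin r → K, A.mulVec c = 0 → c = 0) :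
    ∃ e : Fin r ↪ Fin n, (A.submatrix e id).det ≠ 0 := by
  have hrank : A.rank = r := by
    rw [Matrix.rank, LinearMap.finrank_range_of_inj]
    · simp
    · rw [← LinearMap.ker_eq_bot, LinearMap.ker_eq_bot']
      exact hA
  obtain ⟨κ, a, ha, hspan, hli⟩ := exists_linearIndependent' K A.row
  have : Finite κ := Finite.of_injective a ha
  have := Fintype.ofFinite κ
  have hcard : Fintype.card κ = r := by
    rw [← finrank_span_eq_card hli, hspan, ← Matrix.rank_eq_finrank_span_row, hrank]
  let f : Fin r ≃ κ := (Fintype.equivFinOfCardEq hcard).symm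
  refine ⟨⟨a ∘ f, ha.comp f.injective⟩, ?_⟩
  have h1 : LinearIndependent K (A.submatrix (a ∘ f) id).row :=
    hli.comp f f.injective
  rw [Matrix.linearIndependent_rows_iff_isUnit, Matrix.isUnit_iff_isUnit_det] at h1
  exact h1.ne_zero

/-- The standard basis of the structure sheaf. -/
def Frame.unit (X : Scheme.{u}) : Frame (structureModule X) Unit where
  e _ := 𝟙 _
  p _ := 𝟙 _
  e_p_self _ := by simp
  e_p_ne i j h := (h rfl).elim
  total := by simp

variable {M N : X.Modules} {n r : ℕ}

theorem isUnit_appTop_iff (g : Y ⟶ X) (δ : Γ(X, ⊤)) :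
    IsUnit (g.appTop.hom δ) ↔ ∀ y, g y ∈ X.basicOpen δ := by
  have h1 : ∀ y, g y ∈ X.basicOpen δ ↔ y ∈ Y.basicOpen (g.appTop.hom δ) := by
    intro y
    rw [← Scheme.preimage_basicOpen_top]
    rfl
  simp only [h1]
  constructor
  · intro h y
    rw [Scheme.basicOpen_of_isUnit _ h]
    trivial
  · intro h
    exact RingedSpace.isUnit_of_isUnit_germ Y.toSheafedSpace ⊤ _
      fun y hy => (Scheme.mem_basicOpen_top _ _ _).mp (h y)

/-- On the fibre over the residue field `φ` stays an epimorphism. A vector killed by its matrix is a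
linear form on the fibre of `N` that vanishes after composition with `φ`, hence zero. So the matrix
has rank `r` at `x`, and some maximal minor does not vanish there. -/
theorem exists_mem_basicOpen_det (a : Frame M (Fin n)) (b : Frame N (Fin r)) (φ : M ⟶ N) [Epi φ]
    (x : X) : ∃ e : Fin r ↪ Fin n, x ∈ X.basicOpen ((a.mat b φ).submatrix e id).det := by
  let g := X.fromSpecResidueField x
  let γ : Γ(X, ⊤) →+* X.residueField x :=
    (Scheme.ΓSpecIso (X.residueField x)).hom.hom.comp g.appTop.hom
  obtain ⟨e, he⟩ := exists_submatrix_det_ne_zero ((a.mat b φ).map γ) (by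
    intro c hc
    let C : Matrix (Fin r) Unit Γ(Spec (X.residueField x), ⊤) :=
      Matrix.of fun i _ => (Scheme.ΓSpecIso (X.residueField x)).inv.hom (c i)
    have h0 : (b.pullback g).ofMat (Frame.unit _) C = 0 := by
      rw [← cancel_epi ((Scheme.Modules.pullback g).map φ), Limits.comp_zero,
        ← Frame.mat_eq_zero_iff (a.pullback g) (Frame.unit _), Frame.mat_comp _ (b.pullback g),
        Frame.mat_ofMat, Frame.mat_pullback]
      ext i j
      have h1 := congrArg (Scheme.ΓSpecIso (X.residueField x)).inv.hom (congrFun hc i)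
      simpa [Matrix.mulVec, dotProduct, Matrix.mul_apply, C, γ] using h1
    have h2 : C = 0 := by
      rw [← Frame.mat_ofMat (b.pullback g) (Frame.unit _) C, h0, Frame.mat_zero]
    ext i
    have h3 := congrArg (Scheme.ΓSpecIso (X.residueField x)).hom.hom (congrFun (congrFun h2 i) ())
    simpa [C] using h3)
  refine ⟨e, ?_⟩
  have h1 : γ ((a.mat b φ).submatrix e id).det ≠ 0 := by
    rw [RingHom.map_det]
    exact he
  have h2 : IsUnit (g.appTop.hom ((a.mat b φ).submatrix e id).det) := by
    have := (isUnit_iff_ne_zero.mpr h1).map (Scheme.ΓSpecIso (X.residueField x)).inv.hom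
    simpa [γ] using this
  have h5 : g (IsLocalRing.closedPoint (X.residueField x)) = x :=
    Scheme.fromSpecResidueField_apply _ _
  rw [← h5]
  exact (isUnit_appTop_iff g _).mp h2 _

/-- The section of `φ` given by an invertible minor of its matrix. -/
theorem exists_section_of_isUnit_det (a : Frame M (Fin n)) (b : Frame N (Fin r)) (φ : M ⟶ N)
    (e : Fin r ↪ Fin n) (h : IsUnit ((a.mat b φ).submatrix e id).det) :
    ∃ s : N ⟶ M, s ≫ φ = 𝟙 N ∧ ∀ {K : X.Modules} (k : K ⟶ M) (w : k ≫ φ = 0),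
      Limits.IsLimit (Limits.KernelFork.ofι k w) → Nonempty (Frame K (Fin (n - r))) := by
  classical
  set A := a.mat b φ with hA
  -- Left multiplication by `J` picks the rows in the image of `e`, so `J * A` is the invertible
  -- block `D`, and `D⁻¹ * J` is the matrix of a section of `φ` that uses only the chosen
  -- coordinates.
  let J : Matrix (Fin r) (Fin n) Γ(X, ⊤) := (1 : Matrix (Fin n) (Fin n) Γ(X, ⊤)).submatrix e id
  have hJA : J * A = A.submatrix e id := by
    have := Matrix.submatrix_mul_equiv (1 : Matrix (Fin n) (Fin n) Γ(X, ⊤)) A e (Equiv.refl _) id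
    simpa [J] using this
  let D := A.submatrix e id
  let s := b.ofMat a (D⁻¹ * J)
  have hs : s ≫ φ = 𝟙 N := by
    apply b.mat_injective b
    rw [Frame.mat_comp _ a, Frame.mat_ofMat, Frame.mat_id, Matrix.mul_assoc, ← hA, hJA]
    exact Matrix.nonsing_inv_mul _ h
  refine ⟨s, hs, fun k w hk => ?_⟩
  have h1 : ∀ i, i ∉ Set.range e → s ≫ a.p i = 0 := by
    intro i hi
    refine b.hom_ext fun j => ?_
    rw [Limits.comp_zero]
    apply toGlobal_injective
    have : (D⁻¹ * J) j i = toGlobal (b.e j ≫ s ≫ a.p i) := by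
      rw [← Frame.mat_apply, Frame.mat_ofMat]
    rw [← this, toGlobal_zero, Matrix.mul_apply]
    refine Finset.sum_eq_zero fun m _ => ?_
    have : J m i = 0 := Matrix.one_apply_ne fun h' => hi ⟨m, h'⟩
    rw [this, mul_zero]
  have h2 : ∀ i, ¬ i ∉ Set.range e → a.e i ≫ φ ≫ s = a.e i := by
    intro i hi
    obtain ⟨j, rfl⟩ := not_not.mp hi
    refine a.hom_ext' fun m => toGlobal_injective ?_
    have e1 : toGlobal ((a.e (e j) ≫ φ ≫ s) ≫ a.p m) = (A * (D⁻¹ * J)) (e j) m := by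
      rw [← Frame.mat_ofMat b a (D⁻¹ * J), hA, ← Frame.mat_comp, Frame.mat_apply]
      simp [s]
    have e2 : toGlobal (a.e (e j) ≫ a.p m) = J j m := by
      have := congrFun (congrFun a.mat_id (e j)) m
      rw [Frame.mat_apply, Category.id_comp] at this
      exact this
    rw [e1, e2]
    have e3 : (A * (D⁻¹ * J)) (e j) m = (D * (D⁻¹ * J)) j m := rfl
    rw [e3, ← Matrix.mul_assoc, Matrix.mul_nonsing_inv _ h, Matrix.one_mul]
  -- The embedding `e` forces `r ≤ n`, so this subtraction of natural numbers is not truncated.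
  have hcard : Fintype.card {i // i ∉ Set.range e} = n - r := by
    rw [Fintype.card_subtype_compl, Fintype.card_fin]
    congr 1
    exact (Set.card_range_of_injective e.injective).trans (Fintype.card_fin r)
  exact ⟨(a.ofKernel hs _ h1 h2 k w hk).reindex (Fintype.equivFinOfCardEq hcard).symm⟩

/-- An epimorphism between locally free sheaves splits locally, and its kernel is locally free. -/
theorem exists_section_near {x : X} (hM : HasFrameNear M x n) (hN : HasFrameNear N x r) (φ : M ⟶ N)
    [Epi φ] : ∃ (U : Scheme.{u}) (i : U ⟶ X) (_ : IsOpenImmersion i), x ∈ Set.range i ∧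
      ∃ s : (Scheme.Modules.pullback i).obj N ⟶ (Scheme.Modules.pullback i).obj M,
        s ≫ (Scheme.Modules.pullback i).map φ = 𝟙 _ ∧
        ∀ {K : U.Modules} (k : K ⟶ (Scheme.Modules.pullback i).obj M)
          (w : k ≫ (Scheme.Modules.pullback i).map φ = 0),
          Limits.IsLimit (Limits.KernelFork.ofι k w) → Nonempty (Frame K (Fin (n - r))) := by
  obtain ⟨U, i, hi, hx, ⟨a⟩⟩ := hM
  obtain ⟨V, j, hj, hx', ⟨b⟩⟩ := hN
  obtain ⟨W, c, d, hc, hd, e, w, hw⟩ := exists_common_openImmersion i j hx hx'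
  let a' := (a.pullback c).congr (pullbackIso rfl M)
  let b' := (b.pullback d).congr (pullbackIso e.symm N)
  obtain ⟨f, hf⟩ := exists_mem_basicOpen_det a' b' ((Scheme.Modules.pullback (c ≫ i)).map φ) w
  set δ := ((a'.mat b' ((Scheme.Modules.pullback (c ≫ i)).map φ)).submatrix f id).det with hδ
  -- On the locus where the minor `δ` is invertible, the section exists and the kernel is free.
  let ι := (W.basicOpen δ).ι
  let a'' := (a'.pullback ι).congr (pullbackIso (rfl : ι ≫ c ≫ i = _) M)
  let b'' := (b'.pullback ι).congr (pullbackIso (rfl : ι ≫ c ≫ i = _) N)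
  have hdet : IsUnit (((a''.mat b'' ((Scheme.Modules.pullback (ι ≫ c ≫ i)).map φ))).submatrix
      f id).det := by
    have h1 : a''.mat b'' ((Scheme.Modules.pullback (ι ≫ c ≫ i)).map φ) =
        (a'.mat b' ((Scheme.Modules.pullback (c ≫ i)).map φ)).map ι.appTop.hom := by
      rw [← Frame.mat_pullback]
      ext k l
      simp only [Frame.mat_apply, a'', b'', Frame.congr, Category.assoc]
      rw [← pullbackIso_naturality_assoc]
      simp
    rw [h1]
    have h2 : (((a'.mat b' ((Scheme.Modules.pullback (c ≫ i)).map φ)).map ι.appTop.hom).submatrix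
      f id).det = ι.appTop.hom δ := by
      rw [show ι.appTop.hom δ = _ from RingHom.map_det ι.appTop.hom _]
      rfl
    rw [h2, isUnit_appTop_iff]
    exact fun t => t.2
  obtain ⟨s, hs, hk⟩ := exists_section_of_isUnit_det a'' b'' _ f hdet
  exact ⟨_, ι ≫ c ≫ i, inferInstance, ⟨⟨w, hf⟩, hw⟩, s, hs, hk⟩

end GrassmannZero
end

/-! ### Kernels of epimorphisms of vector bundles, and subbundles. -/

noncomputable section
namespace GrassmannZero
variable {X Y : Scheme.{u}} {M N K : X.Modules} {n r : ℕ}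

/-- With a local section `s` of `φ`, the endomorphism `𝟙 - φ ≫ s` factors through the kernel, and
this factorization is a retraction of `k`. -/
theorem kernel_near {φ : M ⟶ N} [Epi φ] {k : K ⟶ M} {w : k ≫ φ = 0}
    (hk : Limits.IsLimit (Limits.KernelFork.ofι k w)) {x : X} (hM : HasFrameNear M x n)
    (hN : HasFrameNear N x r) :
    HasFrameNear K x (n - r) ∧ ∃ (U : Scheme.{u}) (i : U ⟶ X) (_ : IsOpenImmersion i),
      x ∈ Set.range i ∧ IsSplitMono ((Scheme.Modules.pullback i).map k) := by
  obtain ⟨U, i, hi, hx, s, hs, h⟩ := exists_section_near hM hN φ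
  have : Mono k := Limits.mono_of_isLimit_fork hk
  have hk' := isLimitPullbackKernelFork hk i
  refine ⟨⟨U, i, hi, hx, h _ _ hk'⟩, U, i, hi, hx, ?_⟩
  let t := Limits.KernelFork.IsLimit.lift' hk' (𝟙 _ - (Scheme.Modules.pullback i).map φ ≫ s)
    (by simp [hs])
  refine IsSplitMono.mk' ⟨t.1, ?_⟩
  rw [← cancel_mono ((Scheme.Modules.pullback i).map k)]
  have ht : t.1 ≫ (Scheme.Modules.pullback i).map k = _ := t.2
  rw [Category.assoc, ht, Preadditive.comp_sub, ← Functor.map_comp_assoc, w]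
  simp

/-- The kernel of an epimorphism between vector bundles is a vector bundle. -/
theorem IsVectorBundle.kernel {φ : M ⟶ N} [Epi φ] {k : K ⟶ M} {w : k ≫ φ = 0}
    (hk : Limits.IsLimit (Limits.KernelFork.ofι k w)) (hM : IsVectorBundle M n)
    (hN : IsVectorBundle N r) : IsVectorBundle K (n - r) :=
  isVectorBundle_iff.mpr fun x => (kernel_near hk (hM.hasFrameNear x) (hN.hasFrameNear x)).1

/-- The kernel of an epimorphism between vector bundles is locally a direct summand. -/
theorem LocSplitMono.of_kernel {φ : M ⟶ N} [Epi φ] {k : K ⟶ M} {w : k ≫ φ = 0}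
    (hk : Limits.IsLimit (Limits.KernelFork.ofι k w)) (hM : IsVectorBundle M n)
    (hN : IsVectorBundle N r) : LocSplitMono k :=
  fun x => (kernel_near hk (hM.hasFrameNear x) (hN.hasFrameNear x)).2

/-- The cokernel of a split monomorphism is the kernel of a retraction. -/
def cokernelIsoKernelRetraction {C : Type*} [Category* C] [Abelian C] {A B : C} (j : A ⟶ B)
    (ρ : B ⟶ A) (h : j ≫ ρ = 𝟙 A) : Limits.cokernel j ≅ Limits.kernel ρ where
  hom := Limits.cokernel.desc j (Limits.kernel.lift ρ (𝟙 B - ρ ≫ j) (by simp [h]))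
    (by rw [← cancel_mono (Limits.kernel.ι ρ)]; simp [reassoc_of% h])
  inv := Limits.kernel.ι ρ ≫ Limits.cokernel.π j
  hom_inv_id := by
    rw [← cancel_epi (Limits.cokernel.π j)]
    simp
  inv_hom_id := by
    rw [← cancel_mono (Limits.kernel.ι ρ)]
    simp

/-- A rank `l` subbundle of a vector bundle is a locally free subsheaf of rank `l` that is locally
a direct summand. -/
theorem isSubbundle_iff {S E : X.Modules} {l : ℕ} (hE : IsVectorBundle E n) (j : S ⟶ E) :
    IsSubbundle j l ↔ IsVectorBundle S l ∧ LocSplitMono j := by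
  constructor
  · intro h
    have := h.mono
    refine ⟨h.isVectorBundle, fun x => ?_⟩
    obtain ⟨m, hm⟩ := h.cokernel_free x
    -- `j` is the kernel of the projection to its locally free cokernel, hence locally split.
    have hk : Limits.IsLimit (Limits.KernelFork.ofι j (Limits.cokernel.condition j)) :=
      Abelian.monoIsKernelOfCokernel _ (Limits.colimit.isColimit _)
    exact (kernel_near hk
      (hE.hasFrameNear x) (isFreeNear_iff.mp hm)).2
  · rintro ⟨hS, hj⟩
    refine ⟨hj.mono, hS, fun x => ⟨n - l, isFreeNear_iff.mpr ?_⟩⟩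
    obtain ⟨U, i, hi, ⟨y, rfl⟩, h⟩ := hj x
    -- Conversely, the cokernel of a split monomorphism is the kernel of a retraction, which is an
    -- epimorphism from rank `n` to rank `l`.
    have h1 := (kernel_near (w := Limits.kernel.condition _)
      (Limits.kernelIsKernel (retraction ((Scheme.Modules.pullback i).map j)))
      ((hE.pullback i).hasFrameNear y) ((hS.pullback i).hasFrameNear y)).1
    exact (h1.congr ((cokernelIsoKernelRetraction _ _ (IsSplitMono.id _)).symm ≪≫
      (Limits.PreservesCokernel.iso (Scheme.Modules.pullback i) j).symm)).of_pullback

theorem IsSubbundle.locSplitMono {S E : X.Modules} {l : ℕ} {j : S ⟶ E} (h : IsSubbundle j l)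
    (hE : IsVectorBundle E n) : LocSplitMono j :=
  ((isSubbundle_iff hE j).mp h).2

/-- The pullback of a subbundle. -/
theorem IsSubbundle.pullback {S E : Y.Modules} {l : ℕ} {j : S ⟶ E} (h : IsSubbundle j l)
    (hE : IsVectorBundle E n) (g : X ⟶ Y) :
    IsSubbundle ((Scheme.Modules.pullback g).map j) l :=
  (isSubbundle_iff (hE.pullback g) _).mpr
    ⟨h.isVectorBundle.pullback g, (h.locSplitMono hE).pullback g⟩

theorem IsSubbundle.comp_iso {S E E' : X.Modules} {l : ℕ} {j : S ⟶ E} (h : IsSubbundle j l)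
    (f : E ≅ E') : IsSubbundle (j ≫ f.hom) l where
  mono := by have := h.mono; infer_instance
  isVectorBundle := h.isVectorBundle
  cokernel_free x := by
    obtain ⟨m, hm⟩ := h.cokernel_free x
    refine ⟨m, isFreeNear_iff.mpr ((isFreeNear_iff.mp hm).congr ?_)⟩
    exact Limits.cokernel.mapIso j (j ≫ f.hom) (Iso.refl _) f (by simp)

theorem IsSubbundle.iso_comp {S S' E : X.Modules} {l : ℕ} {j : S ⟶ E} (h : IsSubbundle j l)
    (f : S' ≅ S) : IsSubbundle (f.hom ≫ j) l where
  mono := by have := h.mono; infer_instance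
  isVectorBundle := h.isVectorBundle.congr f.symm
  cokernel_free x := by
    obtain ⟨m, hm⟩ := h.cokernel_free x
    refine ⟨m, isFreeNear_iff.mpr ((isFreeNear_iff.mp hm).congr ?_)⟩
    exact Limits.cokernel.mapIso j (f.hom ≫ j) f.symm (Iso.refl _) (by simp)

end GrassmannZero
end

/-! ### Zero schemes of morphisms of vector bundles. -/

noncomputable section
namespace GrassmannZero
variable {X Y T : Scheme.{u}} {A B : X.Modules} {a b : ℕ}

theorem pullback_map_comp_eq_zero_iff (g : T ⟶ Y) (h : Y ⟶ X) (φ : A ⟶ B) :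
    (Scheme.Modules.pullback (g ≫ h)).map φ = 0 ↔
      (Scheme.Modules.pullback g).map ((Scheme.Modules.pullback h).map φ) = 0 := by
  have h1 := pullbackIso_naturality (rfl : g ≫ h = g ≫ h) φ
  constructor
  · intro h0
    rw [h0, Limits.comp_zero] at h1
    exact (cancel_mono (pullbackIso rfl B).hom).mp (by rw [h1, Limits.zero_comp])
  · intro h0
    rw [h0, Limits.zero_comp] at h1
    exact (cancel_epi (pullbackIso rfl A).hom).mp (by rw [← h1, Limits.comp_zero])

theorem pullback_map_comp_eq_zero (g : T ⟶ Y) {h : Y ⟶ X} {φ : A ⟶ B}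
    (h0 : (Scheme.Modules.pullback h).map φ = 0) :
    (Scheme.Modules.pullback (g ≫ h)).map φ = 0 := by
  rw [pullback_map_comp_eq_zero_iff, h0, Functor.map_zero]

/-- An affine open neighbourhood on which both bundles are free, with the matrix entries of `φ`. -/
theorem exists_affineOpens_entries (hA : IsVectorBundle A a) (hB : IsVectorBundle B b) (φ : A ⟶ B)
    (x : X) : ∃ (V : X.affineOpens) (_ : x ∈ V.1) (E : Set Γ((V.1 : Scheme.{u}), ⊤)),
      ∀ {S : Scheme.{u}} (g : S ⟶ V.1), (Scheme.Modules.pullback (g ≫ V.1.ι)).map φ = 0 ↔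
        ∀ e ∈ E, g.appTop.hom e = 0 := by
  obtain ⟨U, i, hi, hx, ⟨α⟩⟩ := hA.hasFrameNear x
  obtain ⟨U', i', hi', hx', ⟨β⟩⟩ := hB.hasFrameNear x
  obtain ⟨W, c, d, hc, hd, e, hW⟩ := exists_common_openImmersion i i' hx hx'
  obtain ⟨_, ⟨(V : X.Opens), hV, rfl⟩, hxV, hVW⟩ := X.isBasis_affineOpens.exists_subset_of_mem_open
    (show x ∈ ((c ≫ i).opensRange : Set X) by simpa using hW) (c ≫ i).opensRange.2
  let j : (V : Scheme.{u}) ⟶ W := IsOpenImmersion.lift (c ≫ i) V.ι (by simpa using hVW)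
  have hj : j ≫ c ≫ i = V.ι := IsOpenImmersion.lift_fac _ _ _
  let α' : Frame ((Scheme.Modules.pullback V.ι).obj A) (Fin a) :=
    (α.pullback (j ≫ c)).congr (pullbackIso (by rw [Category.assoc, hj]) A)
  let β' : Frame ((Scheme.Modules.pullback V.ι).obj B) (Fin b) :=
    (β.pullback (j ≫ d)).congr (pullbackIso (by rw [Category.assoc, ← e, hj]) B)
  refine ⟨⟨V, hV⟩, hxV, Set.range fun q : Fin a × Fin b =>
    α'.mat β' ((Scheme.Modules.pullback V.ι).map φ) q.1 q.2, fun {S} g => ?_⟩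
  rw [pullback_map_comp_eq_zero_iff, ← Frame.mat_eq_zero_iff (α'.pullback g) (β'.pullback g),
    Frame.mat_pullback]
  constructor
  · rintro h _ ⟨q, rfl⟩
    exact congrFun (congrFun h q.1) q.2
  · intro h
    ext p q
    exact h _ ⟨(p, q), rfl⟩

theorem ofIdealTop_subscheme_appTop [IsAffine X] (J : Ideal Γ(X, ⊤)) {e : Γ(X, ⊤)} (he : e ∈ J) :
    (Scheme.IdealSheafData.ofIdealTop J).subschemeι.appTop.hom e = 0 := by
  have := (Scheme.IdealSheafData.ofIdealTop J).ker_subschemeι_app ⟨⊤, isAffineOpen_top X⟩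
  have h2 : e ∈ (Scheme.IdealSheafData.ofIdealTop J).ideal ⟨⊤, isAffineOpen_top X⟩ := by
    have h3 := Scheme.IdealSheafData.equivOfIsAffine.apply_symm_apply J
    rw [Scheme.IdealSheafData.equivOfIsAffine_symm_apply,
      Scheme.IdealSheafData.equivOfIsAffine_apply] at h3
    rw [h3]; exact he
  rw [← this] at h2
  exact h2

/-- The kernel ideal sheaf is the largest one inside the kernels of `g` on affine opens, and over
each affine open `J` extends to the ideal generated by restrictions of its elements. No
quasi-compactness of `g` enters, so `T` can be arbitrary. -/
theorem ofIdealTop_le_ker (J : Ideal Γ(X, ⊤)) (g : T ⟶ X) (h : ∀ e ∈ J, g.appTop.hom e = 0) :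
    Scheme.IdealSheafData.ofIdealTop J ≤ g.ker := by
  refine Scheme.IdealSheafData.le_ofIdeals_iff.mpr fun U => ?_
  refine Ideal.map_le_iff_le_comap.mpr fun e he => ?_
  have h1 := congr($(g.naturality (homOfLE (le_top : U.1 ≤ ⊤)).op).hom e)
  have h2 : (g.app ⊤).hom e = 0 := h e he
  change (g.app U.1).hom ((X.presheaf.map (homOfLE le_top).op).hom e) = 0
  refine h1.trans ?_
  rw [CommRingCat.hom_comp, RingHom.comp_apply, h2, map_zero]

/-- A function vanishes if it vanishes after restriction to the members of an open cover. -/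
theorem app_eq_zero_of_cover (g : T ⟶ X) {ι : Type*} (O : ι → T.Opens) (hO : ∀ t, ∃ i, t ∈ O i)
    {U : X.Opens} {s : Γ(X, U)} (h : ∀ i, (((O i).ι ≫ g).app U).hom s = 0) :
    (g.app U).hom s = 0 := by
  refine T.IsSheaf.section_ext fun t ht => ?_
  obtain ⟨i, hi⟩ := hO t
  refine ⟨(O i).ι ''ᵁ (O i).ι ⁻¹ᵁ g ⁻¹ᵁ U, ?_, ⟨⟨t, hi⟩, ht, rfl⟩, ?_⟩
  · exact Set.image_preimage_subset (O i).ι (g ⁻¹ᵁ U)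
  · have h1 := h i
    rw [map_zero]
    exact congr($((Scheme.Hom.comp_app (O i).ι g U).symm).hom s).trans h1

/-- The two functions correspond to one another under isomorphisms between rings of sections over
equal open sets. -/
theorem morphismRestrict_appTop_eq_zero_iff (g : T ⟶ X) (V : X.Opens)
    (e : Γ((V : Scheme.{u}), ⊤)) :
    (g ∣_ V).appTop.hom e = 0 ↔ (g.app V).hom (V.topIso.hom.hom e) = 0 := by
  have h1 := congr($(morphismRestrict_appTop g V).hom e)
  have h2 := congr($(g.naturality (eqToHom V.ι_image_top.symm).op).hom e)
  have h3 : ∀ {U U' : T.Opens} (f : Opposite.op U ⟶ Opposite.op U') (_ : IsIso f) (s : Γ(T, U)),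
      (T.presheaf.map f).hom s = 0 ↔ s = 0 := fun f hf s =>
    map_eq_zero_iff _ (ConcreteCategory.bijective_of_isIso (T.presheaf.map f)).1
  rw [show (g ∣_ V).appTop.hom e = _ from h1,
    show (g.app V).hom (V.topIso.hom.hom e) = _ from h2]
  exact (h3 _ inferInstance _).trans (h3 _ inferInstance _).symm

/-- Zero schemes: on a quasi-compact and quasi-separated scheme, a morphism of schemes factors
through the zero scheme of a morphism of vector bundles if and only if the morphism of vector
bundles pulls back to zero. -/
theorem zeroIdeal_spec [CompactSpace X] [QuasiSeparatedSpace X] (hA : IsVectorBundle A a)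
    (hB : IsVectorBundle B b) (φ : A ⟶ B) :
    (Scheme.Modules.pullback (zeroIdeal φ).subschemeι).map φ = 0 ∧
      ∀ {T : Scheme.{u}} (g : T ⟶ X), (Scheme.Modules.pullback g).map φ = 0 →
        zeroIdeal φ ≤ g.ker := by
  choose V hV E hE using exists_affineOpens_entries hA hB φ
  -- Finiteness is essential: only finite infima of ideal sheaves are computed on each affine open
  -- separately.
  obtain ⟨t, ht⟩ := isCompact_univ.elim_finite_subcover (fun x => ((V x).1 : Set X))
    (fun x => (V x).1.2) (fun x _ => Set.mem_iUnion.mpr ⟨x, hV x⟩)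
  have hcov : ∀ x, ∃ i : t, x ∈ (V i).1 := fun x => by
    simpa using ht (Set.mem_univ x)
  have aff (x) : IsAffine (V x).1 := (V x).2
  let K (x : X) := Scheme.IdealSheafData.ofIdealTop (Ideal.span (E x))
  let c (x : X) : (K x).subscheme ⟶ X := (K x).subschemeι ≫ (V x).1.ι
  have hc (x) : (Scheme.Modules.pullback (c x)).map φ = 0 := (hE x _).mpr fun e he =>
    ofIdealTop_subscheme_appTop _ (Ideal.subset_span he)
  -- For a quasi-compact morphism the kernel ideal sheaf is the actual kernel on each affine open.
  -- The source is compact and `X` is quasi-separated.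
  have hqc (x) : QuasiCompact (c x) := by
    have : CompactSpace (K x).subscheme :=
      QuasiCompact.compactSpace_of_compactSpace (K x).subschemeι
    exact quasiCompact_of_compactSpace _
  -- The candidate is the union of the scheme-theoretic images in `X` of the local zero schemes.
  let I : X.IdealSheafData := ⨅ i : t, (c i).ker
  -- `I` is contained in every kernel
  have h1 : ∀ {T : Scheme.{u}} (g : T ⟶ X), (Scheme.Modules.pullback g).map φ = 0 →
      I ≤ g.ker := by
    intro T g hg
    refine Scheme.IdealSheafData.le_ofIdeals_iff.mpr fun U s hs => ?_
    refine app_eq_zero_of_cover g (fun i : t => g ⁻¹ᵁ (V i).1) (fun y => hcov (g y)) fun i => ?_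
    have h2 : (Scheme.Modules.pullback ((g ∣_ (V i).1) ≫ (V i).1.ι)).map φ = 0 := by
      rw [morphismRestrict_ι]
      exact pullback_map_comp_eq_zero _ hg
    have h3 : K i ≤ (g ∣_ (V i).1).ker := ofIdealTop_le_ker _ _ fun e he =>
      (Ideal.span_le (I := RingHom.ker (g ∣_ (V i).1).appTop.hom)).mpr ((hE i _).mp h2) he
    let q := IsClosedImmersion.lift (K i).subschemeι (g ∣_ (V i).1)
      (by rw [Scheme.IdealSheafData.ker_subschemeι]; exact h3)
    -- Over `V i` the morphism `g` kills the matrix entries, so it factors through the local zero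
    -- scheme and its kernel contains that of `c i`.
    have hq : q ≫ c i = (g ⁻¹ᵁ (V i).1).ι ≫ g := by
      rw [← morphismRestrict_ι, ← Category.assoc, IsClosedImmersion.lift_fac]
    have h4 : I ≤ ((g ⁻¹ᵁ (V i).1).ι ≫ g).ker := by
      rw [← hq]
      exact (iInf_le _ i).trans (Scheme.Hom.le_ker_comp _ _)
    exact Scheme.Hom.ideal_ker_le _ _ (h4 U hs)
  -- `φ` vanishes on the subscheme defined by `I`
  have h2 : (Scheme.Modules.pullback I.subschemeι).map φ = 0 := by
    refine eq_zero_of_locally _ fun y => ?_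
    obtain ⟨i, hi⟩ := hcov (I.subschemeι y)
    refine ⟨_, (I.subschemeι ⁻¹ᵁ (V i).1).ι, inferInstance, by simpa using hi, ?_⟩
    rw [← pullback_map_comp_eq_zero_iff, ← morphismRestrict_ι, hE i]
    intro e he
    have key {T : Scheme.{u}} (g : T ⟶ X) :
        (g ∣_ (V i).1).appTop.hom e = 0 ↔ (g.app (V i).1).hom ((V i).1.topIso.hom.hom e) = 0 :=
      morphismRestrict_appTop_eq_zero_iff g _ e
    rw [key, ← RingHom.mem_ker, Scheme.IdealSheafData.ker_subschemeι_app,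
      Scheme.IdealSheafData.ideal_iInf, iInf_apply, Ideal.mem_iInf]
    -- An entry `e` over `V i` also vanishes on the part of every other local zero scheme that lies
    -- over `V i`, because `φ` vanishes along `c k`. Hence `e` lies in all the kernels.
    intro k
    rw [Scheme.Hom.ker_apply, RingHom.mem_ker, ← key]
    refine (hE i _).mp ?_ e he
    rw [morphismRestrict_ι]
    exact pullback_map_comp_eq_zero _ (hc k)
  have h3 : zeroIdeal φ = I := le_antisymm (sInf_le h2) (le_sInf fun J hJ => by
    simpa using h1 J.subschemeι hJ)
  rw [h3]
  exact ⟨h2, h1⟩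

/-- The zero scheme of a morphism of vector bundles represents the vanishing of the morphism. -/
theorem exists_lift_zeroIdeal [CompactSpace X] [QuasiSeparatedSpace X] (hA : IsVectorBundle A a)
    (hB : IsVectorBundle B b) (φ : A ⟶ B) {T : Scheme.{u}} (g : T ⟶ X) :
    (∃ h : T ⟶ (zeroIdeal φ).subscheme, h ≫ (zeroIdeal φ).subschemeι = g) ↔
      (Scheme.Modules.pullback g).map φ = 0 := by
  constructor
  · rintro ⟨h, rfl⟩
    exact pullback_map_comp_eq_zero _ (zeroIdeal_spec hA hB φ).1
  · intro h
    exact ⟨IsClosedImmersion.lift _ g (by simpa using (zeroIdeal_spec hA hB φ).2 g h),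
      IsClosedImmersion.lift_fac _ _ _⟩

end GrassmannZero
end

/-! ### Comparison and gluing of subsheaves. -/

noncomputable section
namespace GrassmannZero
variable {X Y T : Scheme.{u}}

instance restrictFunctor_isRightAdjoint (f : X ⟶ Y) [IsOpenImmersion f] :
    (Scheme.Modules.restrictFunctor f).IsRightAdjoint := by
  unfold Scheme.Modules.restrictFunctor
  have h : ∀ φ : X.ringCatSheaf.obj ⟶ f.opensFunctor.op ⋙ Y.ringCatSheaf.obj,
    (PresheafOfModules.pushforward.{u} φ).IsRightAdjoint := fun φ => inferInstance
  exact @SheafOfModules.instIsRightAdjointPushforward _ _ _ _ _ _ _ _ _ _ _ (h _) inferInstance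
    inferInstance

/-- Restriction to an open subscheme preserves limits. -/
instance pullback_isRightAdjoint (f : X ⟶ Y) [IsOpenImmersion f] :
    (Scheme.Modules.pullback f).IsRightAdjoint :=
  Functor.isRightAdjoint_of_iso (Scheme.Modules.restrictFunctorIsoPullback f)

/-! Comparison of subsheaves. -/

section Compare

variable {E S S' S'' : X.Modules}

/-- The image of `j` is contained in the image of `j'`. -/
def Factors (j : S ⟶ E) (j' : S' ⟶ E) : Prop := ∃ t : S ⟶ S', t ≫ j' = j

/-- Two subsheaves of `E` agree. -/
def SameImage (j : S ⟶ E) (j' : S' ⟶ E) : Prop := ∃ e : S ≅ S', e.hom ≫ j' = j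

variable {j : S ⟶ E} {j' : S' ⟶ E} {j'' : S'' ⟶ E}

theorem SameImage.refl (j : S ⟶ E) : SameImage j j := ⟨Iso.refl _, by simp⟩

theorem SameImage.symm (h : SameImage j j') : SameImage j' j := by
  obtain ⟨e, rfl⟩ := h
  exact ⟨e.symm, by simp⟩

theorem SameImage.trans (h : SameImage j j') (h' : SameImage j' j'') : SameImage j j'' := by
  obtain ⟨e, rfl⟩ := h
  obtain ⟨e', rfl⟩ := h'
  exact ⟨e ≪≫ e', by simp⟩

theorem SameImage.of_eq {j j' : S ⟶ E} (h : j = j') : SameImage j j' := h ▸ .refl j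

theorem SameImage.pullback {E S S' : Y.Modules} {j : S ⟶ E} {j' : S' ⟶ E} (h : SameImage j j')
    (g : X ⟶ Y) :
    SameImage ((Scheme.Modules.pullback g).map j) ((Scheme.Modules.pullback g).map j') := by
  obtain ⟨e, rfl⟩ := h
  exact ⟨(Scheme.Modules.pullback g).mapIso e, by simp⟩

theorem SameImage.comp {E' : X.Modules} (h : SameImage j j') (f : E ⟶ E') :
    SameImage (j ≫ f) (j' ≫ f) := by
  obtain ⟨e, rfl⟩ := h
  exact ⟨e, by simp⟩

theorem SameImage.factors (h : SameImage j j') : Factors j j' := by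
  obtain ⟨e, h⟩ := h
  exact ⟨e.hom, h⟩

theorem Factors.sameImage [Mono j] [Mono j'] (h : Factors j j') (h' : Factors j' j) :
    SameImage j j' := by
  obtain ⟨t, ht⟩ := h
  obtain ⟨t', ht'⟩ := h'
  exact ⟨⟨t, t', by rw [← cancel_mono j]; simp [ht, ht'], by rw [← cancel_mono j']; simp [ht, ht']⟩,
    ht⟩

theorem factors_iff [Mono j'] : Factors j j' ↔ j ≫ Limits.cokernel.π j' = 0 := by
  constructor
  · rintro ⟨t, rfl⟩
    simp
  · intro h
    exact ⟨Abelian.monoLift j' j h, Abelian.monoLift_comp _ _ _⟩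

/-- Factoring through a monomorphism means vanishing of the composite to its cokernel, and vanishing
is local. No gluing of factorizations is needed. -/
theorem factors_of_locally [Mono j']
    (h : ∀ x : X, ∃ (U : Scheme.{u}) (i : U ⟶ X) (_ : IsOpenImmersion i), x ∈ Set.range i ∧
      Factors ((Scheme.Modules.pullback i).map j) ((Scheme.Modules.pullback i).map j')) :
    Factors j j' := by
  refine factors_iff.mpr (eq_zero_of_locally _ fun x => ?_)
  obtain ⟨U, i, hi, hx, t, ht⟩ := h x
  refine ⟨U, i, hi, hx, ?_⟩
  rw [Functor.map_comp, ← ht, Category.assoc, ← Functor.map_comp]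
  simp

theorem sameImage_of_locally [Mono j] [Mono j']
    (h : ∀ x : X, ∃ (U : Scheme.{u}) (i : U ⟶ X) (_ : IsOpenImmersion i), x ∈ Set.range i ∧
      SameImage ((Scheme.Modules.pullback i).map j) ((Scheme.Modules.pullback i).map j')) :
    SameImage j j' := by
  refine Factors.sameImage (factors_of_locally fun x => ?_) (factors_of_locally fun x => ?_)
  · obtain ⟨U, i, hi, hx, h⟩ := h x
    exact ⟨U, i, hi, hx, h.factors⟩
  · obtain ⟨U, i, hi, hx, h⟩ := h x
    exact ⟨U, i, hi, hx, h.symm.factors⟩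

/-- The sections of the image of a monomorphism. -/
def imageSections (j : S ⟶ E) (U : X.Opens) : Set Γ(E, U) :=
  Set.range (Scheme.Modules.Hom.app j U).hom

theorem factors_iff_imageSections [Mono j'] :
    Factors j j' ↔ ∀ U, imageSections j U ⊆ imageSections j' U := by
  constructor
  · rintro ⟨t, rfl⟩ U _ ⟨s, rfl⟩
    exact ⟨(Scheme.Modules.Hom.app t U).hom s, rfl⟩
  · intro h
    refine factors_iff.mpr (Scheme.Modules.hom_ext _ _ fun U => ?_)
    ext s
    obtain ⟨s', hs'⟩ := h U ⟨s, rfl⟩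
    change (Scheme.Modules.Hom.app (Limits.cokernel.π j') U).hom
      ((Scheme.Modules.Hom.app j U).hom s) = 0
    rw [← hs']
    exact congr((Scheme.Modules.Hom.app $(Limits.cokernel.condition j') U).hom s')

/-- A subsheaf is recorded by its sets of sections. This makes "same subsheaf" an equality in a
fixed type, whereas the sources `S` of monomorphisms range over a large category. -/
theorem sameImage_iff_imageSections [Mono j] [Mono j'] :
    SameImage j j' ↔ imageSections j = imageSections j' := by
  constructor
  · intro h
    funext U
    exact Set.Subset.antisymm (factors_iff_imageSections.mp h.factors U)
      (factors_iff_imageSections.mp h.symm.factors U)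
  · intro h
    exact Factors.sameImage (factors_iff_imageSections.mpr fun U => (congrFun h U).le)
      (factors_iff_imageSections.mpr fun U => (congrFun h U).ge)

end Compare

/-! Gluing of subsheaves. -/

theorem pullback_map_injective_of_restrict (i : Y ⟶ X) [IsOpenImmersion i] (M : X.Modules)
    {V W : Y.Opens} (h : V ≤ W)
    (hM : Function.Injective (M.presheaf.map (homOfLE (i.opensFunctor.map (homOfLE h)).le).op).hom) :
    Function.Injective
      (((Scheme.Modules.pullback i).obj M).presheaf.map (homOfLE h).op).hom := by
  let e := (Scheme.Modules.restrictFunctorIsoPullback i).app M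
  have h1 : ∀ U : Y.Opens, Function.Injective (Scheme.Modules.Hom.app e.inv U).hom :=
    (mono_iff_injective e.inv).mp inferInstance
  intro s t hst
  refine h1 W (hM ?_)
  have nat (s) := congr($(e.inv.mapPresheaf.naturality (homOfLE h).op).hom s)
  exact ((nat s).symm.trans (congrArg (Scheme.Modules.Hom.app e.inv V).hom hst)).trans (nat t)

/-- A section of `f_* Q` over `W` is a section of `Q` over the preimage of `W`, so it sees only the
part of `W` inside the image of `f`, that is, the overlap. -/
theorem eq_zero_of_pullback_snd {U V : Scheme.{u}} (f : U ⟶ T) (g : V ⟶ T) [IsOpenImmersion f]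
    [IsOpenImmersion g] {Q : U.Modules} {K : V.Modules}
    (φ : K ⟶ (Scheme.Modules.pullback g).obj ((Scheme.Modules.pushforward f).obj Q))
    (h : (Scheme.Modules.pullback (Limits.pullback.snd f g)).map φ = 0) : φ = 0 := by
  rw [pullback_map_eq_zero_iff] at h
  refine Scheme.Modules.hom_ext _ _ fun W => ?_
  ext s
  let b := Limits.pullback.snd f g
  have hb : b ''ᵁ b ⁻¹ᵁ W ≤ W := b.image_preimage_le W
  refine pullback_map_injective_of_restrict g _ hb ?_ ?_
  · have h1 : f ⁻¹ᵁ g ''ᵁ W ≤ f ⁻¹ᵁ g ''ᵁ b ''ᵁ b ⁻¹ᵁ W := by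
      rintro u ⟨w, hw, hu⟩
      obtain ⟨z, rfl, rfl⟩ := Scheme.Pullback.exists_preimage_pullback u w hu.symm
      exact ⟨_, ⟨z, hw, rfl⟩, hu⟩
    change Function.Injective (Q.presheaf.map _).hom
    have : IsIso (homOfLE (show f ⁻¹ᵁ g ''ᵁ b ''ᵁ b ⁻¹ᵁ W ≤ f ⁻¹ᵁ g ''ᵁ W from
      ((TopologicalSpace.Opens.map f.base).map (g.opensFunctor.map (homOfLE hb))).le)) :=
      ⟨homOfLE h1, rfl, rfl⟩
    exact (ConcreteCategory.bijective_of_isIso (Q.presheaf.map (homOfLE (show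
      f ⁻¹ᵁ g ''ᵁ b ''ᵁ b ⁻¹ᵁ W ≤ f ⁻¹ᵁ g ''ᵁ W from
      ((TopologicalSpace.Opens.map f.base).map (g.opensFunctor.map (homOfLE hb))).le)).op)).1
  · have h2 := congr($(φ.mapPresheaf.naturality (homOfLE hb).op).hom s)
    refine h2.symm.trans ?_
    refine (congr(($(h (b ⁻¹ᵁ W))).hom ((K.presheaf.map (homOfLE hb).op).hom s))).trans ?_
    exact (map_zero (((Scheme.Modules.pullback g).obj
      ((Scheme.Modules.pushforward f).obj Q)).presheaf.map (homOfLE hb).op).hom).symm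

/-- Subsheaves of restrictions of `E` to the members of an open cover that agree on overlaps glue
to a subsheaf of `E`. -/
theorem exists_glue {I : Type u} {U : I → Scheme.{u}} (f : ∀ i, U i ⟶ T)
    [∀ i, IsOpenImmersion (f i)] {E : T.Modules} {S : ∀ i, (U i).Modules}
    (j : ∀ i, S i ⟶ (Scheme.Modules.pullback (f i)).obj E) [∀ i, Mono (j i)]
    (h : ∀ i k {W : Scheme.{u}} (a : W ⟶ U i) (b : W ⟶ U k) (d : W ⟶ T) (ha : a ≫ f i = d)
      (hb : b ≫ f k = d), SameImage
        ((Scheme.Modules.pullback a).map (j i) ≫ (pullbackIso ha E).hom)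
        ((Scheme.Modules.pullback b).map (j k) ≫ (pullbackIso hb E).hom)) :
    ∃ (S₀ : T.Modules) (s : S₀ ⟶ E), Mono s ∧
      ∀ i, SameImage ((Scheme.Modules.pullback (f i)).map s) (j i) := by
  let adj := fun i => Scheme.Modules.pullbackPushforwardAdjunction (f i)
  -- The glued subsheaf is the kernel of `E → ∏ (f i)_* (coker (j i))`: the sections whose
  -- restriction to each `U i` lies in the image of `j i`.
  let ψ : ∀ i, E ⟶ (Scheme.Modules.pushforward (f i)).obj (Limits.cokernel (j i)) := fun i =>
    (adj i).homEquiv _ _ (Limits.cokernel.π (j i))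
  have hψ (i) : (Scheme.Modules.pullback (f i)).map (ψ i) ≫ (adj i).counit.app _ =
      Limits.cokernel.π (j i) := by
    exact (((adj i).homEquiv_counit _ _ _).symm.trans (Equiv.symm_apply_apply _ _))
  have hjψ (i) : j i ≫ (Scheme.Modules.pullback (f i)).map (ψ i) = 0 := by
    rw [← cancel_mono ((adj i).counit.app _), Category.assoc, hψ]
    simp
  refine ⟨_, Limits.kernel.ι (Limits.Pi.lift ψ), inferInstance, fun k => ?_⟩
  refine Factors.sameImage ?_ ?_
  · refine factors_iff.mpr (((adj k).homEquiv _ _).injective ?_)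
    rw [Adjunction.homEquiv_naturality_left]
    have h1 : Limits.kernel.ι (Limits.Pi.lift ψ) ≫ ψ k = 0 := by
      rw [← Limits.Pi.lift_π ψ k, Limits.kernel.condition_assoc, Limits.zero_comp]
    refine Eq.trans h1 ?_
    rw [Adjunction.homEquiv_unit, Functor.map_zero, Limits.comp_zero]
  -- Pullback along an open immersion preserves products and kernels, so it remains to see that each
  -- `ψ i`, restricted to `U k`, kills `j k`. This may be tested on the overlap, where `j k` has the
  -- same image as `j i`.
  · have hlim := Limits.isLimitOfPreserves (Scheme.Modules.pullback (f k))
      (Limits.productIsProduct fun i => (Scheme.Modules.pushforward (f i)).obj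
        (Limits.cokernel (j i)))
    have h0 : j k ≫ (Scheme.Modules.pullback (f k)).map (Limits.Pi.lift ψ) = 0 := by
      refine hlim.hom_ext fun ⟨i⟩ => ?_
      have h1 : (Scheme.Modules.pullback (f k)).map (Limits.Pi.lift ψ) ≫
          (Scheme.Modules.pullback (f k)).map (Limits.Pi.π _ i) =
          (Scheme.Modules.pullback (f k)).map (ψ i) := by
        rw [← Functor.map_comp, Limits.Pi.lift_π]
      refine (Category.assoc _ _ _).trans ?_
      refine (congrArg (j k ≫ ·) h1).trans ?_
      rw [Limits.zero_comp]
      refine eq_zero_of_pullback_snd (f i) (f k) _ ?_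
      obtain ⟨e, he⟩ := h k i (Limits.pullback.snd (f i) (f k)) (Limits.pullback.fst (f i) (f k))
        _ rfl Limits.pullback.condition
      rw [← cancel_mono (pullbackIso rfl _).hom, Functor.map_comp, Category.assoc,
        pullbackIso_naturality, ← Category.assoc, ← he, Category.assoc, Category.assoc,
        ← pullbackIso_naturality, ← Functor.map_comp_assoc, hjψ]
      simp
    let hk := Limits.isLimitForkMapOfIsLimit' (Scheme.Modules.pullback (f k))
      (Limits.kernel.condition (Limits.Pi.lift ψ)) (Limits.kernelIsKernel (Limits.Pi.lift ψ))
    obtain ⟨t, ht⟩ := Limits.KernelFork.IsLimit.lift' hk _ h0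
    exact ⟨t, ht⟩

end GrassmannZero
end

/-! ### The functor of subbundles of a constant bundle is a Zariski sheaf. -/

noncomputable section
namespace GrassmannZero
variable {X Y T : Scheme.{u}}

theorem pullbackIso_id_comp {p : X ⟶ Y} (h : 𝟙 X ≫ p = p) (E : Y.Modules) :
    (pullbackIso h E).hom =
      (Scheme.Modules.pullbackId X).hom.app ((Scheme.Modules.pullback p).obj E) := by
  have key := congrArg (fun t => t.app E) (Scheme.Modules.pseudofunctor_right_unitality p)
  simp only [NatTrans.comp_app, Functor.whiskerLeft_app, Functor.rightUnitor_hom_app]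
    at key
  have key' : ((Scheme.Modules.pullbackComp (𝟙 X) p).app E).inv ≫
    (Scheme.Modules.pullbackId X).hom.app ((Scheme.Modules.pullback p).obj E) = _ := key
  rw [Iso.inv_comp_eq] at key'
  rw [key']
  rfl

theorem SameImage.isSubbundle {E S S' : X.Modules} {j : S ⟶ E} {j' : S' ⟶ E} {l : ℕ}
    (h : SameImage j j') (hj : IsSubbundle j l) : IsSubbundle j' l := by
  obtain ⟨e, rfl⟩ := h.symm
  exact hj.iso_comp e

theorem LocSplitMono.of_locally {M N : X.Modules} {j : M ⟶ N}
    (h : ∀ x : X, ∃ (U : Scheme.{u}) (i : U ⟶ X) (_ : IsOpenImmersion i), x ∈ Set.range i ∧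
      LocSplitMono ((Scheme.Modules.pullback i).map j)) : LocSplitMono j := fun x => by
  obtain ⟨U, i, hi, ⟨y, rfl⟩, h⟩ := h x
  obtain ⟨V, i', hi', ⟨z, rfl⟩, h'⟩ := h y
  refine ⟨V, i' ≫ i, inferInstance, ⟨z, by simp⟩, IsSplitMono.mk' ⟨(pullbackIso rfl N).inv ≫
    retraction ((Scheme.Modules.pullback i').map ((Scheme.Modules.pullback i).map j)) ≫
      (pullbackIso rfl M).hom, ?_⟩⟩
  rw [← pullbackIso_inv_naturality_assoc, IsSplitMono.id_assoc, Iso.inv_hom_id]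

theorem isSubbundle_of_locally {S E : X.Modules} {n l : ℕ} (hE : IsVectorBundle E n) {j : S ⟶ E}
    (h : ∀ x : X, ∃ (U : Scheme.{u}) (i : U ⟶ X) (_ : IsOpenImmersion i), x ∈ Set.range i ∧
      IsSubbundle ((Scheme.Modules.pullback i).map j) l) : IsSubbundle j l := by
  refine (isSubbundle_iff hE j).mpr ⟨isVectorBundle_iff.mpr fun x => ?_,
    LocSplitMono.of_locally fun x => ?_⟩
  · obtain ⟨U, i, hi, ⟨y, rfl⟩, h⟩ := h x
    exact (h.isVectorBundle.hasFrameNear y).of_pullback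
  · obtain ⟨U, i, hi, hx, h⟩ := h x
    exact ⟨U, i, hi, hx, h.locSplitMono (hE.pullback i)⟩

/-! The functor of subbundles of a bundle on the terminal scheme. -/

/-- The morphism to the terminal scheme. -/
abbrev bang (T : Scheme.{u}) : T ⟶ ⊤_ Scheme.{u} := Limits.terminal.from T

variable (E : (⊤_ Scheme.{u}).Modules) (l : ℕ)

/-- The restriction along `g` of a subsheaf of the constant bundle with fibre `E`. -/
def restr (g : X ⟶ Y) {S : Y.Modules} (j : S ⟶ (Scheme.Modules.pullback (bang Y)).obj E) :
    (Scheme.Modules.pullback g).obj S ⟶ (Scheme.Modules.pullback (bang X)).obj E :=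
  (Scheme.Modules.pullback g).map j ≫ (pullbackIso (Limits.terminal.comp_from g) E).hom

variable {E l}

theorem SameImage.restr {S S' : Y.Modules} {j : S ⟶ (Scheme.Modules.pullback (bang Y)).obj E}
    {j' : S' ⟶ (Scheme.Modules.pullback (bang Y)).obj E} (h : SameImage j j') (g : X ⟶ Y) :
    SameImage (restr E g j) (restr E g j') := (h.pullback g).comp _

theorem restr_id {S : Y.Modules} (j : S ⟶ (Scheme.Modules.pullback (bang Y)).obj E) :
    SameImage (restr E (𝟙 Y) j) j := by
  refine ⟨(Scheme.Modules.pullbackId Y).app S, ?_⟩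
  rw [restr, pullbackIso_id_comp]
  exact ((Scheme.Modules.pullbackId Y).hom.naturality j).symm

theorem restr_restr (f : T ⟶ X) (g : X ⟶ Y) {S : Y.Modules}
    (j : S ⟶ (Scheme.Modules.pullback (bang Y)).obj E) :
    SameImage (restr E f (restr E g j)) (restr E (f ≫ g) j) := by
  refine ⟨pullbackIso rfl S, ?_⟩
  rw [restr, restr, restr, Functor.map_comp, Category.assoc,
    pullbackIso_assoc (Limits.terminal.comp_from g) (Limits.terminal.comp_from f) rfl
      (Limits.terminal.comp_from (f ≫ g)), pullbackIso_naturality_assoc]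

theorem IsSubbundle.restr {n : ℕ} (hE : IsVectorBundle E n) (g : X ⟶ Y) {S : Y.Modules}
    {j : S ⟶ (Scheme.Modules.pullback (bang Y)).obj E} (h : IsSubbundle j l) :
    IsSubbundle (restr E g j) l := (h.pullback (hE.pullback _) g).comp_iso _

variable (E l)

/-- The set of rank `l` subbundles of the constant bundle with fibre `E`. -/
def Subbundles (T : Scheme.{u}) : Type u :=
  {N : ∀ U : T.Opens, Set Γ((Scheme.Modules.pullback (bang T)).obj E, U) //
    ∃ (S : T.Modules) (j : S ⟶ (Scheme.Modules.pullback (bang T)).obj E),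
      IsSubbundle j l ∧ imageSections j = N}

namespace Subbundles

variable {E l}

def mk {S : T.Modules} (j : S ⟶ (Scheme.Modules.pullback (bang T)).obj E) (h : IsSubbundle j l) :
    Subbundles E l T := ⟨imageSections j, S, j, h, rfl⟩

theorem exists_mk (x : Subbundles E l T) :
    ∃ (S : T.Modules) (j : S ⟶ (Scheme.Modules.pullback (bang T)).obj E) (h : IsSubbundle j l),
      mk j h = x := by
  obtain ⟨N, S, j, h, rfl⟩ := x
  exact ⟨S, j, h, rfl⟩

theorem mk_eq_mk_iff {S S' : T.Modules} {j : S ⟶ (Scheme.Modules.pullback (bang T)).obj E}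
    {j' : S' ⟶ (Scheme.Modules.pullback (bang T)).obj E} (h : IsSubbundle j l)
    (h' : IsSubbundle j' l) : mk j h = mk j' h' ↔ SameImage j j' := by
  have := h.mono
  have := h'.mono
  rw [sameImage_iff_imageSections]
  exact Subtype.ext_iff

def sheaf (x : Subbundles E l T) : T.Modules := x.exists_mk.choose

def incl (x : Subbundles E l T) : x.sheaf ⟶ (Scheme.Modules.pullback (bang T)).obj E :=
  x.exists_mk.choose_spec.choose

theorem isSubbundle (x : Subbundles E l T) : IsSubbundle x.incl l :=
  x.exists_mk.choose_spec.choose_spec.choose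

theorem mk_incl (x : Subbundles E l T) : mk x.incl x.isSubbundle = x :=
  x.exists_mk.choose_spec.choose_spec.choose_spec

theorem mk_incl_sameImage {S : T.Modules} {j : S ⟶ (Scheme.Modules.pullback (bang T)).obj E}
    (h : IsSubbundle j l) : SameImage (mk j h).incl j :=
  (mk_eq_mk_iff (mk j h).isSubbundle h).mp (mk_incl _)

variable {n : ℕ} (hE : IsVectorBundle E n)

def map (g : X ⟶ Y) (x : Subbundles E l Y) : Subbundles E l X :=
  mk (restr E g x.incl) (x.isSubbundle.restr hE g)

theorem map_mk (g : X ⟶ Y) {S : Y.Modules} {j : S ⟶ (Scheme.Modules.pullback (bang Y)).obj E}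
    (h : IsSubbundle j l) : map hE g (mk j h) = mk (restr E g j) (h.restr hE g) :=
  (mk_eq_mk_iff _ _).mpr ((mk_incl_sameImage h).restr g)

theorem map_id (x : Subbundles E l X) : map hE (𝟙 X) x = x :=
  ((mk_eq_mk_iff _ x.isSubbundle).mpr (restr_id _)).trans x.mk_incl

theorem map_comp (f : T ⟶ X) (g : X ⟶ Y) (x : Subbundles E l Y) :
    map hE (f ≫ g) x = map hE f (map hE g x) := by
  exact ((mk_eq_mk_iff _ _).mpr (restr_restr f g _).symm).trans
    (map_mk hE f (x.isSubbundle.restr hE g)).symm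

theorem map_eq_map_iff (f : T ⟶ X) (g : T ⟶ Y) (x : Subbundles E l X) (y : Subbundles E l Y) :
    map hE f x = map hE g y ↔ SameImage (restr E f x.incl) (restr E g y.incl) :=
  mk_eq_mk_iff _ _

/-- Subbundles are determined locally. -/
theorem ext_of_cover {x y : Subbundles E l T} (h : ∀ t : T, ∃ (U : Scheme.{u}) (i : U ⟶ T)
    (_ : IsOpenImmersion i), t ∈ Set.range i ∧ map hE i x = map hE i y) : x = y := by
  rw [← x.mk_incl, ← y.mk_incl, mk_eq_mk_iff]
  have := x.isSubbundle.mono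
  have := y.isSubbundle.mono
  refine sameImage_of_locally fun t => ?_
  obtain ⟨U, i, hi, ht, h⟩ := h t
  rw [map_eq_map_iff] at h
  have h1 := h.comp (pullbackIso (Limits.terminal.comp_from i) E).inv
  rw [restr, restr, Category.assoc, Category.assoc, Iso.hom_inv_id, Category.comp_id,
    Category.comp_id] at h1
  exact ⟨U, i, hi, ht, h1⟩

/-- Subbundles on the members of an open cover that agree on overlaps glue. -/
theorem exists_glue {I : Type u} {U : I → Scheme.{u}} (f : ∀ i, U i ⟶ T)
    [∀ i, IsOpenImmersion (f i)] (hf : ∀ t, ∃ i, t ∈ Set.range (f i))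
    (x : ∀ i, Subbundles E l (U i))
    (h : ∀ i k {W : Scheme.{u}} (a : W ⟶ U i) (b : W ⟶ U k), a ≫ f i = b ≫ f k →
      map hE a (x i) = map hE b (x k)) :
    ∃ y : Subbundles E l T, ∀ i, map hE (f i) y = x i := by
  let θ := fun i => pullbackIso (Limits.terminal.comp_from (f i)) E
  have hmono (i) : Mono (x i).incl := (x i).isSubbundle.mono
  obtain ⟨S₀, s, hs, hs'⟩ := GrassmannZero.exists_glue f (fun i => (x i).incl ≫ (θ i).inv) (by
    intro i k W a b d ha hb
    have h1 := (map_eq_map_iff hE _ _ _ _).mp (h i k a b (ha.trans hb.symm))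
    have h2 := h1.comp (pullbackIso (Limits.terminal.comp_from d) E).inv
    have key (i) (a : W ⟶ U i) (ha : a ≫ f i = d) :
        (Scheme.Modules.pullback a).map ((x i).incl ≫ (θ i).inv) ≫ (pullbackIso ha _).hom =
          restr E a (x i).incl ≫ (pullbackIso (Limits.terminal.comp_from d) E).inv := by
      rw [Iso.eq_comp_inv, Category.assoc, ← pullbackIso_assoc
        (Limits.terminal.comp_from (f i)) (Limits.terminal.comp_from a), restr,
        ← Functor.map_comp_assoc, Category.assoc, Iso.inv_hom_id, Category.comp_id]
    rw [key i a ha, key k b hb]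
    exact h2)
  have hsub : IsSubbundle s l := isSubbundle_of_locally (hE.pullback _) fun t => by
    obtain ⟨i, hi⟩ := hf t
    exact ⟨U i, f i, inferInstance, hi,
      (hs' i).symm.isSubbundle ((x i).isSubbundle.comp_iso (θ i).symm)⟩
  refine ⟨mk s hsub, fun i => ?_⟩
  rw [map_mk]
  refine ((mk_eq_mk_iff _ (x i).isSubbundle).mpr ?_).trans (x i).mk_incl
  have h3 := (hs' i).comp (θ i).hom
  rwa [Category.assoc, Iso.inv_hom_id, Category.comp_id] at h3

/-- The functor of rank `l` subbundles of the constant bundle with fibre `E`. -/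
def presheaf : Scheme.{u}ᵒᵖ ⥤ Type u where
  obj T := Subbundles E l T.unop
  map g := TypeCat.ofHom (map hE g.unop)
  map_id T := by ext x; exact map_id hE x
  map_comp f g := by ext x; exact map_comp hE _ _ x

/-- Locality of equality is `ext_of_cover` and existence is `exists_glue`. A glued subsheaf is again
a subbundle because being one is a local condition. -/
theorem isSheaf : Presieve.IsSheaf Scheme.zariskiTopology.{u} (presheaf (l := l) hE) := by
  rw [Precoverage.isSheaf_toGrothendieck_iff_of_isStableUnderBaseChange_of_small.{u}]
  intro T (𝒰 : T.OpenCover)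
  refine (Presieve.isSheafFor_arrows_iff _ _).mpr fun x hx => ?_
  obtain ⟨y, hy⟩ := exists_glue hE 𝒰.f (fun t => by
    obtain ⟨i, u, h⟩ := 𝒰.exists_eq t
    exact ⟨i, u, h⟩) x (fun i k W a b h => hx i k W a b h)
  refine ⟨y, hy, fun z hz => ext_of_cover hE fun t => ?_⟩
  obtain ⟨i, u, h⟩ := 𝒰.exists_eq t
  exact ⟨_, 𝒰.f i, inferInstance, ⟨u, h⟩, (hz i).trans (hy i).symm⟩

end Subbundles

end GrassmannZero
end

/-! ### Frames under iterated pullback, and isomorphism loci. -/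

noncomputable section
namespace GrassmannZero
variable {X Y T : Scheme.{u}}

/-- Transposed along the adjunction of `g ≫ p`, both sides are morphisms out of `O_Y`. They agree
because ring homomorphisms preserve `1`. -/
theorem pullbackComp_inv_pullbackUnitHom (g : T ⟶ X) (p : X ⟶ Y) :
    (Scheme.Modules.pullbackComp g p).inv.app (structureModule Y) ≫
      (Scheme.Modules.pullback g).map (pullbackUnitHom p) ≫ pullbackUnitHom g =
      pullbackUnitHom (g ≫ p) := by
  apply ((Scheme.Modules.pullbackPushforwardAdjunction (g ≫ p)).homEquiv _ _).injective
  have h1 : ∀ {Z W : Scheme.{u}} (f : Z ⟶ W),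
      (Scheme.Modules.pullbackPushforwardAdjunction f).unit.app (structureModule W) ≫
        (Scheme.Modules.pushforward f).map (pullbackUnitHom f) = unitToPushforward f := by
    intro Z W f
    exact ((Adjunction.homEquiv_unit _ _ _ _).symm).trans (Equiv.apply_symm_apply _ _)
  rw [Adjunction.homEquiv_unit, Adjunction.homEquiv_unit, h1, Functor.map_comp]
  have h2 := unit_conjugateEquiv ((Scheme.Modules.pullbackPushforwardAdjunction p).comp
    (Scheme.Modules.pullbackPushforwardAdjunction g))
    (Scheme.Modules.pullbackPushforwardAdjunction (g ≫ p)) (Scheme.Modules.pullbackComp g p).inv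
    (structureModule Y)
  rw [Scheme.Modules.conjugateEquiv_pullbackComp_inv] at h2
  rw [← reassoc_of% h2]
  have h3 := (Scheme.Modules.pushforwardComp g p).hom.naturality
    ((Scheme.Modules.pullback g).map (pullbackUnitHom p) ≫ pullbackUnitHom g)
  refine (congrArg (_ ≫ ·) h3.symm).trans ?_
  have h4 : (Scheme.Modules.pullbackPushforwardAdjunction p).unit.app (structureModule Y) ≫
      (Scheme.Modules.pushforward p).map
        ((Scheme.Modules.pullbackPushforwardAdjunction g).unit.app _ ≫
          (Scheme.Modules.pushforward g).map
            ((Scheme.Modules.pullback g).map (pullbackUnitHom p) ≫ pullbackUnitHom g)) =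
      unitToPushforward p ≫ (Scheme.Modules.pushforward p).map (unitToPushforward g) := by
    have h5 := (Scheme.Modules.pullbackPushforwardAdjunction g).unit.naturality (pullbackUnitHom p)
    rw [Functor.map_comp (Scheme.Modules.pushforward g), ← h1 p, Category.assoc,
      ← Functor.map_comp (Scheme.Modules.pushforward p), ← h1 g]
    congr 2
    exact ((reassoc_of% h5) _).symm
  rw [Adjunction.comp_unit_app]
  have h6 : ((Scheme.Modules.pullbackPushforwardAdjunction p).unit.app (structureModule Y) ≫
      (Scheme.Modules.pushforward p).map
        ((Scheme.Modules.pullbackPushforwardAdjunction g).unit.app _)) ≫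
      (Scheme.Modules.pushforward g ⋙ Scheme.Modules.pushforward p).map
        ((Scheme.Modules.pullback g).map (pullbackUnitHom p) ≫ pullbackUnitHom g) =
      unitToPushforward p ≫ (Scheme.Modules.pushforward p).map (unitToPushforward g) := by
    rw [← h4, Functor.map_comp (Scheme.Modules.pushforward p), Category.assoc]
    rfl
  refine (Category.assoc _ _ _).symm.trans ((congrArg (· ≫ _) h6).trans ?_)
  refine hom_structureModule_ext ?_
  change ((g.app (p ⁻¹ᵁ ⊤)).hom ((p.app ⊤).hom 1)) = ((g ≫ p).app ⊤).hom 1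
  rw [map_one, map_one, map_one]
  rfl

theorem pullbackIso_pullbackUnitIso {g : T ⟶ X} {p : X ⟶ Y} {f : T ⟶ Y} (h : g ≫ p = f) :
    (pullbackIso h (structureModule Y)).hom ≫ (pullbackUnitIso f).hom =
      (Scheme.Modules.pullback g).map (pullbackUnitIso p).hom ≫ (pullbackUnitIso g).hom := by
  subst h
  have := pullbackComp_inv_pullbackUnitHom g p
  rw [show (Scheme.Modules.pullbackComp g p).inv.app (structureModule Y) =
    ((Scheme.Modules.pullbackComp g p).app (structureModule Y)).inv from rfl,
    Iso.inv_comp_eq] at this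
  refine Eq.trans ?_ this.symm
  congr 1

theorem Frame.ext_e {M : X.Modules} {ι : Type*} [Fintype ι] {a b : Frame M ι}
    (h : ∀ i, a.e i = b.e i) : a = b := by
  classical
  have he : a.e = b.e := funext h
  have hp : a.p = b.p := funext fun j => a.hom_ext fun i => by
    rw [show a.e i ≫ b.p j = b.e i ≫ b.p j by rw [h]]
    by_cases hij : i = j
    · subst hij; rw [a.e_p_self, b.e_p_self]
    · rw [a.e_p_ne _ _ hij, b.e_p_ne _ _ hij]
  obtain ⟨e, p, h1, h2, h3⟩ := a
  obtain ⟨e', p', h1', h2', h3'⟩ := b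
  cases he
  cases hp
  rfl

/-- The two frames are equal, not merely related by some base change matrix. Hence matrices computed
before and after a further pullback can be compared entry by entry. -/
theorem Frame.pullback_pullback {M : Y.Modules} {ι : Type*} [Fintype ι] (a : Frame M ι) {g : T ⟶ X}
    {p : X ⟶ Y} {f : T ⟶ Y} (h : g ≫ p = f) :
    ((a.pullback p).pullback g).congr (pullbackIso h M) = a.pullback f := by
  refine Frame.ext_e fun i => ?_
  have h1 := pullbackIso_pullbackUnitIso h
  change ((pullbackUnitIso g).inv ≫ (Scheme.Modules.pullback g).map
    ((pullbackUnitIso p).inv ≫ (Scheme.Modules.pullback p).map (a.e i))) ≫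
      (pullbackIso h M).hom = (pullbackUnitIso f).inv ≫ (Scheme.Modules.pullback f).map (a.e i)
  rw [Functor.map_comp, Category.assoc, Category.assoc, pullbackIso_naturality, Iso.inv_comp_eq,
    ← cancel_epi ((Scheme.Modules.pullback g).map (pullbackUnitIso p).hom), ← reassoc_of% h1,
    Iso.hom_inv_id_assoc, ← Functor.map_comp_assoc, Iso.hom_inv_id]
  simp

/-- The open locus where a morphism of vector bundles of the same rank is an isomorphism. -/
theorem exists_isIso_locus {M N : T.Modules} {r : ℕ} (hM : IsVectorBundle M r)
    (hN : IsVectorBundle N r) (φ : M ⟶ N) : ∃ V : T.Opens, ∀ {S : Scheme.{u}} (g : S ⟶ T),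
      IsIso ((Scheme.Modules.pullback g).map φ) ↔ Set.range g ⊆ V := by
  refine ⟨sSup {V | ∃ (U : Scheme.{u}) (i : U ⟶ T) (_ : IsOpenImmersion i),
    i.opensRange = V ∧ IsIso ((Scheme.Modules.pullback i).map φ)}, fun {S} g => ⟨?_, ?_⟩⟩
  · rintro h _ ⟨y, rfl⟩
    obtain ⟨U, i, hi, hx, ⟨a⟩⟩ := hM.hasFrameNear (g y)
    obtain ⟨U', i', hi', hx', ⟨b⟩⟩ := hN.hasFrameNear (g y)
    obtain ⟨W, c, d, hc, hd, e, ⟨w, hw⟩⟩ := exists_common_openImmersion i i' hx hx'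
    let a' := (a.pullback c).congr (pullbackIso rfl M)
    let b' := (b.pullback d).congr (pullbackIso e.symm N)
    let δ := (a'.mat b' ((Scheme.Modules.pullback (c ≫ i)).map φ)).det
    obtain ⟨z, hz, hz'⟩ := Scheme.Pullback.exists_preimage_pullback (f := c ≫ i) (g := g) w y hw
    -- `φ` is an isomorphism over `S`, so its determinant becomes invertible on the fibre product.
    -- Therefore `δ` does not vanish at `w`, and `φ` is already an isomorphism over the basic open
    -- set of `δ`.
    have hu : IsUnit ((Limits.pullback.fst (c ≫ i) g).appTop.hom δ) := by
      rw [RingHom.map_det]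
      have := Frame.mat_pullback a' b' (Limits.pullback.fst (c ≫ i) g)
        ((Scheme.Modules.pullback (c ≫ i)).map φ)
      rw [RingHom.mapMatrix_apply, ← this, ← Frame.isIso_iff_isUnit_det]
      have h1 := pullbackIso_naturality (Limits.pullback.condition (f := c ≫ i) (g := g)) φ
      have h2 := pullbackIso_naturality (rfl : Limits.pullback.snd (c ≫ i) g ≫ g = _) φ
      rw [← Iso.eq_comp_inv] at h1
      rw [← Iso.inv_comp_eq] at h2
      rw [h1, ← h2]
      infer_instance
    have hw' : w ∈ W.basicOpen δ := by
      rw [← hz]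
      exact (isUnit_appTop_iff _ δ).mp hu z
    refine TopologicalSpace.Opens.mem_sSup.mpr ⟨_, ⟨_, (W.basicOpen δ).ι ≫ c ≫ i, inferInstance,
      rfl, ?_⟩, ⟨⟨w, hw'⟩, ?_⟩⟩
    · have h1 := pullbackIso_naturality (rfl : (W.basicOpen δ).ι ≫ c ≫ i = _) φ
      rw [← Iso.inv_comp_eq] at h1
      have : IsIso ((Scheme.Modules.pullback (W.basicOpen δ).ι).map
          ((Scheme.Modules.pullback (c ≫ i)).map φ)) := by
        rw [Frame.isIso_iff_isUnit_det (a'.pullback _) (b'.pullback _), Frame.mat_pullback,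
          ← RingHom.mapMatrix_apply, ← RingHom.map_det]
        exact (isUnit_appTop_iff _ δ).mpr fun y => y.2
      rw [← h1]
      infer_instance
    · exact hw
  · intro h
    refine isIso_of_locally _ fun y => ?_
    obtain ⟨V, ⟨U, i, hi, rfl, hφ⟩, ⟨t, ht⟩⟩ := TopologicalSpace.Opens.mem_sSup.mp (h ⟨y, rfl⟩)
    refine ⟨_, Limits.pullback.snd i g, inferInstance, ?_, ?_⟩
    · obtain ⟨z, _, hz⟩ := Scheme.Pullback.exists_preimage_pullback (f := i) (g := g) t y ht
      exact ⟨z, hz⟩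
    · have h1 := pullbackIso_naturality (Limits.pullback.condition (f := i) (g := g)) φ
      have h2 := pullbackIso_naturality (rfl : Limits.pullback.snd i g ≫ g = _) φ
      rw [← Iso.inv_comp_eq] at h1
      rw [← Iso.eq_comp_inv] at h2
      rw [h2, ← h1]
      infer_instance

/-- A split monomorphism of framed bundles has an invertible maximal minor near each point. -/
theorem exists_mem_basicOpen_det_of_mul_eq_one {n r : ℕ} (A : Matrix (Fin r) (Fin n) Γ(T, ⊤))
    (B : Matrix (Fin n) (Fin r) Γ(T, ⊤)) (h : A * B = 1) (t : T) :
    ∃ e : Fin r ↪ Fin n, t ∈ T.basicOpen (A.submatrix id e).det := by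
  let γ : Γ(T, ⊤) →+* T.residueField t :=
    (Scheme.ΓSpecIso (T.residueField t)).hom.hom.comp (T.fromSpecResidueField t).appTop.hom
  obtain ⟨e, he⟩ := exists_submatrix_det_ne_zero (A.map γ).transpose (by
    intro c hc
    rw [Matrix.mulVec_transpose] at hc
    have h1 : A.map γ * B.map γ = 1 := by
      rw [← Matrix.map_mul, h, Matrix.map_one _ (map_zero γ) (map_one γ)]
    rw [← Matrix.vecMul_one c, ← h1, ← Matrix.vecMul_vecMul, hc, Matrix.zero_vecMul])
  refine ⟨e, ?_⟩
  have h1 : γ (A.submatrix id e).det ≠ 0 := by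
    rw [RingHom.map_det, ← Matrix.det_transpose]
    exact he
  have h2 : IsUnit ((T.fromSpecResidueField t).appTop.hom (A.submatrix id e).det) := by
    have := (isUnit_iff_ne_zero.mpr h1).map (Scheme.ΓSpecIso (T.residueField t)).inv.hom
    simpa [γ] using this
  have h5 : T.fromSpecResidueField t (IsLocalRing.closedPoint (T.residueField t)) = t :=
    Scheme.fromSpecResidueField_apply _ _
  rw [← h5]
  exact (isUnit_appTop_iff _ _).mp h2 _

end GrassmannZero
end

/-! ### The standard affine charts of the Grassmannian. -/

noncomputable section
namespace GrassmannZero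
variable {X Y T : Scheme.{u}}

section Charts

variable {E : (⊤_ Scheme.{u}).Modules} {n l : ℕ} (a : Frame E (Fin n)) (e : Fin l ↪ Fin n)

theorem mat_restr (g : X ⟶ Y) {S : Y.Modules} {ι : Type*} [Fintype ι] (c : Frame S ι)
    (j : S ⟶ (Scheme.Modules.pullback (bang Y)).obj E) :
    (c.pullback g).mat (a.pullback (bang X)) (restr E g j) =
      (c.mat (a.pullback (bang Y)) j).map g.appTop.hom := by
  rw [← Frame.pullback_pullback a (Limits.terminal.comp_from g), ← Frame.mat_pullback]
  ext i k
  simp [Frame.mat_apply, Frame.congr, restr]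

/-- The subsheaf of the constant bundle spanned by the rows of a matrix. -/
def rowSpace (A : Matrix (Fin l) (Fin n) Γ(T, ⊤)) :
    freeModule T (ULift.{u} (Fin l)) ⟶ (Scheme.Modules.pullback (bang T)).obj E :=
  (Frame.ofFree T l).ofMat (a.pullback (bang T)) A

theorem mat_rowSpace (A : Matrix (Fin l) (Fin n) Γ(T, ⊤)) :
    (Frame.ofFree T l).mat (a.pullback (bang T)) (rowSpace a A) = A := Frame.mat_ofMat _ _ _

/-- The matrix of the projection to the coordinates in the image of `e`. -/
def selector (R : Type*) [CommRing R] : Matrix (Fin n) (Fin l) R :=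
  Matrix.of fun κ k => if κ = e k then 1 else 0

theorem mul_selector {R : Type*} [CommRing R] {ι : Type*} (A : Matrix ι (Fin n) R) :
    A * selector e R = A.submatrix id e := by
  ext i k
  simp [selector, Matrix.mul_apply]

theorem map_selector {R R' : Type*} [CommRing R] [CommRing R'] (f : R →+* R') :
    (selector e R).map f = selector e R' := by
  ext κ k
  simp only [selector, Matrix.map_apply, Matrix.of_apply]
  split_ifs <;> simp

/-- The projection of the constant bundle to the coordinates in the image of `e`. -/
def coordProj (T : Scheme.{u}) : (Scheme.Modules.pullback (bang T)).obj E ⟶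
    freeModule T (ULift.{u} (Fin l)) :=
  (a.pullback (bang T)).ofMat (Frame.ofFree T l) (selector e _)

variable {e}

theorem rowSpace_coordProj {A : Matrix (Fin l) (Fin n) Γ(T, ⊤)} (hA : A.submatrix id e = 1) :
    rowSpace a A ≫ coordProj a e T = 𝟙 _ := by
  apply (Frame.ofFree T l).mat_injective (Frame.ofFree T l)
  rw [Frame.mat_comp _ (a.pullback (bang T)), rowSpace, coordProj, Frame.mat_ofMat, Frame.mat_ofMat,
    mul_selector, hA, Frame.mat_id]

theorem rowSpace_isSubbundle {A : Matrix (Fin l) (Fin n) Γ(T, ⊤)} (hA : A.submatrix id e = 1) :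
    IsSubbundle (rowSpace a A) l := by
  refine (isSubbundle_iff (a.pullback (bang T)).isVectorBundle _).mpr
    ⟨(Frame.ofFree T l).isVectorBundle, ?_⟩
  have : IsSplitMono (rowSpace a A) := IsSplitMono.mk' ⟨_, rowSpace_coordProj a hA⟩
  exact LocSplitMono.of_isSplitMono _

theorem restr_rowSpace (g : X ⟶ Y) (A : Matrix (Fin l) (Fin n) Γ(Y, ⊤)) :
    SameImage (restr E g (rowSpace a A)) (rowSpace a (A.map g.appTop.hom)) := by
  refine ⟨((Frame.ofFree Y l).pullback g).iso (Frame.ofFree X l), ?_⟩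
  apply ((Frame.ofFree Y l).pullback g).mat_injective (a.pullback (bang X))
  rw [mat_restr, mat_rowSpace, Frame.mat_comp _ (Frame.ofFree X l), mat_rowSpace, Frame.iso,
    Frame.mat_ofMat]
  exact Matrix.one_mul _

/-- An isomorphism of the row spaces has a matrix `P` with `P * A' = A`. The columns in the image of
`e` read `P = 1`. -/
theorem eq_of_sameImage_rowSpace {A A' : Matrix (Fin l) (Fin n) Γ(T, ⊤)}
    (hA : A.submatrix id e = 1) (hA' : A'.submatrix id e = 1)
    (h : SameImage (rowSpace a A) (rowSpace a A')) : A = A' := by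
  obtain ⟨f, hf⟩ := h
  have h1 := congrArg ((Frame.ofFree T l).mat (a.pullback (bang T))) hf
  rw [Frame.mat_comp _ (Frame.ofFree T l), mat_rowSpace, mat_rowSpace] at h1
  have h2 : (Frame.ofFree T l).mat (Frame.ofFree T l) f.hom * A' * selector e _ =
      A * selector e _ := by rw [h1]
  have h3 : (Frame.ofFree T l).mat (Frame.ofFree T l) f.hom = 1 := by
    refine (Matrix.mul_one _).symm.trans (Eq.trans ?_ (h2.trans ?_))
    · exact (congrArg (_ * ·) ((mul_selector e A').trans hA')).symm.trans
        (Matrix.mul_assoc _ _ _).symm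
    · exact (mul_selector e A).trans hA
  rw [← h1, h3]
  exact (Matrix.one_mul _)

variable (e) in
/-- The subbundle projects isomorphically to the coordinates in the image of `e`. -/
def InChart (x : Subbundles E l T) : Prop := IsIso (x.incl ≫ coordProj a e T)

/-- Precomposing the inclusion with the inverse of the projection is row reduction: it normalizes
the columns in the image of `e` to the identity matrix. -/
theorem inChart_iff (x : Subbundles E l T) : InChart a e x ↔
    ∃ (A : Matrix (Fin l) (Fin n) Γ(T, ⊤)) (hA : A.submatrix id e = 1),
      Subbundles.mk (rowSpace a A) (rowSpace_isSubbundle a hA) = x := by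
  constructor
  · intro h
    have : IsIso (x.incl ≫ coordProj a e T) := h
    have hrow : rowSpace a ((Frame.ofFree T l).mat (a.pullback (bang T))
        (inv (x.incl ≫ coordProj a e T) ≫ x.incl)) = inv (x.incl ≫ coordProj a e T) ≫ x.incl :=
      Frame.ofMat_mat _ _ _
    refine ⟨(Frame.ofFree T l).mat (a.pullback (bang T))
      (inv (x.incl ≫ coordProj a e T) ≫ x.incl), ?_, ?_⟩
    · rw [← mul_selector, ← (a.pullback (bang T)).mat_ofMat (Frame.ofFree T l) (selector e _),
        ← Frame.mat_comp]
      change (Frame.ofFree T l).mat _ ((inv (x.incl ≫ coordProj a e T) ≫ x.incl) ≫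
        coordProj a e T) = 1
      rw [Category.assoc, IsIso.inv_hom_id, Frame.mat_id]
    · refine Eq.trans ?_ x.mk_incl
      refine (Subbundles.mk_eq_mk_iff _ _).mpr ⟨(asIso (x.incl ≫ coordProj a e T)).symm, ?_⟩
      exact hrow.symm
  · rintro ⟨A, hA, rfl⟩
    obtain ⟨f, hf⟩ := Subbundles.mk_incl_sameImage (rowSpace_isSubbundle a hA)
    rw [InChart, ← hf, Category.assoc, rowSpace_coordProj a hA]
    infer_instance

/-- The projection has a matrix with entries `0` and `1`, which every ring homomorphism fixes, so it
is compatible with base change. -/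
theorem pullback_coordProj (g : X ⟶ Y) : ∃ τ : (Scheme.Modules.pullback g).obj
    (freeModule Y (ULift.{u} (Fin l))) ≅ freeModule X (ULift.{u} (Fin l)),
    (pullbackIso (Limits.terminal.comp_from g) E).hom ≫ coordProj a e X =
      (Scheme.Modules.pullback g).map (coordProj a e Y) ≫ τ.hom := by
  refine ⟨((Frame.ofFree Y l).pullback g).iso (Frame.ofFree X l), ?_⟩
  apply ((a.pullback (bang Y)).pullback g).mat_injective (Frame.ofFree X l)
  rw [Frame.mat_comp _ (a.pullback (bang X)), Frame.mat_comp _ ((Frame.ofFree Y l).pullback g),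
    Frame.iso, Frame.mat_ofMat, Frame.mat_pullback, coordProj, coordProj, Frame.mat_ofMat,
    Frame.mat_ofMat, Matrix.mul_one, map_selector,
    ← Frame.pullback_pullback a (Limits.terminal.comp_from g)]
  convert Matrix.one_mul _
  rw [← Frame.mat_id ((a.pullback (bang Y)).pullback g)]
  ext i k
  simp [Frame.mat_apply, Frame.congr]

theorem inChart_map_mk_iff (g : X ⟶ Y) {S : Y.Modules}
    {j : S ⟶ (Scheme.Modules.pullback (bang Y)).obj E} (h : IsSubbundle j l) :
    InChart a e (Subbundles.map a.isVectorBundle g (Subbundles.mk j h)) ↔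
      IsIso ((Scheme.Modules.pullback g).map (j ≫ coordProj a e Y)) := by
  obtain ⟨f, hf⟩ := Subbundles.mk_incl_sameImage (h.restr a.isVectorBundle g)
  obtain ⟨τ, hτ⟩ := pullback_coordProj a (e := e) g
  have key : restr E g j ≫ coordProj a e X =
      (Scheme.Modules.pullback g).map (j ≫ coordProj a e Y) ≫ τ.hom := by
    rw [restr, Category.assoc, hτ, ← Functor.map_comp_assoc]
  rw [Subbundles.map_mk, InChart, ← hf, Category.assoc, key, isIso_comp_left_iff,
    isIso_comp_right_iff]

variable (e) in
/-- The chart of the Grassmannian in which the coordinates in the image of `e` can be prescribed. -/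
def chart : Scheme.{u} :=
  AffineSpace (ULift.{u} (Fin l × {κ : Fin n // κ ∉ Set.range e})) (⊤_ Scheme.{u})

variable (e) in
open Classical in
/-- The universal matrix on the chart. -/
def chartMat : Matrix (Fin l) (Fin n) Γ(chart.{u} e, ⊤) :=
  Matrix.of fun i κ => if h : κ ∈ Set.range e then (1 : Matrix (Fin l) (Fin l) _) i h.choose else
    AffineSpace.coord _ ⟨(i, ⟨κ, h⟩)⟩

theorem apply_of_submatrix_eq_one {R : Type*} [CommRing R] {A : Matrix (Fin l) (Fin n) R}
    (hA : A.submatrix id e = 1) {κ : Fin n} (h : κ ∈ Set.range e) (i : Fin l) :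
    A i κ = (1 : Matrix (Fin l) (Fin l) R) i h.choose := by
  rw [← hA, Matrix.submatrix_apply, h.choose_spec]; rfl

theorem chartMat_submatrix : (chartMat.{u} e).submatrix id e = 1 := by
  ext i k
  have h : e k ∈ Set.range e := ⟨k, rfl⟩
  have h1 : chartMat.{u} e i (e k) = (1 : Matrix (Fin l) (Fin l) _) i h.choose := dif_pos h
  rw [e.injective h.choose_spec] at h1
  exact h1

theorem chartMat_apply {κ : Fin n} (h : κ ∉ Set.range e) (i : Fin l) :
    chartMat.{u} e i κ = AffineSpace.coord _ ⟨(i, ⟨κ, h⟩)⟩ := dif_neg h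

theorem submatrix_map_eq_one {R R' : Type*} [CommRing R] [CommRing R']
    {A : Matrix (Fin l) (Fin n) R} (hA : A.submatrix id e = 1) (f : R →+* R') :
    (A.map f).submatrix id e = 1 := by
  rw [Matrix.submatrix_map, hA, Matrix.map_one _ (map_zero f) (map_one f)]

theorem chart_hom_ext {g g' : T ⟶ chart.{u} e}
    (h : (chartMat e).map g.appTop.hom = (chartMat e).map g'.appTop.hom) : g = g' := by
  refine AffineSpace.hom_ext (Limits.terminal.hom_ext _ _) fun ⟨(i, ⟨κ, hκ⟩)⟩ => ?_
  have h1 := congrFun (congrFun h i) κ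
  rw [Matrix.map_apply, Matrix.map_apply, chartMat_apply hκ] at h1
  exact h1

theorem exists_chart_hom {A : Matrix (Fin l) (Fin n) Γ(T, ⊤)} (hA : A.submatrix id e = 1) :
    ∃ g : T ⟶ chart.{u} e, (chartMat e).map g.appTop.hom = A := by
  refine ⟨AffineSpace.homOfVector (bang T) fun q => A q.down.1 q.down.2, ?_⟩
  ext i κ
  by_cases hκ : κ ∈ Set.range e
  · rw [apply_of_submatrix_eq_one hA hκ,
      apply_of_submatrix_eq_one (submatrix_map_eq_one chartMat_submatrix _) hκ]
  · rw [Matrix.map_apply, chartMat_apply hκ]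
    exact AffineSpace.homOfVector_appTop_coord _ _ _

variable (e) in
/-- The tautological subbundle on the chart. -/
def chartPoint : Subbundles E l (chart.{u} e) :=
  Subbundles.mk (rowSpace a (chartMat e)) (rowSpace_isSubbundle a chartMat_submatrix)

theorem map_chartPoint (g : T ⟶ chart.{u} e) :
    Subbundles.map a.isVectorBundle g (chartPoint a e) =
      Subbundles.mk (rowSpace a ((chartMat e).map g.appTop.hom))
        (rowSpace_isSubbundle a (submatrix_map_eq_one chartMat_submatrix _)) :=
  (Subbundles.map_mk _ _ _).trans ((Subbundles.mk_eq_mk_iff _ _).mpr (restr_rowSpace a g _))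

theorem map_chartPoint_injective {g g' : T ⟶ chart.{u} e}
    (h : Subbundles.map a.isVectorBundle g (chartPoint a e) =
      Subbundles.map a.isVectorBundle g' (chartPoint a e)) : g = g' := by
  rw [map_chartPoint, map_chartPoint, Subbundles.mk_eq_mk_iff] at h
  exact chart_hom_ext (eq_of_sameImage_rowSpace a
    (submatrix_map_eq_one chartMat_submatrix _) (submatrix_map_eq_one chartMat_submatrix _) h)

/-- The columns outside the image of `e` are arbitrary functions, that is, a morphism to an affine
space. So the chart represents the condition `InChart`. -/
theorem inChart_iff_exists_hom (x : Subbundles E l T) : InChart a e x ↔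
    ∃ g : T ⟶ chart.{u} e, Subbundles.map a.isVectorBundle g (chartPoint a e) = x := by
  rw [inChart_iff]
  constructor
  · rintro ⟨A, hA, rfl⟩
    obtain ⟨g, rfl⟩ := exists_chart_hom hA
    exact ⟨g, map_chartPoint a g⟩
  · rintro ⟨g, rfl⟩
    exact ⟨_, submatrix_map_eq_one chartMat_submatrix _, (map_chartPoint a g).symm⟩

variable (e) in
/-- The chart as a subfunctor of the functor of subbundles. -/
def chartHom : yoneda.obj (chart.{u} e) ⟶ Subbundles.presheaf (l := l) a.isVectorBundle :=
  yonedaEquiv.symm (chartPoint a e)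

/-- The open locus where a subbundle lies in a given chart. -/
theorem exists_chart_locus (x : Subbundles E l T) : ∃ V : T.Opens, ∀ {S : Scheme.{u}} (g : S ⟶ T),
    InChart a e (Subbundles.map a.isVectorBundle g x) ↔ Set.range g ⊆ V := by
  obtain ⟨V, hV⟩ := exists_isIso_locus x.isSubbundle.isVectorBundle
    (Frame.ofFree T l).isVectorBundle (x.incl ≫ coordProj a e T)
  refine ⟨V, fun g => Iff.trans ?_ (hV g)⟩
  conv_lhs => rw [← x.mk_incl]
  exact inChart_map_mk_iff a g x.isSubbundle

/-- For a subbundle `x` on `T`, the fibre product of `T` with the chart is the open set where the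
projection of `x` to the chosen coordinates is an isomorphism; there `x` is classified by a unique
morphism to the chart. -/
theorem chartHom_isOpenImmersion : IsOpenImmersion.presheaf (chartHom a e) := by
  refine MorphismProperty.relative.of_exists fun T g => ?_
  obtain ⟨(x : Subbundles E l T), rfl⟩ := yonedaEquiv.symm.surjective g
  obtain ⟨V, hV⟩ := exists_chart_locus (e := e) a x
  obtain ⟨c, hc⟩ := (inChart_iff_exists_hom a _).mp ((hV V.ι).mpr (by simp))
  refine ⟨V, yoneda.map c, V.ι, ?_, inferInstance⟩
  refine IsPullback.of_forall_isPullback_app fun ⟨S⟩ => ?_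
  rw [Limits.Types.isPullback_iff]
  refine ⟨?_, ?_, ?_⟩
  · ext (s : S ⟶ V)
    refine (Subbundles.map_comp a.isVectorBundle s c (chartPoint a e)).trans ?_
    exact (congrArg _ hc).trans (Subbundles.map_comp a.isVectorBundle s V.ι x).symm
  · rintro s s' ⟨-, h⟩
    exact (cancel_mono V.ι).mp h
  · intro (s : S ⟶ chart e) (t : S ⟶ T) h
    have h1 : Subbundles.map a.isVectorBundle s (chartPoint a e) =
      Subbundles.map a.isVectorBundle t x := h
    have h2 : Set.range t ⊆ V := (hV t).mp ((inChart_iff_exists_hom a _).mpr ⟨s, h1⟩)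
    refine ⟨IsOpenImmersion.lift V.ι t (by simpa using h2), ?_, IsOpenImmersion.lift_fac _ _ _⟩
    refine map_chartPoint_injective a (Eq.trans ?_ h1.symm)
    refine (Subbundles.map_comp a.isVectorBundle _ c (chartPoint a e)).trans ?_
    rw [hc, ← Subbundles.map_comp, IsOpenImmersion.lift_fac]

/-- Every subbundle lies in some chart near each point. -/
theorem exists_inChart_near (x : Subbundles E l T) (t : T) : ∃ (e : Fin l ↪ Fin n) (U : Scheme.{u})
    (i : U ⟶ T) (_ : IsOpenImmersion i), t ∈ Set.range i ∧
      InChart a e (Subbundles.map a.isVectorBundle i x) := by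
  obtain ⟨U, i, hi, hx, ⟨c⟩⟩ := x.isSubbundle.isVectorBundle.hasFrameNear t
  obtain ⟨U', i', hi', hx', hs⟩ :=
    x.isSubbundle.locSplitMono (a.isVectorBundle.pullback (bang T)) t
  obtain ⟨W, p, q, hp, hq, hpq, ⟨w, hw⟩⟩ := exists_common_openImmersion i i' hx hx'
  let c' := (c.pullback p).congr (pullbackIso rfl x.sheaf)
  have h1 := pullbackIso_naturality hpq.symm x.incl
  rw [← Iso.inv_comp_eq] at h1
  let ρ := (pullbackIso (Limits.terminal.comp_from (p ≫ i)) E).inv ≫ (pullbackIso hpq.symm _).inv ≫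
    (Scheme.Modules.pullback q).map (retraction ((Scheme.Modules.pullback i').map x.incl)) ≫
      (pullbackIso hpq.symm _).hom
  have hρ : restr E (p ≫ i) x.incl ≫ ρ = 𝟙 _ := by
    rw [restr, ← h1]
    simp only [ρ, Category.assoc, Iso.hom_inv_id_assoc]
    rw [← Functor.map_comp_assoc, IsSplitMono.id]
    simp
  have h2 := congrArg (c'.mat c') hρ
  rw [Frame.mat_comp _ (a.pullback (bang W)), Frame.mat_id] at h2
  -- The retraction makes the matrix of the inclusion right invertible, so some maximal minor is
  -- nonzero at `w`; its columns choose the chart.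
  obtain ⟨e, he⟩ := exists_mem_basicOpen_det_of_mul_eq_one _ _ h2 w
  refine ⟨e, _, (W.basicOpen _).ι ≫ p ≫ i, inferInstance, ⟨⟨w, he⟩, hw⟩, ?_⟩
  have hy : Subbundles.map a.isVectorBundle (p ≫ i) x =
      Subbundles.mk (restr E (p ≫ i) x.incl) (x.isSubbundle.restr a.isVectorBundle _) := rfl
  rw [Subbundles.map_comp, hy, inChart_map_mk_iff,
    Frame.isIso_iff_isUnit_det (c'.pullback _) ((Frame.ofFree W l).pullback _), Frame.mat_pullback,
    ← RingHom.mapMatrix_apply, ← RingHom.map_det, Frame.mat_comp _ (a.pullback (bang W)), coordProj,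
    Frame.mat_ofMat, mul_selector]
  exact (isUnit_appTop_iff _ _).mpr fun y => y.2

end Charts

end GrassmannZero
end

/-! ### Representability over the terminal scheme. -/

noncomputable section
namespace GrassmannZero

variable {E : (⊤_ Scheme.{u}).Modules} {n l : ℕ} (a : Frame E (Fin n))

/-- Smoothness, as a property of morphisms of schemes. -/
abbrev smoothMorphisms : MorphismProperty Scheme.{u} := @Smooth

/-- The terminal scheme is `Spec ℤ`, and a polynomial algebra in finitely many variables is smooth.
-/
theorem smooth_bang_mvPolynomial (m : Type u) [Finite m] :
    Smooth (bang (Spec (.of (MvPolynomial m (ULift.{u} ℤ))))) := by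
  have := Limits.isIso_of_isTerminal specULiftZIsTerminal.{u} Limits.terminalIsTerminal (Limits.terminal.from _)
  rw [bang, ← Limits.terminal.comp_from
    (Spec.map (CommRingCat.ofHom (MvPolynomial.C (R := ULift.{u} ℤ) (σ := m))))]
  refine (MorphismProperty.cancel_right_of_respectsIso smoothMorphisms _ _).mpr
    ((HasRingHomProperty.Spec_iff (P := smoothMorphisms)).mpr ?_)
  exact RingHom.smooth_algebraMap.mpr
    (⟨inferInstance, inferInstance⟩ : Algebra.Smooth (ULift.{u} ℤ) (MvPolynomial m (ULift.{u} ℤ)))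

theorem smooth_bang_chart (e : Fin l ↪ Fin n) : Smooth (bang (chart.{u} e)) := by
  have h := smooth_bang_mvPolynomial.{u} (ULift.{u} (Fin l × {κ : Fin n // κ ∉ Set.range e}))
  have : bang (chart.{u} e) = Limits.pullback.fst (bang (⊤_ Scheme.{u}))
      (bang (Spec (.of (MvPolynomial (ULift.{u} (Fin l × {κ : Fin n // κ ∉ Set.range e})) (ULift.{u} ℤ))))) :=
    Limits.terminal.hom_ext _ _
  rw [this]
  exact MorphismProperty.pullback_fst (P := smoothMorphisms) _ _ h

instance (e : Fin l ↪ Fin n) : IsAffine (chart.{u} e) :=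
  inferInstanceAs (IsAffine (AffineSpace _ _))

variable (l) in
/-- The functor of rank `l` subbundles of a constant bundle, as a Zariski sheaf. -/
def Subbundles.zariskiSheaf {n : ℕ} (hE : IsVectorBundle E n) :
    Sheaf Scheme.zariskiTopology.{u} (Type u) :=
  ⟨Subbundles.presheaf (l := l) hE,
    (isSheaf_iff_isSheaf_of_type _ _).mpr (Subbundles.isSheaf hE)⟩

/-- The family of all charts. -/
def chartHoms (i : ULift.{u} (Fin l ↪ Fin n)) :
    yoneda.obj (chart.{u} i.down) ⟶ (Subbundles.zariskiSheaf l a.isVectorBundle).1 :=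
  chartHom a i.down

theorem chartHoms_isOpenImmersion (i : ULift.{u} (Fin l ↪ Fin n)) :
    IsOpenImmersion.presheaf (chartHoms a i) := chartHom_isOpenImmersion a

theorem chartHoms_imageSieve_mem {T : Scheme.{u}} (x : Subbundles E l T) :
    Presheaf.imageSieve (Limits.Sigma.desc (chartHoms (l := l) a)) (U := T) x ∈
      Scheme.zariskiTopology.{u} T := by
  choose e U i hi ht hc using exists_inChart_near a x
  let 𝒰 : T.OpenCover := .mkOfCovers T U i (fun t => ⟨t, ht t⟩) hi
  refine GrothendieckTopology.superset_covering _ ?_ 𝒰.mem_grothendieckTopology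
  rintro V _ ⟨_, f, _, ⟨t⟩, rfl⟩
  obtain ⟨g, hg⟩ := (inChart_iff_exists_hom a _).mp (hc t)
  refine Sieve.downward_closed _ ?_ f
  refine ⟨((Limits.Sigma.ι (fun i : ULift.{u} (Fin l ↪ Fin n) => yoneda.obj (chart.{u} i.down))
    ⟨e t⟩).app (Opposite.op (U t))).hom g, ?_⟩
  refine Eq.trans ?_ hg
  exact congrArg (fun τ => (τ.app (Opposite.op (U t))).hom g)
    (Limits.Sigma.ι_desc (chartHoms (l := l) a) ⟨e t⟩)

instance : Presheaf.IsLocallySurjective Scheme.zariskiTopology.{u}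
    (Limits.Sigma.desc (chartHoms (l := l) a)) :=
  ⟨fun x => chartHoms_imageSieve_mem a x⟩

variable (l) in
-- The charts are open subfunctors that cover the sheaf locally, so it is represented by their
-- gluing. There are finitely many, each affine and smooth, which gives compactness and smoothness.
theorem exists_universal : ∃ (G : Scheme.{u}) (x : Subbundles E l G), CompactSpace G ∧
    Smooth (bang G) ∧ ∀ (T : Scheme.{u}) (y : Subbundles E l T),
      ∃! g : T ⟶ G, Subbundles.map a.isVectorBundle g x = y := by
  let D := Scheme.LocalRepresentability.glueData (chartHoms_isOpenImmersion (l := l) a)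
  let ρ := Scheme.LocalRepresentability.representableBy (chartHoms_isOpenImmersion (l := l) a)
  refine ⟨D.glued, ρ.homEquiv (𝟙 _), ?_, ?_, fun T y => ?_⟩
  · have : ∀ i, CompactSpace (D.openCover.X i) := fun i => by
      change CompactSpace (chart.{u} i.down); infer_instance
    have : Finite D.openCover.I₀ := inferInstanceAs (Finite (ULift (Fin l ↪ Fin n)))
    exact D.openCover.compactSpace
  · refine (IsZariskiLocalAtSource.iff_of_openCover (P := smoothMorphisms) D.openCover).mpr fun i => ?_
    rw [Limits.terminal.comp_from]
    exact smooth_bang_chart i.down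
  · refine ⟨ρ.homEquiv.symm y, ?_, fun g hg => ?_⟩
    · exact (ρ.homEquiv_eq _).symm.trans (ρ.homEquiv.apply_symm_apply y)
    · apply ρ.homEquiv.injective
      exact ((ρ.homEquiv_eq g).trans hg).trans (ρ.homEquiv.apply_symm_apply y).symm

end GrassmannZero
end

/-! ### Grassmannian bundles: uniqueness, base change, and the bundle of a kernel. -/

noncomputable section
namespace GrassmannZero
variable {X Y Z T T' : Scheme.{u}} {n l : ℕ}

section RestrAlong

variable {E : Y.Modules} {S : X.Modules} {p : X ⟶ Y}

/-- The pullback along `g` of a subsheaf of `p^* E`, as a subsheaf of `f^* E` for `f = p ∘ g`. -/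
def restrAlong {g : T ⟶ X} {f : T ⟶ Y} (hg : g ≫ p = f) (j : S ⟶ (Scheme.Modules.pullback p).obj E) :
    (Scheme.Modules.pullback g).obj S ⟶ (Scheme.Modules.pullback f).obj E :=
  (Scheme.Modules.pullback g).map j ≫ (pullbackIso hg E).hom

theorem restrAlong_comp_map {E' : Y.Modules} {g : T ⟶ X} {f : T ⟶ Y} (hg : g ≫ p = f)
    (j : S ⟶ (Scheme.Modules.pullback p).obj E) (φ : E ⟶ E') :
    restrAlong hg (j ≫ (Scheme.Modules.pullback p).map φ) =
      restrAlong hg j ≫ (Scheme.Modules.pullback f).map φ := by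
  rw [restrAlong, restrAlong, Functor.map_comp, Category.assoc, pullbackIso_naturality,
    Category.assoc]

theorem SameImage.restrAlong {S' : X.Modules} {g : T ⟶ X} {f : T ⟶ Y} (hg : g ≫ p = f)
    {j : S ⟶ (Scheme.Modules.pullback p).obj E} {j' : S' ⟶ (Scheme.Modules.pullback p).obj E}
    (h : SameImage j j') : SameImage (restrAlong hg j) (restrAlong hg j') :=
  (h.pullback g).comp _

theorem restrAlong_id (j : S ⟶ (Scheme.Modules.pullback p).obj E) :
    SameImage (restrAlong (Category.id_comp p) j) j := by
  refine ⟨(Scheme.Modules.pullbackId X).app S, ?_⟩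
  rw [restrAlong, pullbackIso_id_comp]
  exact ((Scheme.Modules.pullbackId X).hom.naturality j).symm

theorem restrAlong_restrAlong {a : T' ⟶ T} {g : T ⟶ X} {f : T ⟶ Y} {f' : T' ⟶ Y}
    (hg : g ≫ p = f) (ha : a ≫ f = f') (hag : (a ≫ g) ≫ p = f')
    (j : S ⟶ (Scheme.Modules.pullback p).obj E) :
    SameImage (restrAlong ha (restrAlong hg j)) (restrAlong hag j) := by
  refine ⟨pullbackIso rfl S, ?_⟩
  rw [restrAlong, restrAlong, restrAlong, Functor.map_comp, Category.assoc,
    pullbackIso_assoc hg ha rfl hag, pullbackIso_naturality_assoc]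

theorem IsSubbundle.restrAlong {g : T ⟶ X} {f : T ⟶ Y} (hg : g ≫ p = f) (hE : IsVectorBundle E n)
    {j : S ⟶ (Scheme.Modules.pullback p).obj E} (h : IsSubbundle j l) :
    IsSubbundle (restrAlong hg j) l := (h.pullback (hE.pullback _) g).comp_iso _

end RestrAlong

theorem restrAlong_comp_eq_zero_iff {E F : Y.Modules} {S : X.Modules} {p : X ⟶ Y} {g : T ⟶ X}
    {f : T ⟶ Y} (hg : g ≫ p = f) (j : S ⟶ (Scheme.Modules.pullback p).obj E) (φ : E ⟶ F) :
    restrAlong hg j ≫ (Scheme.Modules.pullback f).map φ = 0 ↔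
      (Scheme.Modules.pullback g).map (j ≫ (Scheme.Modules.pullback p).map φ) = 0 := by
  rw [← restrAlong_comp_map, restrAlong, ← cancel_mono (pullbackIso hg F).hom, Limits.zero_comp]

theorem SameImage.of_comp_mono {M N : X.Modules} {S S' : X.Modules} {j : S ⟶ M} {j' : S' ⟶ M}
    {m : M ⟶ N} [Mono m] (h : SameImage (j ≫ m) (j' ≫ m)) : SameImage j j' := by
  obtain ⟨e, he⟩ := h
  exact ⟨e, by rw [← cancel_mono m, Category.assoc, he]⟩

namespace GrassmannianBundle

variable {E : Z.Modules}

theorem exists_lift (G : GrassmannianBundle E l) {f : T ⟶ Z} {S : T.Modules}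
    {j : S ⟶ (Scheme.Modules.pullback f).obj E} (hj : IsSubbundle j l) :
    ∃ (g : T ⟶ G.scheme) (hg : g ≫ G.proj = f), SameImage (restrAlong hg G.incl) j := by
  obtain ⟨g, ⟨hg, e, he⟩, -⟩ := G.existsUnique_lift T f S j hj
  exact ⟨g, hg, e, he⟩

theorem lift_unique (G : GrassmannianBundle E l) {f : T ⟶ Z} {S : T.Modules}
    {j : S ⟶ (Scheme.Modules.pullback f).obj E} (hj : IsSubbundle j l) {g g' : T ⟶ G.scheme}
    {hg : g ≫ G.proj = f} {hg' : g' ≫ G.proj = f} (h : SameImage (restrAlong hg G.incl) j)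
    (h' : SameImage (restrAlong hg' G.incl) j) : g = g' :=
  (G.existsUnique_lift T f S j hj).unique ⟨hg, h⟩ ⟨hg', h'⟩

/-- Any two Grassmannian bundles of `E` are isomorphic. -/
theorem nonempty_iso (G G' : GrassmannianBundle E l) :
    Nonempty (Over.mk G.proj ≅ Over.mk G'.proj) := by
  obtain ⟨a, ha, ha'⟩ := G'.exists_lift G.isSubbundle
  obtain ⟨b, hb, hb'⟩ := G.exists_lift G'.isSubbundle
  have hab : (a ≫ b) ≫ G.proj = G.proj := by rw [Category.assoc, hb, ha]
  have hba : (b ≫ a) ≫ G'.proj = G'.proj := by rw [Category.assoc, ha, hb]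
  refine ⟨Over.isoMk ⟨a, b, ?_, ?_⟩ ha⟩
  · exact G.lift_unique G.isSubbundle (hg := hab) (hg' := Category.id_comp _)
      ((restrAlong_restrAlong hb ha hab _).symm.trans ((hb'.restrAlong ha).trans ha'))
      (restrAlong_id _)
  · exact G'.lift_unique G'.isSubbundle (hg := hba) (hg' := Category.id_comp _)
      ((restrAlong_restrAlong ha hb hba _).symm.trans ((ha'.restrAlong hb).trans hb'))
      (restrAlong_id _)

/-- Transport of a Grassmannian bundle along an isomorphism of bundles. -/
def congr (G : GrassmannianBundle E l) {E' : Z.Modules} (θ : E ≅ E') :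
    GrassmannianBundle E' l where
  scheme := G.scheme
  proj := G.proj
  taut := G.taut
  incl := G.incl ≫ (Scheme.Modules.pullback G.proj).map θ.hom
  isSubbundle := G.isSubbundle.comp_iso ((Scheme.Modules.pullback G.proj).mapIso θ)
  existsUnique_lift T f S j hj := by
    have hj' := hj.comp_iso ((Scheme.Modules.pullback f).mapIso θ.symm)
    have key (g : T ⟶ G.scheme) (hg : g ≫ G.proj = f) : SameImage
        (restrAlong hg (G.incl ≫ (Scheme.Modules.pullback G.proj).map θ.hom)) j ↔
        SameImage (restrAlong hg G.incl) (j ≫ ((Scheme.Modules.pullback f).mapIso θ.symm).hom) := by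
      rw [restrAlong_comp_map]
      constructor
      · intro h
        refine SameImage.trans (.of_eq ?_) (h.comp _)
        simp [← Functor.map_comp]
      · intro h
        refine (h.comp ((Scheme.Modules.pullback f).map θ.hom)).trans (.of_eq ?_)
        simp [← Functor.map_comp]
    obtain ⟨g, hg, h⟩ := G.exists_lift hj'
    exact ⟨g, ⟨hg, (key g hg).mpr h⟩, fun g' ⟨hg', h'⟩ => G.lift_unique hj' ((key g' hg').mp h') h⟩

/-- Subbundles induced by a morphism to the base change agree with those induced by its
projection. -/
theorem baseChange_incl_sameImage (G : GrassmannianBundle E l) (h : Y ⟶ Z) {f : T ⟶ Y}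
    {c : T ⟶ Z} (hc : f ≫ h = c) (g : T ⟶ Limits.pullback h G.proj)
    (hg : g ≫ Limits.pullback.fst h G.proj = f)
    (hg' : (g ≫ Limits.pullback.snd h G.proj) ≫ G.proj = c) :
    SameImage (restrAlong hg (restrAlong Limits.pullback.condition.symm G.incl ≫
      (pullbackIso (rfl : Limits.pullback.fst h G.proj ≫ h = _) E).inv) ≫ (pullbackIso hc E).hom)
      (restrAlong hg' G.incl) := by
  have h2 : g ≫ Limits.pullback.fst h G.proj ≫ h = c := by rw [← hc, ← hg, Category.assoc]
  refine SameImage.trans (.of_eq ?_)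
    (restrAlong_restrAlong Limits.pullback.condition.symm h2 hg' G.incl)
  rw [restrAlong, Category.assoc, ← pullbackIso_assoc rfl h2 hg hc,
    ← Functor.map_comp_assoc, Category.assoc, Iso.inv_hom_id, Category.comp_id]
  rfl

/-- Base change of a Grassmannian bundle. -/
def baseChange (G : GrassmannianBundle E l) (hE : IsVectorBundle E n) (h : Y ⟶ Z) :
    GrassmannianBundle ((Scheme.Modules.pullback h).obj E) l where
  scheme := Limits.pullback h G.proj
  proj := Limits.pullback.fst h G.proj
  taut := (Scheme.Modules.pullback (Limits.pullback.snd h G.proj)).obj G.taut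
  incl := restrAlong Limits.pullback.condition.symm G.incl ≫ (pullbackIso rfl E).inv
  isSubbundle := (G.isSubbundle.restrAlong _ hE).comp_iso (pullbackIso rfl E).symm
  existsUnique_lift T f S j hj := by
    have hj' := hj.comp_iso (pullbackIso (rfl : f ≫ h = _) E)
    have key (g : T ⟶ Limits.pullback h G.proj) (hg : g ≫ Limits.pullback.fst h G.proj = f)
        (hg' : (g ≫ Limits.pullback.snd h G.proj) ≫ G.proj = f ≫ h) : SameImage
        (restrAlong hg (restrAlong Limits.pullback.condition.symm G.incl ≫
          (pullbackIso (rfl : Limits.pullback.fst h G.proj ≫ h = _) E).inv)) j ↔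
        SameImage (restrAlong hg' G.incl) (j ≫ (pullbackIso rfl E).hom) := by
      have h4 := G.baseChange_incl_sameImage h rfl g hg hg'
      constructor
      · intro h5
        exact h4.symm.trans (h5.comp _)
      · intro h5
        exact SameImage.of_comp_mono (h4.trans h5)
    obtain ⟨g, hg, hg'⟩ := G.exists_lift hj'
    have hl := Limits.pullback.lift_snd f g hg.symm
    have hl' := Limits.pullback.lift_fst f g hg.symm
    have h5 : (Limits.pullback.lift f g hg.symm ≫ Limits.pullback.snd h G.proj) ≫ G.proj =
        f ≫ h := by rw [hl, hg]
    refine ⟨Limits.pullback.lift f g hg.symm, ⟨hl', (key _ hl' h5).mpr ?_⟩,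
      fun g' ⟨hfst, h'⟩ => ?_⟩
    · convert hg'
    · have h6 : (g' ≫ Limits.pullback.snd h G.proj) ≫ G.proj = f ≫ h := by
        rw [Category.assoc, ← Limits.pullback.condition, ← Category.assoc, hfst]
      have h7 := G.lift_unique hj' ((key g' hfst h6).mp h') hg'
      refine Limits.pullback.hom_ext ?_ ?_
      · exact hfst.trans hl'.symm
      · rw [h7, hl]

/-- The zero scheme of the composite of the tautological inclusion with an epimorphism is the
Grassmannian bundle of the kernel. -/
def ofKernel (G : GrassmannianBundle E l) {F N : Z.Modules} {r : ℕ} (hE : IsVectorBundle E n)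
    (hF : IsVectorBundle F r) {φ : E ⟶ F} (hφ : Epi φ) {k : N ⟶ E} {w : k ≫ φ = 0}
    (hk : Limits.IsLimit (Limits.KernelFork.ofι k w)) {Z₀ : Scheme.{u}} (i : Z₀ ⟶ G.scheme) (hm : Mono i)
    (hi : ∀ {T : Scheme.{u}} (g : T ⟶ G.scheme), (∃ h : T ⟶ Z₀, h ≫ i = g) ↔
      (Scheme.Modules.pullback g).map (G.incl ≫ (Scheme.Modules.pullback G.proj).map φ) = 0) :
    GrassmannianBundle N l :=
  have hk' {T : Scheme.{u}} (f : T ⟶ Z) : LocSplitMono ((Scheme.Modules.pullback f).map k) :=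
    (LocSplitMono.of_kernel hk hE hF).pullback f
  have hkm {T : Scheme.{u}} (f : T ⟶ Z) : Mono ((Scheme.Modules.pullback f).map k) := (hk' f).mono
  -- On `Z₀` the tautological subbundle of `E` is killed by `φ`, so it factors through the pulled
  -- back kernel. This factorization is the new tautological subbundle.
  let t := Limits.KernelFork.IsLimit.lift' (isLimitPullbackKernelFork hk (i ≫ G.proj))
    (restrAlong rfl G.incl) ((restrAlong_comp_eq_zero_iff rfl G.incl φ).mpr ((hi i).mp ⟨𝟙 _, Category.id_comp i⟩))
  have ht : t.1 ≫ (Scheme.Modules.pullback (i ≫ G.proj)).map k = restrAlong rfl G.incl := t.2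
  have hN : IsVectorBundle N (n - r) := hE.kernel hk hF
  { scheme := Z₀
    proj := i ≫ G.proj
    taut := (Scheme.Modules.pullback i).obj G.taut
    incl := t.1
    isSubbundle := by
      have h := G.isSubbundle.restrAlong (rfl : i ≫ G.proj = _) hE
      refine (isSubbundle_iff (hN.pullback _) _).mpr ⟨h.isVectorBundle, ?_⟩
      -- A local retraction onto the subbundle from the pullback of `E` restricts to one from the
      -- pullback of `N`.
      exact LocSplitMono.of_comp (by rw [ht]; exact h.locSplitMono (hE.pullback _))
    existsUnique_lift := fun T f S j hj => by
      have hjk : IsSubbundle (j ≫ (Scheme.Modules.pullback f).map k) l :=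
        (isSubbundle_iff (hE.pullback _) _).mpr
          ⟨hj.isVectorBundle, (hj.locSplitMono (hN.pullback _)).comp (hk' f)⟩
      have key (g : T ⟶ Z₀) (hg : g ≫ i ≫ G.proj = f) (hg' : (g ≫ i) ≫ G.proj = f) :
          SameImage (restrAlong hg t.1) j ↔
            SameImage (restrAlong hg' G.incl) (j ≫ (Scheme.Modules.pullback f).map k) := by
        have h1 : restrAlong hg t.1 ≫ (Scheme.Modules.pullback f).map k =
            restrAlong hg (restrAlong rfl G.incl) :=
          (restrAlong_comp_map hg t.1 k).symm.trans (congrArg (restrAlong hg) ht)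
        have h2 := restrAlong_restrAlong rfl hg hg' G.incl
        constructor
        · intro h
          exact h2.symm.trans ((SameImage.of_eq h1.symm).trans (h.comp _))
        · intro h
          exact SameImage.of_comp_mono ((SameImage.of_eq h1).trans (h2.trans h))
      obtain ⟨g, hg, hg'⟩ := G.exists_lift hjk
      -- A subbundle of `f^* N` is a subbundle of `f^* E` killed by `φ`, so its classifying morphism
      -- to `G` factors through `Z₀`.
      obtain ⟨h, rfl⟩ := (hi g).mpr ((restrAlong_comp_eq_zero_iff hg G.incl φ).mp (by
        obtain ⟨e, he⟩ := hg'
        rw [← he, Category.assoc, Category.assoc, ← Functor.map_comp, w]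
        simp))
      have hg2 : h ≫ i ≫ G.proj = f := by rw [← hg, Category.assoc]
      refine ⟨h, ⟨hg2, (key h hg2 hg).mpr hg'⟩, fun h' ⟨hp, hs⟩ => ?_⟩
      have hp' : (h' ≫ i) ≫ G.proj = f := by rw [Category.assoc, hp]
      exact (cancel_mono i).mp (G.lift_unique hjk ((key h' hp hp').mp hs) hg') }

end GrassmannianBundle

end GrassmannZero
end

/-! ### Vector bundles over a field as vector spaces. -/

noncomputable section
namespace GrassmannZero
variable {k : Type u} [Field k]

variable (k) in
/-- The functor sending a vector space to the constant sheaf on a point is fully faithful. -/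
def tildeFullyFaithful : (tilde.functor (CommRingCat.of k)).FullyFaithful :=
  tilde.fullyFaithfulFunctor (R := CommRingCat.of k)

theorem tilde_map_sum {V V' : ModuleCat.{u} (CommRingCat.of k)} {ι : Type*} (s : Finset ι)
    (f : ι → (V ⟶ V')) : (tilde.functor (.of k)).map (∑ i ∈ s, f i) =
      ∑ i ∈ s, (tilde.functor (.of k)).map (f i) := by
  classical
  induction s using Finset.induction_on with
  | empty => exact tilde.map_zero
  | insert a s ha ih =>
    rw [Finset.sum_insert ha, Finset.sum_insert ha, ← ih]
    exact tilde.map_add _ _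

variable (k) in
/-- The constant line bundle on a point is the structure sheaf. -/
def tildeUnitIso : (tilde.functor (.of k)).obj (ModuleCat.of (CommRingCat.of k) k) ≅
    structureModule (Spec (.of k)) := tildeSelf

/-- The basis of the constant bundle given by a basis of its fibre. -/
def Frame.tilde {V : ModuleCat.{u} (CommRingCat.of k)} {ι : Type*} [Fintype ι] (b : Module.Basis ι k V) :
    Frame ((tilde.functor (.of k)).obj V) ι where
  e i := (tildeUnitIso k).inv ≫ (tilde.functor (.of k)).map (ModuleCat.ofHom (LinearMap.toSpanSingleton k V (b i)))
  p i := (tilde.functor (.of k)).map (ModuleCat.ofHom (b.coord i)) ≫ (tildeUnitIso k).hom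
  e_p_self i := by
    have h : ModuleCat.ofHom (LinearMap.toSpanSingleton k V (b i)) ≫ ModuleCat.ofHom (b.coord i) =
        𝟙 (ModuleCat.of (CommRingCat.of k) k) := by
      ext; simp
    rw [Category.assoc, ← Functor.map_comp_assoc, h, CategoryTheory.Functor.map_id]
    simp
  e_p_ne i j hij := by
    have h : ModuleCat.ofHom (LinearMap.toSpanSingleton k V (b i)) ≫ ModuleCat.ofHom (b.coord j) =
        (0 : ModuleCat.of (CommRingCat.of k) k ⟶ ModuleCat.of (CommRingCat.of k) k) := by
      ext; simp [hij]
    have h0 : (tilde.functor (.of k)).map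
        (0 : ModuleCat.of (CommRingCat.of k) k ⟶ ModuleCat.of (CommRingCat.of k) k) = 0 :=
      tilde.map_zero
    rw [Category.assoc, ← Functor.map_comp_assoc, h, h0, Limits.zero_comp, Limits.comp_zero]
  total := by
    have h : ∑ i, ModuleCat.ofHom (b.coord i) ≫ ModuleCat.ofHom (LinearMap.toSpanSingleton k V (b i)) =
        𝟙 V := by
      ext v
      simp [ModuleCat.hom_sum]
    rw [← CategoryTheory.Functor.map_id, ← h, tilde_map_sum]
    refine Finset.sum_congr rfl fun i _ => ?_
    rw [Category.assoc, Iso.hom_inv_id_assoc, Functor.map_comp]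

theorem isVectorBundle_tilde (V : ModuleCat.{u} (CommRingCat.of k)) [Module.Finite k V] :
    IsVectorBundle ((tilde.functor (.of k)).obj V) (Module.finrank k V) :=
  (Frame.tilde (Module.finBasis k V)).isVectorBundle

theorem IsVectorBundle.nonempty_frame {M : (Spec (.of k)).Modules} {r : ℕ} (h : IsVectorBundle M r) :
    Nonempty (Frame M (Fin r)) := by
  obtain ⟨U, i, hi, hx, ⟨a⟩⟩ := h.hasFrameNear (default : PrimeSpectrum k)
  -- `Spec k` has a single point, so an open immersion that reaches it is an isomorphism.
  have : Surjective i := ⟨fun y => by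
    obtain ⟨z, hz⟩ := hx
    exact ⟨z, hz.trans (Subsingleton.elim (α := PrimeSpectrum k) _ _)⟩⟩
  have : IsIso i := (isIso_iff_isOpenImmersion_and_surjective i).mpr ⟨hi, this⟩
  exact ⟨((a.pullback (inv i)).congr (pullbackIso (IsIso.inv_hom_id i) M)).congr ((Scheme.Modules.pullbackId _).app M)⟩

/-- A vector bundle over a field is a vector space. -/
theorem IsVectorBundle.nonempty_tilde_iso {M : (Spec (.of k)).Modules} {r : ℕ} (h : IsVectorBundle M r) :
    Nonempty (M ≅ (tilde.functor (.of k)).obj (ModuleCat.of (CommRingCat.of k) (Fin r → k))) := by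
  obtain ⟨a⟩ := h.nonempty_frame
  exact ⟨a.iso (Frame.tilde (Pi.basisFun k (Fin r)))⟩

section Image

variable {V V' : ModuleCat.{u} (CommRingCat.of k)} {M M' : (Spec (.of k)).Modules}

/-- The subspace of `V` spanned by the image of a morphism to the constant sheaf. -/
def imageSubspace (t : M ⟶ (tilde.functor (.of k)).obj V) : Submodule k V :=
  LinearMap.range (ModuleCat.Hom.hom ((moduleSpecΓFunctor (R := .of k)).map t ≫
    (tilde.toTildeΓNatIso (R := .of k)).inv.app V))

theorem imageSubspace_iso_comp (e : M' ≅ M) (t : M ⟶ (tilde.functor (.of k)).obj V) :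
    imageSubspace (e.hom ≫ t) = imageSubspace t := by
  rw [imageSubspace, imageSubspace, Functor.map_comp, Category.assoc, ModuleCat.hom_comp]
  refine LinearMap.range_comp_of_range_eq_top _ (LinearMap.range_eq_top.mpr ?_)
  exact ((moduleSpecΓFunctor (R := .of k)).mapIso e).toLinearEquiv.surjective

theorem imageSubspace_comp_tilde (t : M ⟶ (tilde.functor (.of k)).obj V) (f : V ⟶ V') :
    imageSubspace (t ≫ (tilde.functor (.of k)).map f) = (imageSubspace t).map f.hom := by
  have h := (tilde.toTildeΓNatIso (R := .of k)).inv.naturality f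
  rw [imageSubspace, imageSubspace, Functor.map_comp, Category.assoc]
  refine (congrArg (fun g => LinearMap.range (ModuleCat.Hom.hom
    ((moduleSpecΓFunctor (R := .of k)).map t ≫ g))) h).trans ?_
  rw [← Category.assoc, ModuleCat.hom_comp, LinearMap.range_comp]
  rfl

theorem imageSubspace_tilde (f : V ⟶ V') :
    imageSubspace ((tilde.functor (.of k)).map f) = LinearMap.range f.hom := by
  have h : imageSubspace (𝟙 ((tilde.functor (.of k)).obj V)) = ⊤ := by
    rw [imageSubspace, CategoryTheory.Functor.map_id, Category.id_comp]
    exact LinearMap.range_eq_top.mpr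
      ((tilde.toTildeΓNatIso (R := .of k)).symm.app V).toLinearEquiv.surjective
  rw [← Category.id_comp ((tilde.functor (.of k)).map f), imageSubspace_comp_tilde, h,
    Submodule.map_top]

theorem SameImage.imageSubspace_eq {t : M ⟶ (tilde.functor (.of k)).obj V}
    {t' : M' ⟶ (tilde.functor (.of k)).obj V} (h : SameImage t t') :
    imageSubspace t = imageSubspace t' := by
  obtain ⟨e, rfl⟩ := h
  exact imageSubspace_iso_comp e t'

theorem IsVectorBundle.exists_eq_tilde {r : ℕ} (h : IsVectorBundle M r)
    (t : M ⟶ (tilde.functor (.of k)).obj V) :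
    ∃ (e : M ≅ (tilde.functor (.of k)).obj (ModuleCat.of (CommRingCat.of k) (Fin r → k)))
      (f : ModuleCat.of (CommRingCat.of k) (Fin r → k) ⟶ V), t = e.hom ≫ (tilde.functor (.of k)).map f := by
  obtain ⟨e⟩ := h.nonempty_tilde_iso
  exact ⟨e, (tildeFullyFaithful k).preimage (e.inv ≫ t), by
    rw [Functor.FullyFaithful.map_preimage, Iso.hom_inv_id_assoc]⟩

/-- Both sheaves come from vector spaces, and `tilde` is fully faithful, so factoring is a question
about linear maps. There the map onto the larger range splits. -/
theorem factors_iff_imageSubspace_le {r r' : ℕ} (h : IsVectorBundle M r) (h' : IsVectorBundle M' r')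
    (t : M ⟶ (tilde.functor (.of k)).obj V) (t' : M' ⟶ (tilde.functor (.of k)).obj V) :
    Factors t t' ↔ imageSubspace t ≤ imageSubspace t' := by
  obtain ⟨e, f, rfl⟩ := h.exists_eq_tilde t
  obtain ⟨e', f', rfl⟩ := h'.exists_eq_tilde t'
  rw [imageSubspace_iso_comp, imageSubspace_iso_comp, imageSubspace_tilde, imageSubspace_tilde]
  constructor
  · rintro ⟨s, hs⟩
    have h1 : (tildeFullyFaithful k).preimage (e.inv ≫ s ≫ e'.hom) ≫ f' = f := by
      apply (tildeFullyFaithful k).map_injective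
      rw [Functor.map_comp, Functor.FullyFaithful.map_preimage, Category.assoc, Category.assoc, hs,
        Iso.inv_hom_id_assoc]
    rw [← h1, ModuleCat.hom_comp]
    exact LinearMap.range_comp_le_range _ _
  · intro hle
    obtain ⟨g, hg⟩ := f'.hom.rangeRestrict.exists_rightInverse_of_surjective f'.hom.range_rangeRestrict
    let c := g ∘ₗ Submodule.inclusion hle ∘ₗ f.hom.rangeRestrict
    have hc : ModuleCat.ofHom c ≫ f' = f := by
      ext1
      exact LinearMap.ext fun v => congrArg Subtype.val
        (LinearMap.congr_fun hg (Submodule.inclusion hle (f.hom.rangeRestrict v)))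
    refine ⟨e.hom ≫ (tilde.functor (.of k)).map (ModuleCat.ofHom c) ≫ e'.inv, ?_⟩
    rw [Category.assoc, Category.assoc, Iso.inv_hom_id_assoc, ← Functor.map_comp, hc]

theorem finrank_imageSubspace {r : ℕ} (h : IsVectorBundle M r)
    (t : M ⟶ (tilde.functor (.of k)).obj V) [Mono t] : Module.finrank k (imageSubspace t) = r := by
  obtain ⟨e, f, rfl⟩ := h.exists_eq_tilde t
  rw [imageSubspace_iso_comp, imageSubspace_tilde]
  have : Mono ((tilde.functor (.of k)).map f) := by
    rw [← Iso.inv_hom_id_assoc e ((tilde.functor (.of k)).map f)]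
    infer_instance
  have hf : Mono f := ⟨fun a b hab => (tildeFullyFaithful k).map_injective
    ((cancel_mono ((tilde.functor (.of k)).map f)).mp (by rw [← Functor.map_comp, hab, Functor.map_comp]))⟩
  have h2 := LinearMap.finrank_range_of_inj ((ModuleCat.mono_iff_injective f).mp hf)
  exact h2.trans (Module.finrank_fin_fun k)

end Image

end GrassmannZero
end

/-! ### Existence, smoothness and local triviality of Grassmannian bundles. -/

noncomputable section
namespace GrassmannZero
variable {X Y Z T : Scheme.{u}} {n l : ℕ}

/-- Quasi-compactness, as a property of morphisms of schemes. -/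
abbrev quasiCompactMorphisms : MorphismProperty Scheme.{u} := @QuasiCompact

theorem smooth_pullback_fst (f : X ⟶ Z) (g : Y ⟶ Z) (h : Smooth g) :
    Smooth (Limits.pullback.fst f g) := MorphismProperty.pullback_fst (P := smoothMorphisms) _ _ h

theorem MorphismProperty.of_over_iso (P : MorphismProperty Scheme.{u}) [P.RespectsIso] {f : X ⟶ Z}
    {g : Y ⟶ Z} (e : Over.mk f ≅ Over.mk g) (h : P g) : P f := by
  let i : X ≅ Y := (Over.forget Z).mapIso e
  have h1 : i.hom ≫ g = f := Over.w e.hom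
  rw [← h1]
  exact (P.cancel_left_of_respectsIso _ _).mpr h

/-- The universal rank `l` subbundle of a framed bundle on the terminal scheme. -/
theorem exists_grassmannianBundle_terminal {E : (⊤_ Scheme.{u}).Modules} (a : Frame E (Fin n)) (l : ℕ) :
    ∃ G : GrassmannianBundle E l, Smooth G.proj ∧ QuasiCompact G.proj := by
  obtain ⟨G, x, h1, h2, h3⟩ := exists_universal l a
  have key {T : Scheme.{u}} {S : T.Modules} (g : T ⟶ G) (hg : g ≫ bang G = bang T)
      {j : S ⟶ (Scheme.Modules.pullback (bang T)).obj E} (hj : IsSubbundle j l) :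
      Subbundles.map a.isVectorBundle g x = Subbundles.mk j hj ↔ SameImage (restrAlong hg x.incl) j :=
    Subbundles.mk_eq_mk_iff _ _
  refine ⟨⟨G, bang G, x.sheaf, x.incl, x.isSubbundle, fun T f S j hj => ?_⟩, h2,
    (compactSpace_iff_quasiCompact G).mp h1⟩
  obtain rfl : f = bang T := Limits.terminal.hom_ext _ _
  obtain ⟨g, hg, hu⟩ := h3 T (Subbundles.mk j hj)
  exact ⟨g, ⟨Limits.terminal.comp_from g, (key g _ hj).mp hg⟩,
    fun g' ⟨hg', h'⟩ => hu g' ((key g' hg' hj).mpr h')⟩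

/-- The Grassmannian bundle of a trivial bundle exists. -/
theorem exists_grassmannianBundle {E : Z.Modules} (a : Frame E (Fin n)) (l : ℕ) :
    ∃ G : GrassmannianBundle E l, Smooth G.proj ∧ QuasiCompact G.proj := by
  let a₀ := Frame.ofFree (⊤_ Scheme.{u}) n
  obtain ⟨G, h1, h2⟩ := exists_grassmannianBundle_terminal a₀ l
  refine ⟨(G.baseChange a₀.isVectorBundle (bang Z)).congr ((a₀.pullback (bang Z)).iso a), ?_, ?_⟩
  · exact smooth_pullback_fst _ _ h1
  · exact inferInstanceAs (QuasiCompact (Limits.pullback.fst (bang Z) G.proj))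

/-- Uniqueness up to isomorphism over `Z` transfers the properties of the constructed model to an
arbitrary one. -/
theorem GrassmannianBundle.smooth_quasiCompact {E : Z.Modules} (a : Frame E (Fin n))
    (G : GrassmannianBundle E l) : Smooth G.proj ∧ QuasiCompact G.proj := by
  obtain ⟨G', h1, h2⟩ := exists_grassmannianBundle a l
  obtain ⟨e⟩ := G.nonempty_iso G'
  exact ⟨MorphismProperty.of_over_iso smoothMorphisms e h1,
    MorphismProperty.of_over_iso quasiCompactMorphisms e h2⟩

/-- The Grassmannian bundle of a vector bundle is locally isomorphic to the Grassmannian bundle of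
any trivial bundle of the same rank. -/
theorem GrassmannianBundle.exists_local_iso {N : Z.Modules} (G : GrassmannianBundle N l)
    (hN : IsVectorBundle N n) (q : Z ⟶ Y) {E : Y.Modules} (a : Frame E (Fin n))
    (G₀ : GrassmannianBundle E l) (z : Z) : ∃ V : Z.Opens, z ∈ V ∧
      Nonempty (Over.mk (Limits.pullback.snd G.proj V.ι) ≅
        Over.mk (Limits.pullback.fst (V.ι ≫ q) G₀.proj)) := by
  obtain ⟨U, i, hi, hz, ⟨b⟩⟩ := hN.hasFrameNear z
  let V := i.opensRange
  have hV : i.isoOpensRange.inv ≫ i = V.ι := Scheme.Hom.isoOpensRange_inv_comp i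
  let c : Frame ((Scheme.Modules.pullback V.ι).obj N) (Fin n) :=
    (b.pullback i.isoOpensRange.inv).congr (pullbackIso hV N)
  refine ⟨V, hz, ?_⟩
  obtain ⟨e⟩ := (G.baseChange hN V.ι).nonempty_iso
    ((G₀.baseChange a.isVectorBundle (V.ι ≫ q)).congr ((a.pullback (V.ι ≫ q)).iso c))
  let s : Over.mk (Limits.pullback.snd G.proj V.ι) ≅ Over.mk (Limits.pullback.fst V.ι G.proj) :=
    Over.isoMk (Limits.pullbackSymmetry G.proj V.ι) (Limits.pullbackSymmetry_hom_comp_fst _ _)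
  exact ⟨s ≪≫ e⟩

theorem GrassmannianBundle.smooth_proj {N : Z.Modules} (G : GrassmannianBundle N l)
    (hN : IsVectorBundle N n) : Smooth G.proj := by
  -- Locally on `Z` the bundle is pulled back from the terminal scheme, where smoothness comes from
  -- the charts.
  let a := Frame.ofFree (⊤_ Scheme.{u}) n
  obtain ⟨G₀, h, -⟩ := exists_grassmannianBundle a l
  choose V hV e using G.exists_local_iso hN (bang Z) a G₀
  let 𝒰 : Z.OpenCover := .mkOfCovers Z (fun z => (V z : Scheme.{u})) (fun z => (V z).ι)
    (fun z => ⟨z, ⟨z, hV z⟩, rfl⟩) (fun z => inferInstanceAs (IsOpenImmersion (V z).ι))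
  refine IsZariskiLocalAtTarget.of_openCover (P := smoothMorphisms) 𝒰 fun z => ?_
  obtain ⟨e⟩ := e z
  exact MorphismProperty.of_over_iso smoothMorphisms e (smooth_pullback_fst _ _ h)

section KernelSum

variable {C : Type*} [Category* C] [Preadditive C] [Limits.HasBinaryBiproducts C]

/-- If `B = A ⊞ D`, then the kernel of `B ⟶ D ⟶ F` is the sum of `A` and the kernel of `D ⟶ F`. -/
def isLimitKernelForkBiprodDesc {A B D F M : C} {s : A ⟶ B} {π : B ⟶ A} {σ : B ⟶ D} {τ : D ⟶ B}
    (h₁ : s ≫ π = 𝟙 A) (h₂ : τ ≫ σ = 𝟙 D) (h₃ : s ≫ σ = 0) (h₄ : τ ≫ π = 0)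
    (h₅ : π ≫ s + σ ≫ τ = 𝟙 B) {v : D ⟶ F} {κ : M ⟶ D} {w : κ ≫ v = 0}
    (hκ : Limits.IsLimit (Limits.KernelFork.ofι κ w)) :
    Limits.IsLimit (Limits.KernelFork.ofι (f := σ ≫ v) (Limits.biprod.desc s (κ ≫ τ)) (by
      apply Limits.biprod.hom_ext' <;> simp [reassoc_of% h₃, reassoc_of% h₂, w])) :=
  have : Mono κ := Limits.mono_of_isLimit_fork hκ
  have : Mono (Limits.biprod.desc s (κ ≫ τ)) := Preadditive.mono_of_cancel_zero _ fun t ht => by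
    have h6 : t ≫ Limits.biprod.fst = 0 := by
      have := congrArg (· ≫ π) ht
      simpa [Limits.biprod.desc_eq, h₁, h₄] using this
    have h7 : t ≫ Limits.biprod.snd = 0 := by
      have := congrArg (· ≫ σ) ht
      rw [← cancel_mono κ]
      simpa [Limits.biprod.desc_eq, h₂, h₃] using this
    apply Limits.biprod.hom_ext <;> simp [h6, h7]
  Limits.KernelFork.IsLimit.ofι' _ _ fun t ht =>
    ⟨Limits.biprod.lift (t ≫ π) (Limits.KernelFork.IsLimit.lift' hκ (t ≫ σ) (by simpa using ht)).1, by
      have h8 : (Limits.KernelFork.IsLimit.lift' hκ (t ≫ σ) (by simpa using ht)).1 ≫ κ = t ≫ σ :=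
        (Limits.KernelFork.IsLimit.lift' hκ (t ≫ σ) (by simpa using ht)).2
      rw [Limits.biprod.lift_desc, reassoc_of% h8, Category.assoc,
        ← Preadditive.comp_add, h₅, Category.comp_id]⟩

end KernelSum

end GrassmannZero
end

/-! ### The section `s`, its zero locus, and the `k`-points. -/

noncomputable section
namespace GrassmannZero
variable {k : Type u} [Field k] {Z : Scheme.{u}} (p : Z ⟶ Spec (.of k)) (F : Z.Modules) {r l : ℕ}
  {W : Type u} [AddCommGroup W] [Module k W]

/-- The composite `W ⊗ O → H⁰(Z, F) ⊗ O → F`. -/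
def sectionMap (σ : W →ₗ[k] (globalSections p).obj F) :
    (Scheme.Modules.pullback p).obj
      ((tilde.functor (.of k)).obj (ModuleCat.of (CommRingCat.of k) W)) ⟶ F :=
  (trivialBundle p).map (ModuleCat.ofHom σ) ≫ evaluation p F

theorem trivialBundle_map_add {V V' : ModuleCat.{u} (CommRingCat.of k)} (f g : V ⟶ V') :
    (trivialBundle p).map (f + g) = (trivialBundle p).map f + (trivialBundle p).map g :=
  (congrArg (Scheme.Modules.pullback p).map (tilde.map_add f g)).trans
    ((Scheme.Modules.pullback p).map_add)

theorem trivialBundle_map_zero (V V' : ModuleCat.{u} (CommRingCat.of k)) :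
    (trivialBundle p).map (0 : V ⟶ V') = 0 :=
  (congrArg (Scheme.Modules.pullback p).map tilde.map_zero).trans
    ((Scheme.Modules.pullback p).map_zero _ _)

/-- The right-hand side is the tautological inclusion of `Gr.baseChange` followed by the pullback of
`W ⊗ O → F`, the form to which `GrassmannianBundle.ofKernel` applies. -/
theorem boxSection_eq (Gr : Grassmannian k W l) (σ : W →ₗ[k] (globalSections p).obj F) :
    boxSection p F Gr σ = (restrAlong Limits.pullback.condition.symm Gr.incl ≫
      (pullbackIso (rfl : Limits.pullback.fst p Gr.proj ≫ p = _) _).inv) ≫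
        (Scheme.Modules.pullback (Limits.pullback.fst p Gr.proj)).map (sectionMap p F σ) := by
  have h := pullbackIso_inv_naturality_assoc (rfl : Limits.pullback.fst p Gr.proj ≫ p = _)
    ((tilde.functor (.of k)).map (ModuleCat.ofHom σ))
    ((Scheme.Modules.pullback (Limits.pullback.fst p Gr.proj)).map (evaluation p F))
  have h' : (Scheme.Modules.pullback (Limits.pullback.fst p Gr.proj)).map (sectionMap p F σ) =
      (Scheme.Modules.pullback (Limits.pullback.fst p Gr.proj)).map
        ((Scheme.Modules.pullback p).map ((tilde.functor (.of k)).map (ModuleCat.ofHom σ))) ≫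
      (Scheme.Modules.pullback (Limits.pullback.fst p Gr.proj)).map (evaluation p F) :=
    Functor.map_comp _ _ _
  rw [h', Category.assoc]
  refine Eq.trans ?_ (congrArg (restrAlong Limits.pullback.condition.symm Gr.incl ≫ ·) h).symm
  exact (Category.assoc _ _ _).symm

variable {p F} in
theorem epi_sectionMap (hgg : IsGloballyGenerated p F) {σ : W →ₗ[k] (globalSections p).obj F}
    (hσ : Function.Surjective σ) : Epi (sectionMap p F σ) := by
  obtain ⟨τ, hτ⟩ := σ.exists_rightInverse_of_surjective (LinearMap.range_eq_top.mpr hσ)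
  have h : ModuleCat.ofHom τ ≫ ModuleCat.ofHom σ = 𝟙 ((globalSections p).obj F) := by
    ext1; exact hτ
  have : IsSplitEpi ((trivialBundle p).map (ModuleCat.ofHom σ)) := IsSplitEpi.mk'
    ⟨(trivialBundle p).map (ModuleCat.ofHom τ), by
      rw [← Functor.map_comp, h, CategoryTheory.Functor.map_id]⟩
  exact @epi_comp _ _ _ _ _ _ (@IsSplitEpi.epi _ _ _ _ _ this) _ hgg

/-- The kernel of `W ⊗ O → F` is `K ⊗ O ⊕ M`. -/
theorem exists_isLimit_sectionMap {σ : W →ₗ[k] (globalSections p).obj F}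
    (hσ : Function.Surjective σ) :
    ∃ (κ : (trivialBundle p).obj (ModuleCat.of (CommRingCat.of k) (LinearMap.ker σ)) ⊞
        kernelBundle p F ⟶ (trivialBundle p).obj (ModuleCat.of (CommRingCat.of k) W))
      (w : κ ≫ sectionMap p F σ = 0),
      Nonempty (Limits.IsLimit (Limits.KernelFork.ofι κ w)) := by
  obtain ⟨τ, hτ⟩ := σ.exists_rightInverse_of_surjective (LinearMap.range_eq_top.mpr hσ)
  have hτ' (v) : σ (τ v) = v := LinearMap.congr_fun hτ v
  -- `v ↦ v - τ (σ v)` projects `W` onto `K` along the image of the section `τ`. It gives the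
  -- decomposition of `W` into `K` and `H⁰(Z, F)`.
  let π : W →ₗ[k] LinearMap.ker σ := (LinearMap.id - τ ∘ₗ σ).codRestrict _ fun v => by
    simp [hτ']
  let s := (trivialBundle p).map (ModuleCat.ofHom (LinearMap.ker σ).subtype)
  let π' := (trivialBundle p).map (ModuleCat.ofHom π)
  let τ' := (trivialBundle p).map (ModuleCat.ofHom τ)
  let σ' := (trivialBundle p).map (ModuleCat.ofHom σ)
  have hπs (v : LinearMap.ker σ) : π v = v := by
    ext
    simp [π, LinearMap.mem_ker.mp v.2]
  have h₁ : s ≫ π' = 𝟙 _ := ((trivialBundle p).map_comp _ _).symm.trans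
    ((congrArg _ (by ext1; exact LinearMap.ext hπs)).trans ((trivialBundle p).map_id _))
  have h₂ : τ' ≫ σ' = 𝟙 _ := ((trivialBundle p).map_comp _ _).symm.trans
    ((congrArg _ (by ext1; exact hτ)).trans ((trivialBundle p).map_id _))
  have h₃ : s ≫ σ' = 0 := ((trivialBundle p).map_comp _ _).symm.trans
    ((congrArg _ (by ext1; exact LinearMap.ext fun v => v.2)).trans (trivialBundle_map_zero p _ _))
  have h₄ : τ' ≫ π' = 0 := ((trivialBundle p).map_comp _ _).symm.trans
    ((congrArg _ (by
      ext1
      exact LinearMap.ext fun v => Subtype.ext (by simp [π, hτ']))).trans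
        (trivialBundle_map_zero p _ _))
  have h₅ : π' ≫ s + σ' ≫ τ' = 𝟙 _ := by
    have h : ModuleCat.ofHom π ≫ ModuleCat.ofHom (LinearMap.ker σ).subtype +
        ModuleCat.ofHom σ ≫ ModuleCat.ofHom τ = 𝟙 (ModuleCat.of (CommRingCat.of k) W) := by
      ext1
      exact LinearMap.ext fun v => by simp [π]
    refine Eq.trans ?_ ((congrArg (trivialBundle p).map h).trans ((trivialBundle p).map_id _))
    rw [trivialBundle_map_add, Functor.map_comp, Functor.map_comp]
  exact ⟨_, _, ⟨isLimitKernelForkBiprodDesc h₁ h₂ h₃ h₄ h₅ (w := Limits.kernel.condition _)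
    (Limits.kernelIsKernel (evaluation p F))⟩⟩

variable [Module.Finite k W]

/-- `Z × G(ℓ, W)` is of finite type over a field, hence Noetherian. These are the hypotheses under
which zero schemes have their universal property. -/
theorem prodGr_compactSpace_quasiSeparatedSpace (Gr : Grassmannian k W l) [LocallyOfFiniteType p] [QuasiCompact p] :
    CompactSpace (prodGr p Gr) ∧ QuasiSeparatedSpace (prodGr p Gr) := by
  obtain ⟨h1, h2⟩ := Gr.smooth_quasiCompact (Frame.tilde (Module.finBasis k W))
  have : CompactSpace Z := QuasiCompact.compactSpace_of_compactSpace p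
  refine ⟨QuasiCompact.compactSpace_of_compactSpace (Limits.pullback.fst p Gr.proj), ?_⟩
  have : IsLocallyNoetherian (prodGr p Gr) :=
    LocallyOfFiniteType.isLocallyNoetherian (Limits.pullback.fst p Gr.proj ≫ p)
  infer_instance

theorem exists_lift_zeroLocus (Gr : Grassmannian k W l) [LocallyOfFiniteType p] [QuasiCompact p]
    (hF : IsVectorBundle F r) (σ : W →ₗ[k] (globalSections p).obj F) {T : Scheme.{u}} (g : T ⟶ prodGr p Gr) :
    (∃ h : T ⟶ zeroLocus p F Gr σ, h ≫ zeroLocusι p F Gr σ = g) ↔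
      (Scheme.Modules.pullback g).map (boxSection p F Gr σ) = 0 := by
  obtain ⟨_, _⟩ := prodGr_compactSpace_quasiSeparatedSpace p Gr
  exact exists_lift_zeroIdeal (Gr.isSubbundle.isVectorBundle.pullback _) (hF.pullback _) _ g

/-- The zero locus is the Grassmannian bundle of `K ⊗ O ⊕ M`. -/
theorem exists_grassmannianBundle_zeroLocus [LocallyOfFiniteType p] [QuasiCompact p]
    (hF : IsVectorBundle F r) (hgg : IsGloballyGenerated p F)
    (Gr : Grassmannian k W l) {σ : W →ₗ[k] (globalSections p).obj F}
    (hσ : Function.Surjective σ) :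
    IsVectorBundle ((trivialBundle p).obj (ModuleCat.of (CommRingCat.of k) (LinearMap.ker σ)) ⊞
      kernelBundle p F) (Module.finrank k W - r) ∧
    ∃ G : GrassmannianBundle ((trivialBundle p).obj
        (ModuleCat.of (CommRingCat.of k) (LinearMap.ker σ)) ⊞ kernelBundle p F) l,
      Nonempty (Over.mk (zeroLocusProj p F Gr σ) ≅ Over.mk G.proj) := by
  have hW := isVectorBundle_tilde (ModuleCat.of (CommRingCat.of k) W)
  have hφ := epi_sectionMap hgg hσ
  obtain ⟨κ, w, ⟨hκ⟩⟩ := exists_isLimit_sectionMap p F hσ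
  have : Mono (zeroLocusι p F Gr σ) := inferInstanceAs (Mono (zeroIdeal (boxSection p F Gr σ)).subschemeι)
  -- The total space of `Gr.baseChange` is the product itself, and `GrassmannianBundle.ofKernel` is
  -- built on the zero locus. The required isomorphism is therefore the identity.
  refine ⟨@IsVectorBundle.kernel _ _ _ _ _ _ _ hφ _ _ hκ (hW.pullback p) hF,
    (Gr.baseChange hW p).ofKernel (hW.pullback p) hF hφ hκ (zeroLocusι p F Gr σ) this
      fun g => ?_, ⟨Iso.refl _⟩⟩
  exact (exists_lift_zeroLocus p F Gr hF σ g).trans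
    (Iff.of_eq (congrArg (fun t => (Scheme.Modules.pullback g).map t = 0) (boxSection_eq p F Gr σ)))

theorem fiberSubspace_eq {X : Scheme.{u}} (q : X ⟶ Spec (.of k)) {V : ModuleCat.{u} (CommRingCat.of k)}
    {S : X.Modules} (j : S ⟶ (trivialBundle q).obj V) (x : Spec (.of k) ⟶ X) (hx : x ≫ q = 𝟙 _) :
    fiberSubspace q j x hx = imageSubspace (restrAlong (E := (tilde.functor (.of k)).obj V) hx j ≫
      (Scheme.Modules.pullbackId _).hom.app ((tilde.functor (.of k)).obj V)) :=
  congrArg (imageSubspace (V := V)) (Category.assoc _ _ _).symm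

theorem mono_restrAlong_pullbackId {E : (Spec (.of k)).Modules} {n : ℕ} (hE : IsVectorBundle E n)
    (G : GrassmannianBundle E l) (u : Spec (.of k) ⟶ G.scheme) (hu : u ≫ G.proj = 𝟙 _) :
    Mono (restrAlong hu G.incl ≫ (Scheme.Modules.pullbackId _).hom.app E) := by
  have := (G.isSubbundle.restrAlong hu hE).mono
  infer_instance

variable {p F}

theorem finrank_fiberSubspace (Gr : Grassmannian k W l) (u : Spec (.of k) ⟶ Gr.scheme)
    (hu : u ≫ Gr.proj = 𝟙 _) : Module.finrank k (fiberSubspace Gr.proj Gr.incl u hu) = l := by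
  have hW := isVectorBundle_tilde (ModuleCat.of (CommRingCat.of k) W)
  have := mono_restrAlong_pullbackId hW Gr u hu
  have h := finrank_imageSubspace (Gr.isSubbundle.isVectorBundle.pullback u)
    (restrAlong hu Gr.incl ≫ (Scheme.Modules.pullbackId _).hom.app _)
  refine Eq.trans ?_ h
  exact congrArg (fun U : Submodule k W => Module.finrank k U)
    (fiberSubspace_eq Gr.proj Gr.incl u hu)

/-- The points of the Grassmannian are the subspaces. -/
theorem existsUnique_fiberSubspace_eq (Gr : Grassmannian k W l) (U : Submodule k W)
    (hU : Module.finrank k U = l) : ∃! u : Spec (.of k) ⟶ Gr.scheme, ∃ hu : u ≫ Gr.proj = 𝟙 _,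
      fiberSubspace Gr.proj Gr.incl u hu = U := by
  have hW := isVectorBundle_tilde (ModuleCat.of (CommRingCat.of k) W)
  let j : (tilde.functor (.of k)).obj (ModuleCat.of (CommRingCat.of k) U) ⟶
      (tilde.functor (.of k)).obj (ModuleCat.of (CommRingCat.of k) W) :=
    (tilde.functor (.of k)).map (ModuleCat.ofHom U.subtype)
  let θ := (Scheme.Modules.pullbackId (Spec (.of k))).app
    ((tilde.functor (.of k)).obj (ModuleCat.of (CommRingCat.of k) W))
  have hj : IsSplitMono j := by
    obtain ⟨ρ, hρ⟩ := U.subtype.exists_leftInverse_of_injective (Submodule.ker_subtype U)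
    refine IsSplitMono.mk' ⟨(tilde.functor (.of k)).map (ModuleCat.ofHom ρ), ?_⟩
    rw [← Functor.map_comp, ← CategoryTheory.Functor.map_id]
    exact congrArg _ (by ext1; exact hρ)
  have hjv : IsVectorBundle ((tilde.functor (.of k)).obj (ModuleCat.of (CommRingCat.of k) U)) l :=
    hU ▸ isVectorBundle_tilde (ModuleCat.of (CommRingCat.of k) U)
  have hjs : IsSubbundle j l := (isSubbundle_iff hW j).mpr ⟨hjv, LocSplitMono.of_isSplitMono j⟩
  have him : imageSubspace j = U := (imageSubspace_tilde _).trans U.range_subtype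
  -- Over a field equal image subspaces mean equal subsheaves, so prescribing the subspace is
  -- prescribing the subbundle, to which the universal property applies.
  have key (u : Spec (.of k) ⟶ Gr.scheme) (hu : u ≫ Gr.proj = 𝟙 _) :
      fiberSubspace Gr.proj Gr.incl u hu = U ↔
        SameImage (restrAlong hu Gr.incl) (j ≫ θ.symm.hom) := by
    have := mono_restrAlong_pullbackId hW Gr u hu
    have hv := Gr.isSubbundle.isVectorBundle.pullback u
    refine (Iff.of_eq (congrArg (· = U) (fiberSubspace_eq Gr.proj Gr.incl u hu))).trans ?_
    constructor
    · intro h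
      have h' := h.trans him.symm
      have h1 := Factors.sameImage ((factors_iff_imageSubspace_le hv hjv _ j).mpr h'.le)
        ((factors_iff_imageSubspace_le hjv hv j _).mpr h'.ge)
      refine SameImage.of_comp_mono (m := θ.hom) (h1.trans (.of_eq ?_))
      simp
    · intro h
      have h1 : SameImage (restrAlong hu Gr.incl ≫ θ.hom) j :=
        (h.comp θ.hom).trans (.of_eq (by simp))
      exact h1.imageSubspace_eq.trans him
  obtain ⟨u, hu, h⟩ := Gr.exists_lift (hjs.comp_iso θ.symm)
  refine ⟨u, ⟨hu, (key u hu).mpr h⟩, fun u' ⟨hu', h'⟩ => ?_⟩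
  exact Gr.lift_unique (hjs.comp_iso θ.symm) ((key u' hu').mp h') h

/-- If the ranges are nested, the base change of `i` to `S` is a surjective closed immersion into a
reduced scheme, hence an isomorphism. -/
theorem range_subset_range_iff_exists_lift {X Y S : Scheme.{u}} (i : Y ⟶ X) [IsClosedImmersion i]
    [IsReduced S] (q : S ⟶ X) : Set.range q ⊆ Set.range i ↔ ∃ h : S ⟶ Y, h ≫ i = q := by
  constructor
  · intro h
    have : Surjective (Limits.pullback.fst q i) := ⟨by
      rw [← Set.range_eq_univ, Scheme.Pullback.range_fst]
      exact Set.eq_univ_of_forall fun s => h ⟨s, rfl⟩⟩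
    have := isIso_of_isClosedImmersion_of_surjective (Limits.pullback.fst q i)
    refine ⟨inv (Limits.pullback.fst q i) ≫ Limits.pullback.snd q i, ?_⟩
    rw [Category.assoc, ← Limits.pullback.condition, IsIso.inv_hom_id_assoc]
  · rintro ⟨h, rfl⟩ _ ⟨s, rfl⟩
    exact ⟨h s, by simp⟩

/-- The fibre at a `k`-point of the constant bundle with fibre `V`. -/
def fiberIso (p : Z ⟶ Spec (.of k)) {x : Spec (.of k) ⟶ Z} (hx : x ≫ p = 𝟙 _)
    (E : (Spec (.of k)).Modules) :
    (Scheme.Modules.pullback x).obj ((Scheme.Modules.pullback p).obj E) ≅ E :=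
  pullbackIso hx E ≪≫ (Scheme.Modules.pullbackId _).app E

theorem fiberIso_naturality {x : Spec (.of k) ⟶ Z} (hx : x ≫ p = 𝟙 _)
    {E E' : (Spec (.of k)).Modules} (φ : E ⟶ E') :
    (Scheme.Modules.pullback x).map ((Scheme.Modules.pullback p).map φ) ≫ (fiberIso p hx E').hom =
      (fiberIso p hx E).hom ≫ φ := by
  have h := (Scheme.Modules.pullbackId (Spec (.of k))).hom.naturality φ
  simp only [fiberIso, Iso.trans_hom, Category.assoc, Iso.app_hom]
  rw [pullbackIso_naturality_assoc]
  exact congrArg _ h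

/-- A subbundle of a constant bundle is killed by a map at a point if its fibre lands in the fibre
of the kernel. -/
theorem comp_pullback_eq_zero_iff {V V' : ModuleCat.{u} (CommRingCat.of k)} [Module.Finite k V']
    (φ : V ⟶ V') (hF : IsVectorBundle F r)
    {ev : (Scheme.Modules.pullback p).obj ((tilde.functor (.of k)).obj V') ⟶ F} (hev : Epi ev)
    {K : Z.Modules} {κ : K ⟶ (Scheme.Modules.pullback p).obj ((tilde.functor (.of k)).obj V')}
    {w : κ ≫ ev = 0} (hκ : Limits.IsLimit (Limits.KernelFork.ofι κ w)) {x : Spec (.of k) ⟶ Z}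
    (hx : x ≫ p = 𝟙 _) {S : (Spec (.of k)).Modules} (hS : IsVectorBundle S l)
    (J : S ⟶ (Scheme.Modules.pullback x).obj
      ((Scheme.Modules.pullback p).obj ((tilde.functor (.of k)).obj V))) :
    J ≫ (Scheme.Modules.pullback x).map
        ((Scheme.Modules.pullback p).map ((tilde.functor (.of k)).map φ) ≫ ev) = 0 ↔
      (imageSubspace (J ≫ (fiberIso p hx _).hom)).map φ.hom ≤
        imageSubspace ((Scheme.Modules.pullback x).map κ ≫ (fiberIso p hx _).hom) := by
  have hH := (isVectorBundle_tilde V').pullback p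
  -- The kernel is locally a direct summand, so its fibre injects and is the kernel of the map on
  -- fibres at `x`.
  have hm : Mono ((Scheme.Modules.pullback x).map κ) :=
    ((LocSplitMono.of_kernel hκ hH hF).pullback x).mono
  have hK := (hH.kernel hκ hF).pullback x
  have h1 : (imageSubspace (J ≫ (fiberIso p hx _).hom)).map φ.hom =
      imageSubspace ((J ≫ (Scheme.Modules.pullback x).map
        ((Scheme.Modules.pullback p).map ((tilde.functor (.of k)).map φ))) ≫
          (fiberIso p hx _).hom) := by
    rw [← imageSubspace_comp_tilde, Category.assoc, Category.assoc, fiberIso_naturality]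
  rw [h1, ← factors_iff_imageSubspace_le hS hK, Functor.map_comp, ← Category.assoc]
  constructor
  · intro h
    obtain ⟨t, ht⟩ := Limits.KernelFork.IsLimit.lift' (isLimitPullbackKernelFork hκ x) _ h
    exact ⟨t, by rw [← ht]; simp⟩
  · rintro ⟨t, ht⟩
    rw [← Category.assoc, cancel_mono] at ht
    rw [← ht, Category.assoc, ← Functor.map_comp, w, Functor.map_zero, Limits.comp_zero]

/-- The fibre of `Z(s)` over `x`. -/
theorem range_subset_range_zeroLocusι_iff [LocallyOfFiniteType p] [QuasiCompact p]
    (hF : IsVectorBundle F r) (hgg : IsGloballyGenerated p F)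
    [Module.Finite k ((globalSections p).obj F)]
    (Gr : Grassmannian k W l) (σ : W →ₗ[k] (globalSections p).obj F)
    (x : Spec (.of k) ⟶ Z) (hx : x ≫ p = 𝟙 _) (u : Spec (.of k) ⟶ Gr.scheme)
    (hu : u ≫ Gr.proj = 𝟙 _) :
    Set.range (Limits.pullback.lift (f := p) (g := Gr.proj) x u (hx.trans hu.symm)) ⊆
        Set.range (zeroLocusι p F Gr σ) ↔
      (fiberSubspace Gr.proj Gr.incl u hu).map σ ≤ fiberSubspace p (kernelInclusion p F) x hx := by
  have hcl : IsClosedImmersion (zeroLocusι p F Gr σ) :=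
    inferInstanceAs (IsClosedImmersion (zeroIdeal (boxSection p F Gr σ)).subschemeι)
  have hH := (isVectorBundle_tilde ((globalSections p).obj F)).pullback p
  have hepi : Epi (evaluation p F) := hgg
  let q := Limits.pullback.lift (f := p) (g := Gr.proj) x u (hx.trans hu.symm)
  have hq₁ : q ≫ Limits.pullback.fst p Gr.proj = x := Limits.pullback.lift_fst _ _ _
  have hq₂ : q ≫ Limits.pullback.snd p Gr.proj = u := Limits.pullback.lift_snd _ _ _
  have hu' : (q ≫ Limits.pullback.snd p Gr.proj) ≫ Gr.proj = 𝟙 _ := by rw [hq₂, hu]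
  -- Lying in `Z(s)` becomes factoring through it, then vanishing of the pulled back section, then a
  -- composite of maps of vector spaces being zero.
  rw [range_subset_range_iff_exists_lift, exists_lift_zeroLocus p F Gr hF σ, boxSection_eq,
    ← restrAlong_comp_eq_zero_iff hq₁]
  set J := restrAlong hq₁ (restrAlong Limits.pullback.condition.symm Gr.incl ≫
      (pullbackIso (rfl : Limits.pullback.fst p Gr.proj ≫ p = _) _).inv)
  have hJ : SameImage (J ≫ (pullbackIso hx _).hom) (restrAlong hu' Gr.incl) :=
    Gr.baseChange_incl_sameImage p hx q hq₁ hu'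
  have h1 : imageSubspace (J ≫ (fiberIso p hx _).hom) = fiberSubspace Gr.proj Gr.incl u hu := by
    refine Eq.trans ?_ ((fiberSubspace_eq Gr.proj Gr.incl _ hu').symm.trans (by simp only [hq₂]))
    refine SameImage.imageSubspace_eq (SameImage.trans (.of_eq ?_) (hJ.comp _))
    exact (Category.assoc _ _ _).symm
  have h2 : imageSubspace ((Scheme.Modules.pullback x).map (kernelInclusion p F) ≫
      (fiberIso p hx _).hom) = fiberSubspace p (kernelInclusion p F) x hx := rfl
  rw [← h1, ← h2]
  exact comp_pullback_eq_zero_iff (ModuleCat.ofHom σ) hF hgg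
    (Limits.kernelIsKernel (evaluation p F)) (w := Limits.kernel.condition _) hx
    ((Gr.isSubbundle.isVectorBundle.pullback _).pullback _) J

end GrassmannZero
end

theorem mainTheorem4
    {k : Type u} [Field k] [IsAlgClosed k]
    -- a variety `Z` over `k`
    (Z : Scheme.{u}) (p : Z ⟶ Spec (.of k))
    [IsIntegral Z] [IsSeparated p] [LocallyOfFiniteType p] [QuasiCompact p]
    -- a globally generated vector bundle `F` of rank `r` with finite-dimensional `H⁰(Z, F)`
    (F : Z.Modules) (r : ℕ) (hF : GrassmannZero.IsVectorBundle F r)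
    (hgg : GrassmannZero.IsGloballyGenerated p F)
    [Module.Finite k ((GrassmannZero.globalSections p).obj F)]
    -- a vector space `W` of dimension at least `dim H⁰(Z, F)`, and `0 < l < dim W`
    (W : Type u) [AddCommGroup W] [Module k W] [Module.Finite k W]
    (hW : Module.finrank k ((GrassmannZero.globalSections p).obj F) ≤ Module.finrank k W)
    (l : ℕ) (hl : 0 < l) (hlW : l < Module.finrank k W)
    (σ : W →ₗ[k] (GrassmannZero.globalSections p).obj F) :
    -- the Grassmannian `G(l, W)` exists; below, `Gr` is any model of it
    Nonempty (GrassmannZero.Grassmannian k W l) ∧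
    ∀ Gr : GrassmannZero.Grassmannian k W l,
      -- its `k`-points are the `l`-dimensional subspaces of `W`
      (∀ U : Submodule k W, Module.finrank k U = l →
        ∃! u : Spec (.of k) ⟶ Gr.scheme, ∃ hu : u ≫ Gr.proj = 𝟙 _,
          GrassmannZero.fiberSubspace Gr.proj Gr.incl u hu = U) ∧
      (∀ (u : Spec (.of k) ⟶ Gr.scheme) (hu : u ≫ Gr.proj = 𝟙 _),
        Module.finrank k (GrassmannZero.fiberSubspace Gr.proj Gr.incl u hu) = l) ∧
      -- (1) a point `(x, U)` lies in `Z(s)` if and only if `σ(U) ⊆ M_x`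
      (∀ (x : Spec (.of k) ⟶ Z) (hx : x ≫ p = 𝟙 _)
        (u : Spec (.of k) ⟶ Gr.scheme) (hu : u ≫ Gr.proj = 𝟙 _),
        Set.range (Limits.pullback.lift (f := p) (g := Gr.proj) x u (hx.trans hu.symm)) ⊆
            Set.range (GrassmannZero.zeroLocusι p F Gr σ) ↔
          (GrassmannZero.fiberSubspace Gr.proj Gr.incl u hu).map σ ≤
            GrassmannZero.fiberSubspace p (GrassmannZero.kernelInclusion p F) x hx) ∧
      -- (2) if `σ` is surjective
      (Function.Surjective σ →
        -- `Z(s)` is smooth over `Z`, and smooth over `k` if `Z` is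
        Smooth (GrassmannZero.zeroLocusProj p F Gr σ) ∧
        (Smooth p → Smooth (GrassmannZero.zeroLocusProj p F Gr σ ≫ p)) ∧
        -- `Z(s)` is a locally trivial `G(l, w - r)`-bundle over `Z`
        (∃ G₀ : GrassmannZero.Grassmannian k (Fin (Module.finrank k W - r) → k) l,
          ∀ z : Z, ∃ V : Z.Opens, z ∈ V ∧
            Nonempty (
              Over.mk (Limits.pullback.snd (GrassmannZero.zeroLocusProj p F Gr σ) V.ι) ≅
                Over.mk (Limits.pullback.fst (V.ι ≫ p) G₀.proj))) ∧
        -- `K ⊗ O_Z ⊕ M` is a vector bundle of rank `w - r`, and `Z(s)` is isomorphic over `Z`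
        -- to its Grassmannian bundle
        GrassmannZero.IsVectorBundle
          ((GrassmannZero.trivialBundle p).obj (ModuleCat.of (CommRingCat.of k)
              (LinearMap.ker σ)) ⊞ GrassmannZero.kernelBundle p F)
          (Module.finrank k W - r) ∧
        ∃ G : GrassmannZero.GrassmannianBundle
            ((GrassmannZero.trivialBundle p).obj (ModuleCat.of (CommRingCat.of k)
              (LinearMap.ker σ)) ⊞ GrassmannZero.kernelBundle p F) l,
          Nonempty (Over.mk (GrassmannZero.zeroLocusProj p F Gr σ) ≅ Over.mk G.proj)) := by
  have hGr : Nonempty (GrassmannZero.Grassmannian k W l) := by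
    obtain ⟨G, -⟩ := GrassmannZero.exists_grassmannianBundle
      (GrassmannZero.Frame.tilde (V := ModuleCat.of (CommRingCat.of k) W) (Module.finBasis k W)) l
    exact ⟨G⟩
  refine ⟨hGr, fun Gr => ⟨fun U hU => GrassmannZero.existsUnique_fiberSubspace_eq Gr U hU,
    fun u hu => GrassmannZero.finrank_fiberSubspace Gr u hu,
    fun x hx u hu => GrassmannZero.range_subset_range_zeroLocusι_iff hF hgg Gr σ x hx u hu,
    fun hσ => ?_⟩⟩
  obtain ⟨hN, G, ⟨e⟩⟩ := GrassmannZero.exists_grassmannianBundle_zeroLocus p F hF hgg Gr hσ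
  have hsm : Smooth (GrassmannZero.zeroLocusProj p F Gr σ) :=
    GrassmannZero.MorphismProperty.of_over_iso GrassmannZero.smoothMorphisms e (G.smooth_proj hN)
  refine ⟨hsm, fun _ => inferInstance, ?_, hN, G, ⟨e⟩⟩
  let a := GrassmannZero.Frame.tilde
    (V := ModuleCat.of (CommRingCat.of k) (Fin (Module.finrank k W - r) → k)) (Pi.basisFun k _)
  -- The model fibre is built over `Spec k`, so local triviality of the bundle `K ⊗ O ⊕ M` compares
  -- `Z(s)` with the product of `V` and this Grassmannian.
  obtain ⟨G₀, -⟩ := GrassmannZero.exists_grassmannianBundle a l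
  refine ⟨G₀, fun z => ?_⟩
  obtain ⟨V, hz, ⟨e'⟩⟩ := G.exists_local_iso hN p a G₀ z
  exact ⟨V, hz, ⟨(Over.pullback V.ι).mapIso e ≪≫ e'⟩⟩
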